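/- **Setting.** An instance $I$ of a stochastic problem $\mathcal P$ has $n$ items with independent random outcomes $X_i\sim D_i$ in $[a,b]$, where the $D_i$ are arbitrary (discrete, continuous or mixed) probability distributions. A policy $\sigma$ is a decision tree: a node names the item to probe next and branches on the observed outcome, no item is probed twice on a path, and a leaf may carry a final decision. The objective $f(\sigma,x)$ depends only on the sequence of items probed by $\sigma$ under the realization $x\in[a,b]^n$, on their realizations, and on the final decision; it is measurable, and $0\le f(\sigma,x)\le f_{\max}$ for every policy in the set $\mathcal C$ of feasible policies. Put $f(\sigma|D)=\mathbb E_{x\sim D}[f(\sigma,x)]$, and let $\mathrm{OPT}_I(D)$ be the infimum (minimization problem) or the supremum (maximization problem) of $f(\sigma|D)$ over $\sigma\in\mathcal C$. $E$ stochastically dominates $D$ if $\Pr_{E_i}(X\ge t)\ge\Pr_{D_i}(X\ge t)$ for all $i$ and $t$. $\mathcal P$ is up-monotone if $\mathrm{OPT}_I(E)\le\mathrm{OPT}_I(D)$ for every instance $I$ and all $D,E$ such that $E$ stochastically dominates $D$, and down-monotone if always $\mathrm{OPT}_I(E)\ge\mathrm{OPT}_I(D)$ in this situation. A $k$-threshold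 policy ($k\ge1$) is a policy given by a tree in which each node partitions $[a,b]$ by $k-1$ thresholds into $k$ intervals and has one branch for each interval. *Assumption 1:* there is a finite $\mathrm{TV}_{\max}(f)\ge0$ such that for every feasible $k$-threshold policy $\sigma$ there are functions $f_{\sigma,\ell}:[a,b]^n\to\mathbb R$, one for each leaf $\ell$, such that $f(\sigma,x)=f_{\sigma,\ell}(x)$ whenever $x$ leads to $\ell$, and all one-dimensional slices of the $f_{\sigma,\ell}$ (all coordinates but one fixed) are continuous on $[a,b]$ and have total variation at most $\mathrm{TV}_{\max}(f)$. Running times count the steps of a uniform real-number machine (unit-cost field operations and comparisons of reals, constants $0,1$, pairing and projections of data). An $\alpha$-approximation algorithm via $k$-threshold policies ($\alpha\ge1$ for minimization, $0\le\alpha\le1$ for maximization) takes an instance together with finitely supported distributions $E_1,\dots,E_n$ on $[a,b]$, given as lists of outcomes with probabilities, and carries out a feasible $k$-threshold policy $\sigma$ with $f(\sigma|E)\le\alpha\,\mathrm{OPT}_I(E)$ (maximization: $f(\sigma|E)\ge\alpha\,\mathrm{OPT}_I(E)$): from the outcomes observed so far it computes the next item to probe, or the final decision, in time polynomial in the size of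 its input. Here $k$, $\alpha$, $f_{\max}$, $\mathrm{TV}_{\max}(f)$ may depend on the instance. In the online semi-bandit setting the $D_i$ are unknown. In each period $t=1,\dots,T$ a learning algorithm presents a feasible policy $\sigma^t$ that depends only on the observations in earlier periods; the realizations $x^t\sim D_1\times\dots\times D_n$ are independent over the periods, and the algorithm observes exactly the probed items of $\sigma^t$ and their outcomes. Its $\alpha$-regret is $\mathbb E\big[\sum_{t=1}^T f(\sigma^t,x^t)\big]-\alpha T\,\mathrm{OPT}_I(D)$ for minimization and the negative of this for maximization. **Theorem.** There is an absolute constant $C>0$ such that the following holds. Let $\mathcal P$ be a stochastic (minimization or maximization) problem that is up-monotone or down-monotone, satisfies Assumption 1, and has a polynomial-time $\alpha$-approximation algorithm via $k$-threshold policies. Then there is a polynomial-time semi-bandit learning algorithm for $\mathcal P$, which takes time polynomial in $n$, $T$ and the size of the description of the instance, such that for every instance, every $T$ with $nT\ge2$, and all distributions $D_1,\dots,D_n$ on $[a,b]$, the collected total $\sum_{t=1}^T f(\sigma^t,x^t)$ is integrable and the $\alpha$-regret is at most $$C\,k\,n\,\big(f_{\max}+\mathrm{TV}_{\max}(f)\big)\sqrt{T\log(nT)}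 .$$ -/

import Mathlib

open MeasureTheory
open scoped NNReal ENNReal

noncomputable section

namespace StochOpt

/-! ## Machine model: a real-number machine on pointer structures, with unit cost per operation -/

/-- Data handled by programs: binary trees whose leaves are `nil` or real numbers. -/
inductive Data : Type
  | nil : Data
  | num (r : ℝ) : Data
  | pair (a b : Data) : Data

namespace Data

def size : Data → ℕ
  | nil => 1
  | num _ => 1
  | pair a b => a.size + b.size + 1

def ofList : List Data → Data
  | [] => nil
  | a :: l => pair a (ofList l)

end Data

/-- The elementary operations. The only numerical constants are `0` and `1`; the arithmetic is that
of an ordered field. -/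
inductive Op : Type
  | skip | nil | zero | one | fst | snd | isPair | add | sub | mul | div | le

/-- Effect of an elementary operation. Operations applied to data of the wrong form give `nil`. In
tests `nil` stands for "false" and everything else for "true". -/
def Op.apply : Op → Data → Data
  | .skip, v => v
  | .nil, _ => .nil
  | .zero, _ => .num 0
  | .one, _ => .num 1
  | .fst, .pair a _ => a
  | .snd, .pair _ b => b
  | .isPair, .pair _ _ => .num 1
  | .add, .pair (.num r) (.num s) => .num (r + s)
  | .sub, .pair (.num r) (.num s) => .num (r - s)
  | .mul, .pair (.num r) (.num s) => .num (r * s)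
  | .div, .pair (.num r) (.num s) => .num (r / s)
  | .le, .pair (.num r) (.num s) => open Classical in if r ≤ s then .num 1 else .nil
  | _, _ => .nil

/-- Programs: elementary operations, composition (`seq f g` is `f` followed by `g`), pairing of
results, conditional, and the loop "while `c` holds do `f`". -/
inductive Prog : Type
  | op (o : Op) : Prog
  | seq (f g : Prog) : Prog
  | both (f g : Prog) : Prog
  | cond (c f g : Prog) : Prog
  | loop (c f : Prog) : Prog

/-- `Runs p u v t`: the program `p`, started on `u`, halts with result `v` after `t` steps. -/
inductive Runs : Prog → Data → Data → ℕ → Prop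
  | op (o : Op) (u : Data) : Runs (.op o) u (o.apply u) 1
  | seq {f g : Prog} {u v w : Data} {s t : ℕ} :
      Runs f u v s → Runs g v w t → Runs (.seq f g) u w (s + t + 1)
  | both {f g : Prog} {u v w : Data} {s t : ℕ} :
      Runs f u v s → Runs g u w t → Runs (.both f g) u (.pair v w) (s + t + 1)
  | condTrue {c f g : Prog} {u b v : Data} {s t : ℕ} :
      Runs c u b s → b ≠ .nil → Runs f u v t → Runs (.cond c f g) u v (s + t + 1)
  | condFalse {c f g : Prog} {u v : Data} {s t : ℕ} :
      Runs c u .nil s → Runs g u v t → Runs (.cond c f g) u v (s + t + 1)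
  | loopExit {c f : Prog} {u : Data} {s : ℕ} :
      Runs c u .nil s → Runs (.loop c f) u u (s + 1)
  | loopStep {c f : Prog} {u b v w : Data} {r s t : ℕ} :
      Runs c u b r → b ≠ .nil → Runs f u v s → Runs (.loop c f) v w t →
      Runs (.loop c f) u w (r + s + t + 1)

/-! ## Policies -/

/-- A policy for `n` items with outcomes in `X`, as a decision tree: a node names the item to probe
and has one branch for every outcome. A leaf may carry a final decision, coded by a number (for
instance, which of the probed items are kept). -/
inductive DecisionTree (n : ℕ) (X : Type) : Type
  | leaf (d : ℕ) : DecisionTree n X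
  | node (i : Fin n) (next : X → DecisionTree n X) : DecisionTree n X

namespace DecisionTree

variable {n : ℕ} {X : Type}

/-- The probed items, in order, together with their realizations, when the policy is executed under
the realization `x`. This is also the semi-bandit feedback. -/
def trace : DecisionTree n X → (Fin n → X) → List (Fin n × X)
  | leaf _, _ => []
  | node i next, x => (i, x i) :: (next (x i)).trace x

/-- The decision at the leaf reached under `x`. -/
def decision : DecisionTree n X → (Fin n → X) → ℕ
  | leaf d, _ => d
  | node i next, x => (next (x i)).decision x

/-- No item is probed twice on a path, and no item of `S` is probed at all. -/
def ProbesOnce : DecisionTree n X → Finset (Fin n) → Prop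
  | leaf _, _ => True
  | node i next, S => i ∉ S ∧ ∀ y, (next y).ProbesOnce (insert i S)

/-- `Executes ans σ h`: at every node of `σ`, reached with the list `h ++ …` of observations, the
answer "probe `i`" (coded `pair (num i) nil`) or "stop with decision `d`" (coded `num d`) given by
the node stands in the relation `ans` to the list of observations. -/
def Executes (ans : List (Fin n × X) → Data → Prop) :
    DecisionTree n X → List (Fin n × X) → Prop
  | leaf d, h => ans h (.num d)
  | node i next, h =>
      ans h (.pair (.num (i : ℕ)) .nil) ∧ ∀ y, (next y).Executes ans (h ++ [(i, y)])

end DecisionTree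

/-- A `k`-threshold policy. The monotone map `J` at a node is the partition of the (ordered) set of
outcomes by `k - 1` thresholds into the `k` consecutive intervals `J ⁻¹' {s}`, with an arbitrary
choice of the interval to which a threshold belongs; there is one branch for every interval. -/
inductive ThresholdTree (n k : ℕ) (X : Type) [Preorder X] : Type
  | leaf (d : ℕ) : ThresholdTree n k X
  | node (i : Fin n) (J : X →o Fin k) (next : Fin k → ThresholdTree n k X) : ThresholdTree n k X

namespace ThresholdTree

variable {n k : ℕ} {X : Type} [Preorder X]

def toTree : ThresholdTree n k X → DecisionTree n X
  | leaf d => .leaf d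
  | node i J next => .node i fun y => (next (J y)).toTree

/-- The leaf reached under `x`, named by the branches on the path that leads to it. -/
def leafOf : ThresholdTree n k X → (Fin n → X) → List (Fin k)
  | leaf _, _ => []
  | node i J next, x => J (x i) :: (next (J (x i))).leafOf x

end ThresholdTree

/-! ## Stochastic problems -/

/-- An instance with unknown item distributions: `n` items with outcomes in `[a, b]`, the feasible
policies, and the objective, which is a function of the sequence of probed items, their
realizations, and the decision at the leaf. `params` is the description of the objective and the
constraints that algorithms get to read. -/
structure Instance where
  n : ℕ
  a : ℝ
  b : ℝ
  hab : a ≤ b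
  params : Data
  feasible : Set (DecisionTree n (Set.Icc a b))
  cost : List (Fin n × Set.Icc a b) → ℕ → ℝ
  probesOnce : ∀ σ ∈ feasible, σ.ProbesOnce ∅
  measurable_cost : ∀ (s : List (Fin n)) (d : ℕ), s.Nodup →
    Measurable fun x : Fin n → Set.Icc a b => cost (s.map fun i => (i, x i)) d
  measurable_value : ∀ σ ∈ feasible,
    Measurable fun x : Fin n → Set.Icc a b => cost (σ.trace x) (σ.decision x)

namespace Instance

variable (I : Instance)

/-- Possible outcomes of an item. -/
abbrev X : Type := Set.Icc I.a I.b

/-- What is observed in one execution of a policy. -/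
abbrev Obs : Type := List (Fin I.n × I.X)

abbrev Policy : Type := DecisionTree I.n I.X

/-- The objective `f(σ, x)`. -/
def value (σ : I.Policy) (x : Fin I.n → I.X) : ℝ :=
  I.cost (σ.trace x) (σ.decision x)

/-- The expected objective `f(σ | D)` for independent items with distributions `D i`. -/
def expValue (D : Fin I.n → Measure I.X) (σ : I.Policy) : ℝ :=
  ∫ x, I.value σ x ∂Measure.pi D

/-- The objective takes values in `[0, fmax]`. -/
def Bounded (fmax : ℝ) : Prop :=
  ∀ σ ∈ I.feasible, ∀ x, 0 ≤ I.value σ x ∧ I.value σ x ≤ fmax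

/-- The assumption on the objective: on every feasible `k`-threshold policy `τ` it is given by leaf
functions `g ℓ : [a, b]^n → ℝ` (`ℓ` ranges over the leaves of `τ`), all of whose one-dimensional
slices are continuous and have total variation at most `V`. -/
def LeafRegular (k : ℕ) (V : ℝ≥0) : Prop :=
  ∀ τ : ThresholdTree I.n k I.X, τ.toTree ∈ I.feasible →
    ∃ g : List (Fin k) → (Fin I.n → I.X) → ℝ,
      (∀ ℓ x i, Continuous (fun y : I.X => g ℓ (Function.update x i y)) ∧
        eVariationOn (fun y : I.X => g ℓ (Function.update x i y)) Set.univ ≤ V) ∧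
      ∀ x, I.value τ.toTree x = g (τ.leafOf x) x

/-! ### Inputs of algorithms -/

def encObs (h : I.Obs) : Data :=
  .ofList (h.map fun o => .pair (.num (o.1 : ℕ)) (.num (o.2 : ℝ)))

def encDists (E : Fin I.n → List (I.X × ℝ)) : Data :=
  .ofList (List.ofFn fun i => .ofList ((E i).map fun p => .pair (.num (p.1 : ℝ)) (.num p.2)))

/-- Input of the offline algorithm: the instance, the distributions (as lists of outcomes with
probabilities), and the observations made so far in the current execution. -/
def offlineInput (E : Fin I.n → List (I.X × ℝ)) (h : I.Obs) : Data :=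
  .ofList [.num I.n, .num I.a, .num I.b, I.params, I.encDists E, I.encObs h]

/-- Input of the online algorithm: the instance, the number `T` of periods, the observations made
in the past periods, and the observations made so far in the current period. -/
def onlineInput (T : ℕ) (H : List I.Obs) (h : I.Obs) : Data :=
  .ofList [.num I.n, .num I.a, .num I.b, I.params, .num T, .ofList (H.map I.encObs), I.encObs h]

/-! ### Online execution -/

/-- Feedback of the first `t` periods under the realizations `x 0, x 1, …`, when `pol` chooses the
policy of each period from the feedback of the earlier ones. -/
def history (pol : List I.Obs → I.Policy) (x : ℕ → Fin I.n → I.X) : ℕ → List I.Obs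
  | 0 => []
  | t + 1 => history pol x t ++ [(pol (history pol x t)).trace (x t)]

/-- The total objective value collected in periods `0, …, T - 1`. -/
def total (pol : List I.Obs → I.Policy) (T : ℕ) (x : ℕ → Fin I.n → I.X) : ℝ :=
  ∑ t ∈ Finset.range T, I.value (pol (I.history pol x t)) (x t)

/-- In each of the `T` periods, whatever happened before, `pol` presents a feasible policy, and the
program `L` carries it out: from the observations it computes each next probe, or the final
decision, in at most `B` steps. (A period takes at most `n + 1` such computations.) -/
def Implements (L : Prog) (B T : ℕ) (pol : List I.Obs → I.Policy) : Prop :=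
  ∀ (x : ℕ → Fin I.n → I.X), ∀ t < T,
    pol (I.history pol x t) ∈ I.feasible ∧
    (pol (I.history pol x t)).Executes
      (fun h out => ∃ s ≤ B, Runs L (I.onlineInput T (I.history pol x t) h) out s) []

end Instance

/-- The discrete distribution described by a list of outcomes with their probabilities. -/
def distOf {X : Type} [MeasurableSpace X] (l : List (X × ℝ)) : Measure X :=
  (l.map fun p => ENNReal.ofReal p.2 • Measure.dirac p.1).sum

def IsDist {X : Type} (l : List (X × ℝ)) : Prop :=
  (∀ p ∈ l, 0 ≤ p.2) ∧ (l.map Prod.snd).sum = 1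

/-- `E` stochastically dominates `D`. -/
def Dominates {X : Type} [Preorder X] [MeasurableSpace X] (E D : Measure X) : Prop :=
  ∀ t : X, D (Set.Ici t) ≤ E (Set.Ici t)

/-- A stochastic problem: a class of instances, and whether one minimizes or maximizes. -/
structure StochasticProblem where
  instances : Set Instance
  maximize : Bool

namespace StochasticProblem

variable (P : StochasticProblem)

/-- The optimal expected objective `OPT_I(D)`. -/
def opt (I : Instance) (D : Fin I.n → Measure I.X) : ℝ :=
  if P.maximize then ⨆ σ : I.feasible, I.expValue D σ else ⨅ σ : I.feasible, I.expValue D σ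

def UpMonotone : Prop :=
  ∀ I ∈ P.instances, ∀ D E : Fin I.n → Measure I.X,
    (∀ i, IsProbabilityMeasure (D i)) → (∀ i, IsProbabilityMeasure (E i)) →
    (∀ i, Dominates (E i) (D i)) → P.opt I E ≤ P.opt I D

def DownMonotone : Prop :=
  ∀ I ∈ P.instances, ∀ D E : Fin I.n → Measure I.X,
    (∀ i, IsProbabilityMeasure (D i)) → (∀ i, IsProbabilityMeasure (E i)) →
    (∀ i, Dominates (E i) (D i)) → P.opt I D ≤ P.opt I E

/-- The convention on approximation ratios. -/
def IsRatio (α : ℝ) : Prop :=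
  if P.maximize then 0 ≤ α ∧ α ≤ 1 else 1 ≤ α

/-- `σ` is an `α`-approximate policy under `D`. -/
def IsApprox (I : Instance) (α : ℝ) (D : Fin I.n → Measure I.X) (σ : I.Policy) : Prop :=
  if P.maximize then α * P.opt I D ≤ I.expValue D σ else I.expValue D σ ≤ α * P.opt I D

/-- A polynomial-time `α`-approximation algorithm via `k`-threshold policies: given an instance with
finitely supported distributions, the program `A` carries out a feasible `α`-approximate
`k`-threshold policy, where it computes each next step in time polynomial in its input. -/
def HasApproxAlgorithm (k : Instance → ℕ) (α : Instance → ℝ) : Prop :=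
  ∃ (A : Prog) (p : Polynomial ℕ), ∀ I ∈ P.instances, ∀ E : Fin I.n → List (I.X × ℝ),
    (∀ i, IsDist (E i)) →
    ∃ τ : ThresholdTree I.n (k I) I.X, τ.toTree ∈ I.feasible ∧
      P.IsApprox I (α I) (fun i => distOf (E i)) τ.toTree ∧
      τ.toTree.Executes
        (fun h out => ∃ s ≤ p.eval (I.offlineInput E h).size, Runs A (I.offlineInput E h) out s) []

/-- The law of the realizations: independent over the periods and over the items. -/
def law (I : Instance) (D : Fin I.n → Measure I.X) [∀ i, IsProbabilityMeasure (D i)] :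
    Measure (ℕ → Fin I.n → I.X) :=
  Measure.infinitePi fun _ : ℕ => Measure.pi D

/-- The expected `α`-regret over `T` periods. -/
def regret (I : Instance) (α : ℝ) (D : Fin I.n → Measure I.X) [∀ i, IsProbabilityMeasure (D i)]
    (T : ℕ) (pol : List I.Obs → I.Policy) : ℝ :=
  if P.maximize then α * T * P.opt I D - ∫ x, I.total pol T x ∂law I D
  else (∫ x, I.total pol T x ∂law I D) - α * T * P.opt I D

end StochasticProblem

end StochOpt

end

noncomputable section

namespace StochOpt

/-! ## Determinism of the machine -/

/-! The algorithm is optimistic. By `exists_direction`, monotonicity means that moving mass towards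
one of the two endpoints can only improve the optimum. Let j = ⌈log₂(nT)⌉. Given m earlier samples
of an item, the estimate is the empirical distribution with about 3√(jm) of its least favorable
samples moved to the favorable endpoint. The offline algorithm runs on these estimates E in every
period.

Outside an event of small probability, the empirical distribution is within 3√(j/m) of the true D_i
in Kolmogorov-Smirnov distance. The shifted one is then at least as favorable as D_i and within
7√(j/m) of it (`shifted_spec`, `estimate_spec`). Hence, for minimization, the presented policy τ
satisfies f(τ|E) ≤ α OPT(E) ≤ α OPT(D), and only f(τ|D) − f(τ|E) has to be bounded.

The stability bound `ThresholdTree.abs_integral_sub_le` handles that difference. As a function of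
the outcome at a node, the expected continuation takes values in [0, F] and has variation at most V
on each of the k intervals. Changing the item's distribution by ε in Kolmogorov-Smirnov distance
therefore costs at most k(F + V)ε. Induction over the tree gives k(F + V) times the expected sum of
the radii of the probed items. This expectation is under D, so the radii are charged to probes that
really occur, and each such probe adds a sample. Since ∑ 1/√m telescopes to O(√T), every item
contributes O(√(jT)) in total (`sum_probedRadius_le`).

Samples are collected adaptively, so concentration comes from an exponential supermartingale
(`lintegral_expWeight_le`) and a union bound over finitely many test sets, which are enough to
control all upper sets up to 1/T (`abs_frequency_sub_le`).

Two further matters need proof. The transformation of inputs must run in polynomial time on the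
machine; `PolyTime` is a calculus of such computations. Moreover, the policies are obtained by
choice from an existence statement, so they need not depend measurably on the history. What is
probed and decided is nevertheless determined by a program, and programs compute measurable
functions (`measurableSet_runs`, `measurable_probes_decision`). -/

theorem Runs.det {p : Prog} {u v v' : Data} {s s' : ℕ} (h : Runs p u v s) (h' : Runs p u v' s') :
    v = v' := by
  induction h generalizing v' s' with
  | op o u => cases h'; rfl
  | seq _ _ ih₁ ih₂ =>
    cases h' with
    | seq h₁ h₂ => obtain rfl := ih₁ h₁; exact ih₂ h₂
  | both _ _ ih₁ ih₂ =>
    cases h' with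
    | both h₁ h₂ => rw [ih₁ h₁, ih₂ h₂]
  | condTrue _ hb _ ih₁ ih₂ =>
    cases h' with
    | condTrue h₁ _ h₂ => exact ih₂ h₂
    | condFalse h₁ _ => exact absurd (ih₁ h₁) hb
  | condFalse _ _ ih₁ ih₂ =>
    cases h' with
    | condTrue h₁ hb _ => exact absurd (ih₁ h₁).symm hb
    | condFalse _ h₂ => exact ih₂ h₂
  | loopExit _ ih₁ =>
    cases h' with
    | loopExit _ => rfl
    | loopStep h₁ hb _ _ => exact absurd (ih₁ h₁).symm hb
  | loopStep _ hb _ _ ih₁ ih₂ ih₃ =>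
    cases h' with
    | loopExit h₁ => exact absurd (ih₁ h₁) hb
    | loopStep _ _ h₂ h₃ => obtain rfl := ih₂ h₂; exact ih₃ h₃

/-! ## Families of computations in polynomial time -/

theorem eval_mono (q : Polynomial ℕ) {m n : ℕ} (h : m ≤ n) : q.eval m ≤ q.eval n := by
  rw [Polynomial.eval_eq_sum, Polynomial.eval_eq_sum]
  exact Finset.sum_le_sum fun i _ => Nat.mul_le_mul_left _ (Nat.pow_le_pow_left h i)

/-- One program computes `b i` from `a i` for every index `i`, in time polynomial in `N i`. -/
def PolyTime {ι : Type*} (N : ι → ℕ) (a b : ι → Data) : Prop :=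
  ∃ (p : Prog) (q : Polynomial ℕ), ∀ i, ∃ s ≤ q.eval (N i), Runs p (a i) (b i) s

/-- A quantity that is polynomially bounded in terms of `N`. -/
def PolyBdd {ι : Type*} (N c : ι → ℕ) : Prop := ∃ q : Polynomial ℕ, ∀ i, c i ≤ q.eval (N i)

/-- The truth values of the machine. -/
def Data.ofProp (P : Prop) : Data := open Classical in if P then .num 1 else .nil

theorem Data.ofProp_ne_nil {P : Prop} (h : P) : Data.ofProp P ≠ .nil := by
  simp [Data.ofProp, h]

theorem Data.ofProp_eq_nil {P : Prop} (h : ¬P) : Data.ofProp P = .nil := by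
  simp [Data.ofProp, h]

namespace PolyBdd

variable {ι : Type*} {N c d : ι → ℕ}

theorem self : PolyBdd N N := ⟨Polynomial.X, by simp⟩

theorem const (m : ℕ) : PolyBdd N fun _ => m := ⟨Polynomial.C m, by simp⟩

theorem add (hc : PolyBdd N c) (hd : PolyBdd N d) : PolyBdd N fun i => c i + d i := by
  obtain ⟨p, hp⟩ := hc
  obtain ⟨q, hq⟩ := hd
  exact ⟨p + q, fun i => by simpa using Nat.add_le_add (hp i) (hq i)⟩

theorem mul (hc : PolyBdd N c) (hd : PolyBdd N d) : PolyBdd N fun i => c i * d i := by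
  obtain ⟨p, hp⟩ := hc
  obtain ⟨q, hq⟩ := hd
  exact ⟨p * q, fun i => by simpa using Nat.mul_le_mul (hp i) (hq i)⟩

theorem mono (hd : PolyBdd N d) (h : ∀ i, c i ≤ d i) : PolyBdd N c := by
  obtain ⟨q, hq⟩ := hd
  exact ⟨q, fun i => (h i).trans (hq i)⟩

theorem comp {κ : Type*} (hc : PolyBdd N c) (f : κ → ι) : PolyBdd (fun k => N (f k)) fun k => c (f k) := by
  obtain ⟨q, hq⟩ := hc
  exact ⟨q, fun k => hq (f k)⟩

theorem eval (hc : PolyBdd N c) (p : Polynomial ℕ) : PolyBdd N fun i => p.eval (c i) := by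
  obtain ⟨q, hq⟩ := hc
  exact ⟨p.comp q, fun i => by simpa using eval_mono p (hq i)⟩

end PolyBdd

namespace PolyTime

variable {ι κ : Type*} {N : ι → ℕ} {a b c d : ι → Data} {x y : ι → ℝ} {P Q : ι → Prop}

theorem op (o : Op) : PolyTime N a fun i => o.apply (a i) :=
  ⟨.op o, 1, fun i => ⟨1, by simp, .op o (a i)⟩⟩

theorem refl : PolyTime N a a := op .skip

theorem trans (h₁ : PolyTime N a b) (h₂ : PolyTime N b c) : PolyTime N a c := by
  obtain ⟨p₁, q₁, h₁⟩ := h₁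
  obtain ⟨p₂, q₂, h₂⟩ := h₂
  refine ⟨.seq p₁ p₂, q₁ + q₂ + 1, fun i => ?_⟩
  obtain ⟨s, hs, hr⟩ := h₁ i
  obtain ⟨t, ht, hr'⟩ := h₂ i
  exact ⟨s + t + 1, by simp; omega, .seq hr hr'⟩

theorem pair (h₁ : PolyTime N a b) (h₂ : PolyTime N a c) :
    PolyTime N a fun i => .pair (b i) (c i) := by
  obtain ⟨p₁, q₁, h₁⟩ := h₁
  obtain ⟨p₂, q₂, h₂⟩ := h₂
  refine ⟨.both p₁ p₂, q₁ + q₂ + 1, fun i => ?_⟩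
  obtain ⟨s, hs, hr⟩ := h₁ i
  obtain ⟨t, ht, hr'⟩ := h₂ i
  exact ⟨s + t + 1, by simp; omega, .both hr hr'⟩

theorem reindex (h : PolyTime N a b) (f : κ → ι) :
    PolyTime (fun k => N (f k)) (fun k => a (f k)) fun k => b (f k) := by
  obtain ⟨p, q, h⟩ := h
  exact ⟨p, q, fun k => h (f k)⟩

theorem nil : PolyTime N a fun _ => .nil := by simpa [Op.apply] using op (N := N) (a := a) .nil

theorem zero : PolyTime N a fun _ => .num 0 := by simpa [Op.apply] using op (N := N) (a := a) .zero

theorem one : PolyTime N a fun _ => .num 1 := by simpa [Op.apply] using op (N := N) (a := a) .one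

theorem fst (h : PolyTime N a fun i => .pair (b i) (c i)) : PolyTime N a b := h.trans (op .fst)

theorem snd (h : PolyTime N a fun i => .pair (b i) (c i)) : PolyTime N a c := h.trans (op .snd)

theorem add (hx : PolyTime N a fun i => .num (x i)) (hy : PolyTime N a fun i => .num (y i)) :
    PolyTime N a fun i => .num (x i + y i) := (hx.pair hy).trans (op .add)

theorem sub (hx : PolyTime N a fun i => .num (x i)) (hy : PolyTime N a fun i => .num (y i)) :
    PolyTime N a fun i => .num (x i - y i) := (hx.pair hy).trans (op .sub)

theorem mul (hx : PolyTime N a fun i => .num (x i)) (hy : PolyTime N a fun i => .num (y i)) :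
    PolyTime N a fun i => .num (x i * y i) := (hx.pair hy).trans (op .mul)

theorem div (hx : PolyTime N a fun i => .num (x i)) (hy : PolyTime N a fun i => .num (y i)) :
    PolyTime N a fun i => .num (x i / y i) := (hx.pair hy).trans (op .div)

theorem le (hx : PolyTime N a fun i => .num (x i)) (hy : PolyTime N a fun i => .num (y i)) :
    PolyTime N a fun i => .ofProp (x i ≤ y i) := (hx.pair hy).trans (op .le)

theorem ite [DecidablePred P] (hP : PolyTime N a fun i => .ofProp (P i)) (h₁ : PolyTime N a b)
    (h₂ : PolyTime N a c) : PolyTime N a fun i => if P i then b i else c i := by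
  obtain ⟨p, q, h⟩ := hP
  obtain ⟨p₁, q₁, h₁⟩ := h₁
  obtain ⟨p₂, q₂, h₂⟩ := h₂
  refine ⟨.cond p p₁ p₂, q + q₁ + q₂ + 1, fun i => ?_⟩
  obtain ⟨s, hs, hr⟩ := h i
  by_cases hi : P i
  · obtain ⟨t, ht, hr'⟩ := h₁ i
    refine ⟨s + t + 1, by simp; omega, ?_⟩
    simp only [hi, if_true]
    exact .condTrue hr (Data.ofProp_ne_nil hi) hr'
  · obtain ⟨t, ht, hr'⟩ := h₂ i
    refine ⟨s + t + 1, by simp; omega, ?_⟩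
    simp only [hi, if_false]
    exact .condFalse (Data.ofProp_eq_nil hi ▸ hr) hr'

theorem not (hP : PolyTime N a fun i => .ofProp (P i)) : PolyTime N a fun i => .ofProp (¬P i) := by
  classical
  convert hP.ite nil one using 2 with i
  by_cases h : P i <;> simp [Data.ofProp, h]

theorem and (hP : PolyTime N a fun i => .ofProp (P i)) (hQ : PolyTime N a fun i => .ofProp (Q i)) :
    PolyTime N a fun i => .ofProp (P i ∧ Q i) := by
  classical
  convert hP.ite hQ nil using 2 with i
  by_cases h : P i <;> simp [Data.ofProp, h]

/-- A loop that runs through the states `S i 0, …, S i (m i)`. The states are accompanied by the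
environment `a i`. -/
theorem loop {m : ι → ℕ} (hm : PolyBdd N m) {S : ι → ℕ → Data}
    (h₀ : PolyTime N a fun i => S i 0)
    (htest : PolyTime (fun z : {z : ι × ℕ // z.2 ≤ m z.1} => N z.1.1)
      (fun z => .pair (a z.1.1) (S z.1.1 z.1.2)) fun z => .ofProp (z.1.2 < m z.1.1))
    (hstep : PolyTime (fun z : {z : ι × ℕ // z.2 < m z.1} => N z.1.1)
      (fun z => .pair (a z.1.1) (S z.1.1 z.1.2)) fun z => S z.1.1 (z.1.2 + 1)) :
    PolyTime N a fun i => S i (m i) := by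
  -- The loop body replaces the whole state, so it has to hand on the environment together with the
  -- new state.
  have hstep' := (PolyTime.refl (N := fun z : {z : ι × ℕ // z.2 < m z.1} => N z.1.1)
    (a := fun z => .pair (a z.1.1) (S z.1.1 z.1.2))).fst.pair hstep
  obtain ⟨r, hr⟩ := hm
  obtain ⟨p, q, ht⟩ := htest
  obtain ⟨p', q', hs⟩ := hstep'
  have key : PolyTime N (fun i => .pair (a i) (S i 0)) fun i => .pair (a i) (S i (m i)) := by
    refine ⟨.loop p p', r * (q + q' + 1) + q + 1, fun i => ?_⟩
    have : ∀ l j, j + l = m i → ∃ s ≤ l * ((q + q' + 1).eval (N i)) + q.eval (N i) + 1,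
        Runs (.loop p p') (.pair (a i) (S i j)) (.pair (a i) (S i (m i))) s := by
      intro l
      induction l with
      | zero =>
        intro j hj
        obtain rfl : j = m i := by omega
        obtain ⟨s, hs, hrun⟩ := ht ⟨(i, m i), le_rfl⟩
        dsimp only at hrun
        rw [Data.ofProp_eq_nil (lt_irrefl _)] at hrun
        exact ⟨s + 1, by simpa using hs, .loopExit hrun⟩
      | succ l ih =>
        intro j hj
        obtain ⟨s₁, hs₁, hrun₁⟩ := ht ⟨(i, j), show j ≤ m i by omega⟩
        obtain ⟨s₂, hs₂, hrun₂⟩ := hs ⟨(i, j), show j < m i by omega⟩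
        obtain ⟨s₃, hs₃, hrun₃⟩ := ih (j + 1) (by omega)
        refine ⟨s₁ + s₂ + s₃ + 1, ?_, .loopStep hrun₁ (Data.ofProp_ne_nil ?_) hrun₂ hrun₃⟩
        · simp only [Polynomial.eval_add, Polynomial.eval_one, add_mul, one_mul] at hs₁ hs₂ hs₃ ⊢
          omega
        · show j < m i
          omega
    obtain ⟨s, hs, hrun⟩ := this (m i) 0 (by omega)
    refine ⟨s, hs.trans ?_, hrun⟩
    simp only [Polynomial.eval_add, Polynomial.eval_mul, Polynomial.eval_one]
    gcongr
    exact hr i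
  exact ((refl.pair h₀).trans key).snd

/-- A loop over the entries of a list. -/
theorem foldList {l : ι → List Data} (hl : PolyBdd N fun i => (l i).length) {S : ι → ℕ → Data}
    (hlist : PolyTime N a fun i => .ofList (l i)) (h₀ : PolyTime N a fun i => S i 0)
    (hstep : PolyTime (fun z : {z : ι × ℕ // z.2 < (l z.1).length} => N z.1.1)
      (fun z => .pair (a z.1.1) (.pair ((l z.1.1)[z.1.2]'z.2) (S z.1.1 z.1.2)))
      fun z => S z.1.1 (z.1.2 + 1)) :
    PolyTime N a fun i => S i (l i).length := by
  refine (loop hl (S := fun i j => .pair (.ofList ((l i).drop j)) (S i j)) ?_ ?_ ?_).snd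
  · simpa using hlist.pair h₀
  · convert (PolyTime.refl (N := fun z : {z : ι × ℕ // z.2 ≤ (l z.1).length} => N z.1.1)
      (a := fun z => .pair (a z.1.1)
        (.pair (.ofList ((l z.1.1).drop z.1.2)) (S z.1.1 z.1.2)))).snd.fst.trans (op .isPair) using 2
      with z
    obtain ⟨⟨i, j⟩, hj⟩ := z
    by_cases h : j < (l i).length
    · dsimp only
      rw [List.drop_eq_getElem_cons h]
      simp [Data.ofList, Op.apply, Data.ofProp, h]
    · simp [List.drop_eq_nil_of_le (not_lt.1 h), Data.ofList, Op.apply, Data.ofProp, h]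
  · have e : ∀ z : {z : ι × ℕ // z.2 < (l z.1).length},
        Data.ofList ((l z.1.1).drop z.1.2)
          = .pair ((l z.1.1)[z.1.2]'z.2) (.ofList ((l z.1.1).drop (z.1.2 + 1))) := by
      intro z
      rw [List.drop_eq_getElem_cons z.2]
      rfl
    simp only [e]
    have r := PolyTime.refl (N := fun z : {z : ι × ℕ // z.2 < (l z.1).length} => N z.1.1)
      (a := fun z => .pair (a z.1.1) (.pair (.pair ((l z.1.1)[z.1.2]'z.2)
        (.ofList ((l z.1.1).drop (z.1.2 + 1)))) (S z.1.1 z.1.2)))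
    exact r.snd.fst.snd.pair ((r.fst.pair (r.snd.fst.fst.pair r.snd.snd)).trans hstep)

end PolyTime

/-! ## Shifted empirical distributions -/

section Estimate

variable {n : ℕ} {X : Type}

/-- The outcomes of item `i` recorded in a list of executions. -/
def samples (i : Fin n) (H : List (List (Fin n × X))) : List X :=
  H.foldl (fun acc o => o.foldl (fun acc p => if p.1 = i then p.2 :: acc else acc) acc) []

open Classical in
/-- One step of the search for a first element with respect to `rel`: the candidate and the elements
that were discarded. -/
def sweepStep (rel : X → X → Prop) (s : X × List X) (y : X) : X × List X :=
  if rel y s.1 then (y, s.1 :: s.2) else (s.1, y :: s.2)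

/-- Removes a first element with respect to `rel`. -/
def dropFirst (rel : X → X → Prop) : List X → List X
  | [] => []
  | x :: l => (l.foldl (sweepStep rel) (x, [])).2

theorem exists_trimCount (j m : ℕ) : ∃ r : ℕ, 9 * j * m ≤ r * r :=
  ⟨9 * j * m, Nat.le_mul_self _⟩

open Classical in
/-- The number of samples, out of `m`, that are moved to an endpoint. -/
def trimCount (j m : ℕ) : ℕ := min m (Nat.find (exists_trimCount j m))

/-- The empirical distribution of `l` with its `trimCount j l.length` first elements moved to `e`. -/
def shifted (rel : X → X → Prop) (j : ℕ) (e : X) (l : List X) : List (X × ℝ) :=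
  ((dropFirst rel)^[trimCount j l.length] l).foldl (fun acc y => (y, 1 / (l.length : ℝ)) :: acc)
    [(e, 1 - ((l.length : ℝ) - (trimCount j l.length : ℕ)) * (1 / (l.length : ℝ)))]

/-- The order of the outcomes, or its reverse. -/
def before [LE X] (dir : Bool) (y z : X) : Prop := if dir then y ≤ z else z ≤ y

theorem length_foldl_sweepStep (rel : X → X → Prop) (l : List X) (s : X × List X) :
    (l.foldl (sweepStep rel) s).2.length = s.2.length + l.length := by
  induction l generalizing s with
  | nil => simp
  | cons y l ih =>
    rw [List.foldl_cons, ih]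
    unfold sweepStep
    split <;> simp <;> omega

theorem length_dropFirst (rel : X → X → Prop) (l : List X) :
    (dropFirst rel l).length = l.length - 1 := by
  cases l with
  | nil => rfl
  | cons x l => simp [dropFirst, length_foldl_sweepStep]

theorem length_iterate_dropFirst (rel : X → X → Prop) (l : List X) (r : ℕ) :
    ((dropFirst rel)^[r] l).length = l.length - r := by
  induction r with
  | zero => simp
  | succ r ih => rw [Function.iterate_succ_apply', length_dropFirst, ih]; omega

/-- This is the test of the trimming loop. Since r * r grows with r, the minimality in `Nat.find`
reduces to a condition on the current r alone. -/
theorem lt_trimCount_iff {j m r : ℕ} : r < trimCount j m ↔ r < m ∧ r * r < 9 * j * m := by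
  classical
  unfold trimCount
  rw [lt_min_iff, Nat.lt_find_iff]
  refine and_congr_right fun _ => ⟨fun h => not_le.1 (h r le_rfl), fun h s hs hle => ?_⟩
  have := Nat.mul_le_mul hs hs
  omega

theorem trimCount_le (j m : ℕ) : trimCount j m ≤ m := min_le_left _ _

end Estimate

namespace Instance

variable (I : Instance)

/-- The endpoint to which mass is moved. -/
def endpoint (dir : Bool) : I.X :=
  if dir then ⟨I.b, Set.right_mem_Icc.2 I.hab⟩ else ⟨I.a, Set.left_mem_Icc.2 I.hab⟩

/-- The distributions on which the offline algorithm is run, after the observations `H`. -/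
def estimate (dir : Bool) (T : ℕ) (H : List I.Obs) (i : Fin I.n) : List (I.X × ℝ) :=
  shifted (before dir) (Nat.clog 2 (I.n * T)) (I.endpoint dir) (samples i H)

end Instance

/-! ### Polynomial-time computation of the shifted empirical distributions -/

namespace PolyTime

variable {ι : Type*} {N : ι → ℕ} {a : ι → Data}

/-- A loop that folds a function over a list. -/
theorem foldl {β σ : ι → Type*} (e : ∀ i, β i → Data) (E : ∀ i, σ i → Data)
    {l : ∀ i, List (β i)} {s₀ : ∀ i, σ i} {f : ∀ i, σ i → β i → σ i}
    (hl : PolyBdd N fun i => (l i).length)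
    (hlist : PolyTime N a fun i => .ofList ((l i).map (e i)))
    (h₀ : PolyTime N a fun i => E i (s₀ i))
    (hstep : PolyTime (fun z : {z : Σ i, σ i × β i // z.2.2 ∈ l z.1} => N z.1.1)
      (fun z => .pair (a z.1.1) (.pair (e _ z.1.2.2) (E _ z.1.2.1)))
      fun z => E _ (f _ z.1.2.1 z.1.2.2)) :
    PolyTime N a fun i => E i ((l i).foldl (f i) (s₀ i)) := by
  have := foldList (N := N) (a := a) (l := fun i => (l i).map (e i))
    (S := fun i j => E i (((l i).take j).foldl (f i) (s₀ i))) (by simpa using hl) hlist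
    (by simpa using h₀) ?_
  · simpa using this
  · have hlt : ∀ z : {z : ι × ℕ // z.2 < ((l z.1).map (e z.1)).length},
        z.1.2 < (l z.1.1).length := fun z => by simpa using z.2
    convert hstep.reindex fun z : {z : ι × ℕ // z.2 < ((l z.1).map (e z.1)).length} =>
      ⟨⟨z.1.1, ((l z.1.1).take z.1.2).foldl (f z.1.1) (s₀ z.1.1), (l z.1.1)[z.1.2]'(hlt z)⟩,
        List.getElem_mem _⟩ using 2 with z z
    · simp
    · rw [List.take_add_one, List.getElem?_eq_getElem (hlt z),
        Option.toList_some, List.foldl_append, List.foldl_cons, List.foldl_nil]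

variable {I : ι → Instance}

/-- The code of a list of outcomes. -/
def _root_.StochOpt.Instance.encList (I : Instance) (l : List I.X) : Data :=
  .ofList (l.map fun y : I.X => .num (y : ℝ))

/-- The code of a distribution. -/
def _root_.StochOpt.Instance.encDist (I : Instance) (l : List (I.X × ℝ)) : Data :=
  .ofList (l.map fun p => .pair (.num (p.1 : ℝ)) (.num p.2))

theorem before {dir : Bool} {y z : ∀ k, (I k).X} (hy : PolyTime N a fun k => .num (y k : ℝ))
    (hz : PolyTime N a fun k => .num (z k : ℝ)) :
    PolyTime N a fun k => .ofProp (before dir (y k) (z k)) := by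
  cases dir
  · simpa [StochOpt.before] using hz.le hy
  · simpa [StochOpt.before] using hy.le hz

theorem natEq {x y : ι → ℕ} (hx : PolyTime N a fun k => .num (x k))
    (hy : PolyTime N a fun k => .num (y k)) : PolyTime N a fun k => .ofProp (x k = y k) := by
  have := (hx.le hy).and (hy.le hx)
  simpa only [Nat.cast_le, ← le_antisymm_iff] using this

theorem length {l : ∀ k, List (I k).X} (hl : PolyBdd N fun k => (l k).length)
    (hlist : PolyTime N a fun k => (I k).encList (l k)) :
    PolyTime N a fun k => .num ((l k).length : ℕ) := by
  have := foldl (N := N) (a := a) (β := fun k => (I k).X) (σ := fun _ => ℕ)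
    (fun k (y : (I k).X) => .num (y : ℝ)) (fun _ c => .num c) (l := l) (s₀ := fun _ => 0)
    (f := fun _ c _ => c + 1) hl hlist (by simpa using zero) ?_
  · simpa using this
  · simpa using refl.snd.snd.add one

theorem samples {i : ∀ k, Fin (I k).n} {H : ∀ k, List (I k).Obs}
    (hH : PolyBdd N fun k => (H k).length) {w : ι → ℕ} (hw : PolyBdd N w)
    (hlen : ∀ k, ∀ o ∈ H k, o.length ≤ w k)
    (hi : PolyTime N a fun k => .num (i k : ℕ))
    (hlist : PolyTime N a fun k => .ofList ((H k).map (I k).encObs)) :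
    PolyTime N a fun k => (I k).encList (samples (i k) (H k)) := by
  refine foldl (N := N) (a := a) (β := fun k => (I k).Obs) (σ := fun k => List (I k).X)
    (fun k => (I k).encObs) (fun k => (I k).encList) hH hlist nil ?_
  refine foldl
    (ι := {z : Σ k, List (I k).X × (I k).Obs // z.2.2 ∈ H z.1})
    (β := fun z => Fin (I z.1.1).n × (I z.1.1).X) (σ := fun z => List (I z.1.1).X)
    (fun z o => .pair (.num (o.1 : ℕ)) (.num (o.2 : ℝ))) (fun z => (I z.1.1).encList)
    (l := fun z => z.1.2.2) (s₀ := fun z => z.1.2.1)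
    (f := fun z acc p => if p.1 = i z.1.1 then p.2 :: acc else acc)
    ((hw.comp _).mono fun z => hlen _ _ z.2) refl.snd.fst refl.snd.snd ?_
  set κ := {z : Σ z : {z : Σ k, List (I k).X × (I k).Obs // z.2.2 ∈ H z.1},
    List (I z.1.1).X × (Fin (I z.1.1).n × (I z.1.1).X) // z.2.2 ∈ z.1.1.2.2}
  have h₁ : PolyTime (fun z : κ => N z.1.1.1.1) _ _ :=
    refl (a := fun z : κ => .pair (.pair (a z.1.1.1.1) (.pair ((I z.1.1.1.1).encObs z.1.1.1.2.2)
      ((I z.1.1.1.1).encList z.1.1.1.2.1))) (.pair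
      (.pair (.num (z.1.2.2.1 : ℕ)) (.num (z.1.2.2.2 : ℝ))) ((I z.1.1.1.1).encList z.1.2.1)))
  have h₂ := h₁.fst.fst.trans (hi.reindex fun z : κ => z.1.1.1.1)
  have h₃ := (h₁.snd.fst.fst.natEq h₂).ite (h₁.snd.fst.snd.pair h₁.snd.snd) h₁.snd.snd
  simp only [Fin.val_inj] at h₃
  convert h₃ using 2 with z
  split <;> rfl

theorem dropFirst {dir : Bool} {l : ∀ k, List (I k).X} (hl : PolyBdd N fun k => (l k).length)
    (hne : ∀ k, l k ≠ []) (hlist : PolyTime N a fun k => (I k).encList (l k)) :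
    PolyTime N a fun k => (I k).encList (dropFirst (StochOpt.before dir) (l k)) := by
  choose x t hxt using fun k => List.exists_cons_of_ne_nil (hne k)
  obtain rfl : l = fun k => x k :: t k := funext hxt
  have h := foldl (N := N) (a := a) (β := fun k => (I k).X) (σ := fun k => (I k).X × List (I k).X)
    (fun k (y : (I k).X) => .num (y : ℝ)) (fun k s => .pair (.num (s.1 : ℝ)) ((I k).encList s.2)) (l := t)
    (s₀ := fun k => (x k, [])) (f := fun k => sweepStep (StochOpt.before dir))
    (hl.mono fun k => by simp) hlist.snd (hlist.fst.pair nil) ?_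
  · exact h.snd
  set κ := {z : Σ k, ((I k).X × List (I k).X) × (I k).X // z.2.2 ∈ t z.1}
  have h₁ : PolyTime (fun z : κ => N z.1.1) _ _ :=
    refl (a := fun z : κ => .pair (a z.1.1) (.pair (.num (z.1.2.2 : ℝ))
      (.pair (.num (z.1.2.1.1 : ℝ)) ((I z.1.1).encList z.1.2.1.2))))
  classical
  have h₂ := (before (dir := dir) (I := fun z : κ => I z.1.1) (y := fun z => z.1.2.2)
    (z := fun z => z.1.2.1.1) h₁.snd.fst h₁.snd.snd.fst).ite
      (h₁.snd.fst.pair (h₁.snd.snd.fst.pair h₁.snd.snd.snd))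
      (h₁.snd.snd.fst.pair (h₁.snd.fst.pair h₁.snd.snd.snd))
  convert h₂ using 2 with z
  unfold sweepStep
  split <;> simp_all [Instance.encList, Data.ofList]

theorem nine : PolyTime N a fun _ => .num 9 := by
  have h := (one (N := N) (a := a)).add (one.add one)
  convert h.mul h using 3
  norm_num

theorem isCons {l : ∀ k, List (I k).X} (hlist : PolyTime N a fun k => (I k).encList (l k)) :
    PolyTime N a fun k => .ofProp (l k ≠ []) := by
  convert hlist.trans (op .isPair) using 2 with k
  rcases h : l k with _ | ⟨x, t⟩ <;> simp [Instance.encList, Data.ofList, Op.apply, Data.ofProp]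

/-- The machine has no square root. The number of samples to move is found by counting up while
samples remain and r * r < 9 * j * m, with one sample removed per round. -/
theorem trim {dir : Bool} {l : ∀ k, List (I k).X} (hl : PolyBdd N fun k => (l k).length)
    {j : ι → ℕ} (hj : PolyTime N a fun k => .num (j k))
    (hlist : PolyTime N a fun k => (I k).encList (l k)) :
    PolyTime N a fun k => .pair ((I k).encList
      ((StochOpt.dropFirst (StochOpt.before dir))^[trimCount (j k) (l k).length] (l k)))
        (.num (trimCount (j k) (l k).length : ℕ)) := by
  have hm := length hl hlist
  refine loop (hl.mono fun k => trimCount_le _ _) (S := fun k r =>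
    .pair ((I k).encList ((StochOpt.dropFirst (StochOpt.before dir))^[r] (l k))) (.num r))
    (by simpa using hlist.pair zero) ?_ ?_
  · set κ := {z : ι × ℕ // z.2 ≤ trimCount (j z.1) (l z.1).length}
    have h₁ : PolyTime (fun z : κ => N z.1.1) _ _ :=
      refl (a := fun z : κ => .pair (a z.1.1) (.pair ((I z.1.1).encList
        ((StochOpt.dropFirst (StochOpt.before dir))^[z.1.2] (l z.1.1))) (.num z.1.2)))
    have h₂ := h₁.fst.trans (((nine.mul hj).mul hm).reindex fun z : κ => z.1.1)
    have h₃ := (isCons (I := fun z : κ => I z.1.1) h₁.snd.fst).and (h₂.le (h₁.snd.snd.mul h₁.snd.snd)).not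
    convert h₃ using 3 with z
    rw [lt_trimCount_iff, not_le, ← List.length_pos_iff, length_iterate_dropFirst]
    refine and_congr (by omega) ?_
    exact_mod_cast Iff.rfl
  · set κ := {z : ι × ℕ // z.2 < trimCount (j z.1) (l z.1).length}
    have h₁ : PolyTime (fun z : κ => N z.1.1) _ _ :=
      refl (a := fun z : κ => .pair (a z.1.1) (.pair ((I z.1.1).encList
        ((StochOpt.dropFirst (StochOpt.before dir))^[z.1.2] (l z.1.1))) (.num z.1.2)))
    have h₂ := dropFirst (dir := dir) (I := fun z : κ => I z.1.1)
      (l := fun z => (StochOpt.dropFirst (StochOpt.before dir))^[z.1.2] (l z.1.1))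
      ((hl.comp fun z : κ => z.1.1).mono fun z => by
        rw [length_iterate_dropFirst]; omega) (fun z => ?_) h₁.snd.fst
    · simpa only [Function.iterate_succ_apply', Nat.cast_add, Nat.cast_one] using
        h₂.pair (h₁.snd.snd.add one)
    · have := (lt_trimCount_iff.1 z.2).1
      rw [← List.length_pos_iff, length_iterate_dropFirst]
      omega

theorem shifted {dir : Bool} {l : ∀ k, List (I k).X} (hl : PolyBdd N fun k => (l k).length)
    {j : ι → ℕ} (hj : PolyTime N a fun k => .num (j k)) {e : ∀ k, (I k).X}
    (he : PolyTime N a fun k => .num (e k : ℝ))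
    (hlist : PolyTime N a fun k => (I k).encList (l k)) :
    PolyTime N a fun k =>
      (I k).encDist (shifted (StochOpt.before dir) (j k) (e k) (l k)) := by
  have hm := length hl hlist
  have ht := trim (dir := dir) hl hj hlist
  have hw := one.div hm
  refine foldl (N := N) (a := a) (β := fun k => (I k).X) (σ := fun k => List ((I k).X × ℝ))
    (fun k (y : (I k).X) => .num (y : ℝ)) (fun k => (I k).encDist)
    (l := fun k => (StochOpt.dropFirst (StochOpt.before dir))^[trimCount (j k) (l k).length] (l k))
    (f := fun k acc y => (y, 1 / ((l k).length : ℝ)) :: acc)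
    (hl.mono fun k => by rw [length_iterate_dropFirst]; omega) ht.fst
    ((he.pair (one.sub ((hm.sub ht.snd).mul hw))).pair nil) ?_
  set κ := {z : Σ k, List ((I k).X × ℝ) × (I k).X // z.2.2 ∈
    (StochOpt.dropFirst (StochOpt.before dir))^[trimCount (j z.1) (l z.1).length] (l z.1)}
  have h₁ : PolyTime (fun z : κ => N z.1.1) _ _ :=
    refl (a := fun z : κ => .pair (a z.1.1) (.pair (.num (z.1.2.2 : ℝ))
      ((I z.1.1).encDist z.1.2.1)))
  exact (h₁.snd.fst.pair (h₁.fst.trans (hw.reindex fun z : κ => z.1.1))).pair h₁.snd.snd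

/-- A power of two is doubled until it reaches x; the number of rounds is the logarithm. -/
theorem clog {x : ι → ℕ} (hx : PolyBdd N x) (h : PolyTime N a fun k => .num (x k)) :
    PolyTime N a fun k => .num (Nat.clog 2 (x k) : ℕ) := by
  refine (loop (N := N) (a := a) (m := fun k => Nat.clog 2 (x k)) (S := fun _ j => .pair (.num ((2 ^ j : ℕ) : ℝ))
    (.num j)) (hx.mono fun k => ?_) (by simpa using one.pair zero) ?_ ?_).snd
  · exact Nat.clog_le_of_le_pow Nat.lt_two_pow_self.le
  · set κ := {z : ι × ℕ // z.2 ≤ Nat.clog 2 (x z.1)}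
    have h₁ : PolyTime (fun z : κ => N z.1.1) _ _ :=
      refl (a := fun z : κ => .pair (a z.1.1) (.pair (.num ((2 ^ z.1.2 : ℕ) : ℝ)) (.num z.1.2)))
    have h₂ := ((h₁.fst.trans (h.reindex fun z : κ => z.1.1)).le h₁.snd.fst).not
    convert h₂ using 3 with z
    rw [not_le, Nat.cast_lt, Nat.lt_clog_iff_pow_lt (by norm_num)]
  · set κ := {z : ι × ℕ // z.2 < Nat.clog 2 (x z.1)}
    have h₁ : PolyTime (fun z : κ => N z.1.1) _ _ :=
      refl (a := fun z : κ => .pair (a z.1.1) (.pair (.num ((2 ^ z.1.2 : ℕ) : ℝ)) (.num z.1.2)))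
    convert (h₁.snd.fst.add h₁.snd.fst).pair (h₁.snd.snd.add one) using 3 with z
    · push_cast
      ring_nf
    · push_cast
      rfl

end PolyTime

/-! ### Reduction of online inputs to offline inputs of polynomial size -/

theorem length_samples_le {n w : ℕ} {X : Type} (i : Fin n) (H : List (List (Fin n × X)))
    (hw : ∀ o ∈ H, o.length ≤ w) : (samples i H).length ≤ H.length * w := by
  have inner : ∀ (o : List (Fin n × X)) (acc : List X),
      (o.foldl (fun acc p => if p.1 = i then p.2 :: acc else acc) acc).length
        ≤ acc.length + o.length := by
    intro o
    induction o with
    | nil => simp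
    | cons p o ih =>
      intro acc
      rw [List.foldl_cons]
      refine (ih _).trans ?_
      (split <;> simp); omega
  have outer : ∀ (H : List (List (Fin n × X))) (acc : List X), (∀ o ∈ H, o.length ≤ w) →
      (H.foldl (fun acc o => o.foldl (fun acc p => if p.1 = i then p.2 :: acc else acc) acc)
        acc).length ≤ acc.length + H.length * w := by
    intro H
    induction H with
    | nil => simp
    | cons o H ih =>
      intro acc hw
      rw [List.foldl_cons]
      refine (ih _ fun o ho => hw o (by simp [ho])).trans ?_
      have := inner o acc
      have := hw o (by simp)
      rw [List.length_cons, add_mul]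
      omega
  simpa [samples] using outer H [] hw

/-- The situations in which the online algorithm has to answer. -/
structure OnlineState where
  I : Instance
  T : ℕ
  H : List I.Obs
  h : I.Obs
  length_le : H.length ≤ T
  obs_length_le : ∀ o ∈ H, o.length ≤ I.n
  length_current_le : h.length ≤ I.n

namespace OnlineState

/-- The feedback does not enter: it consists of at most T + 1 lists with at most n entries each, so
its size is polynomial in this quantity. -/
def bound (z : OnlineState) : ℕ := z.I.params.size + z.I.n + z.T

theorem polyBdd_n : PolyBdd bound fun z => z.I.n :=
  PolyBdd.self.mono fun z => by unfold bound; omega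

theorem polyBdd_T : PolyBdd bound fun z => z.T :=
  PolyBdd.self.mono fun z => by unfold bound; omega

theorem polyBdd_samples : PolyBdd bound fun z => z.T * z.I.n := polyBdd_T.mul polyBdd_n

/-- The input of the online algorithm is transformed into an input of the offline algorithm. -/
theorem polyTime_offlineInput (dir : Bool) :
    PolyTime bound (fun z => z.I.onlineInput z.T z.H z.h)
      fun z => z.I.offlineInput (z.I.estimate dir z.T z.H) z.h := by
  set a : OnlineState → Data := fun z => z.I.onlineInput z.T z.H z.h
  have h₀ : PolyTime bound a a := .refl
  have hn : PolyTime bound a fun z => .num z.I.n := h₀.fst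
  have ha : PolyTime bound a fun z => .num z.I.a := h₀.snd.fst
  have hb : PolyTime bound a fun z => .num z.I.b := h₀.snd.snd.fst
  have hp : PolyTime bound a fun z => z.I.params := h₀.snd.snd.snd.fst
  have hT : PolyTime bound a fun z => .num z.T := h₀.snd.snd.snd.snd.fst
  have hH : PolyTime bound a fun z => .ofList (z.H.map z.I.encObs) := h₀.snd.snd.snd.snd.snd.fst
  have hh : PolyTime bound a fun z => z.I.encObs z.h := h₀.snd.snd.snd.snd.snd.snd.fst
  have he : PolyTime bound a fun z => .num (z.I.endpoint dir : ℝ) := by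
    cases dir
    · exact ha
    · exact hb
  have hj : PolyTime bound a fun z => .num (Nat.clog 2 (z.I.n * z.T) : ℕ) :=
    .clog (polyBdd_n.mul polyBdd_T) (by simpa using hn.mul hT)
  have hE : PolyTime bound a fun z => z.I.encDists (z.I.estimate dir z.T z.H) := by
    -- The list of distributions is built from its end, so that each new one goes in front. After j
    -- rounds the counter n − j remains, and the next item has index n − (j + 1).
    have := (PolyTime.loop (N := bound) (a := a) polyBdd_n (S := fun z j => .pair
      (.num ((z.I.n : ℝ) - j)) (.ofList ((List.ofFn fun i =>
        z.I.encDist (z.I.estimate dir z.T z.H i)).drop (z.I.n - j))))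
      ?_ ?_ ?_).snd
    · simpa [Instance.encDists, Instance.encDist] using this
    · have h := hn.pair (.nil (N := bound) (a := a))
      convert h using 3 with z
      · simp
      · rw [Nat.sub_zero, List.drop_of_length_le (by simp)]
        rfl
    · set κ := {z : OnlineState × ℕ // z.2 ≤ z.1.I.n}
      have h₁ : PolyTime (fun z : κ => bound z.1.1) _ _ :=
        .refl (a := fun z : κ => .pair (a z.1.1) (.pair
          (.num ((z.1.1.I.n : ℝ) - z.1.2)) (.ofList ((List.ofFn fun i =>
            z.1.1.I.encDist (z.1.1.I.estimate dir z.1.1.T z.1.1.H i)).drop (z.1.1.I.n - z.1.2)))))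
      convert PolyTime.one.le h₁.snd.fst using 3 with z
      rw [le_sub_iff_add_le, Nat.lt_iff_add_one_le]
      exact_mod_cast (by rw [add_comm])
    · set κ := {z : OnlineState × ℕ // z.2 < z.1.I.n}
      set env : κ → Data := fun z : κ => .pair (a z.1.1) (.pair
        (.num ((z.1.1.I.n : ℝ) - z.1.2)) (.ofList ((List.ofFn fun i =>
          z.1.1.I.encDist (z.1.1.I.estimate dir z.1.1.T z.1.1.H i)).drop (z.1.1.I.n - z.1.2))))
      have h₁ : PolyTime (fun z : κ => bound z.1.1) env env := .refl
      have hlt : ∀ z : κ, z.1.1.I.n - (z.1.2 + 1) < z.1.1.I.n := fun z => by have := z.2; omega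
      have hi : PolyTime (fun z : κ => bound z.1.1) env
          fun z => .num ((⟨z.1.1.I.n - (z.1.2 + 1), hlt z⟩ : Fin z.1.1.I.n) : ℕ) := by
        convert h₁.snd.fst.sub .one using 3 with z
        have := z.2
        rw [Fin.val_mk, Nat.cast_sub (by omega)]
        push_cast
        ring
      have hs := PolyTime.samples (I := fun z : κ => z.1.1.I) (H := fun z => z.1.1.H)
        (w := fun z => z.1.1.I.n)
        (((polyBdd_T.mono fun z => z.length_le)).comp fun z : κ => z.1.1)
        (polyBdd_n.comp fun z : κ => z.1.1) (fun z => z.1.1.obs_length_le) hi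
        (h₁.fst.trans (hH.reindex fun z : κ => z.1.1))
      have hd := PolyTime.shifted (dir := dir) (I := fun z : κ => z.1.1.I)
        ((polyBdd_samples.comp fun z : κ => z.1.1).mono fun z =>
          (length_samples_le _ _ z.1.1.obs_length_le).trans
            (Nat.mul_le_mul_right _ z.1.1.length_le))
        (h₁.fst.trans (hj.reindex fun z : κ => z.1.1))
        (h₁.fst.trans (he.reindex fun z : κ => z.1.1)) hs
      convert (h₁.snd.fst.sub .one).pair (hd.pair h₁.snd.snd) using 3 with z
      · push_cast; ring_nf
      · have h2 := z.2
        rw [List.drop_eq_getElem_cons (by simpa using hlt z)]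
        simp only [List.getElem_ofFn, Data.ofList]
        congr 4
        omega
  exact hn.pair (ha.pair (hb.pair (hp.pair (hE.pair (hh.pair .nil)))))

end OnlineState

theorem Data.size_ofList_le {l : List Data} {w : ℕ} (h : ∀ u ∈ l, u.size ≤ w) :
    (Data.ofList l).size ≤ l.length * (w + 1) + 1 := by
  induction l with
  | nil => simp [Data.ofList, Data.size]
  | cons u l ih =>
    have h₁ := h u (by simp)
    have h₂ := ih fun v hv => h v (by simp [hv])
    simp only [Data.ofList, Data.size, List.length_cons, add_mul, one_mul] at h₂ ⊢
    omega

theorem shifted_eq {X : Type} (rel : X → X → Prop) (j : ℕ) (e : X) (l : List X) :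
    shifted rel j e l =
      (((dropFirst rel)^[trimCount j l.length] l).map fun y => (y, 1 / (l.length : ℝ))).reverse ++
        [(e, 1 - ((l.length : ℝ) - (trimCount j l.length : ℕ)) * (1 / (l.length : ℝ)))] := by
  unfold shifted
  simp

theorem length_shifted_le {X : Type} (rel : X → X → Prop) (j : ℕ) (e : X) (l : List X) :
    (shifted rel j e l).length ≤ l.length + 1 := by
  simp [shifted_eq, length_iterate_dropFirst]

theorem weight_le_one (j m : ℕ) : ((m : ℝ) - (trimCount j m : ℕ)) * (1 / (m : ℝ)) ≤ 1 := by
  rcases Nat.eq_zero_or_pos m with rfl | hm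
  · simp
  · rw [mul_one_div, div_le_one (by exact_mod_cast hm)]
    simp

/-- The endpoint receives whatever the kept samples leave over. Without samples, 1 / 0 = 0 makes
this a point mass at e, so no case distinction is needed. -/
theorem isDist_shifted {X : Type} (rel : X → X → Prop) (j : ℕ) (e : X) (l : List X) :
    IsDist (shifted rel j e l) := by
  rw [shifted_eq]
  constructor
  · intro p hp
    simp only [List.mem_append, List.mem_reverse, List.mem_map, List.mem_singleton] at hp
    rcases hp with ⟨y, _, rfl⟩ | rfl
    · positivity
    · simpa using weight_le_one j l.length
  · simp only [List.map_append, List.map_reverse, List.map_map, List.sum_append, List.sum_reverse,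
      Function.comp_def, List.map_const', List.sum_replicate, length_iterate_dropFirst,
      List.map_cons, List.map_nil, List.sum_singleton, nsmul_eq_mul]
    rw [Nat.cast_sub (trimCount_le _ _)]
    ring

namespace OnlineState

theorem polyBdd_size_offlineInput (dir : Bool) :
    PolyBdd bound fun z => (z.I.offlineInput (z.I.estimate dir z.T z.H) z.h).size := by
  have h₁ : PolyBdd bound fun z => z.I.n * 4 + 1 := (polyBdd_n.mul (.const 4)).add (.const 1)
  have h₂ : PolyBdd bound fun z => z.I.n * ((z.T * z.I.n + 1) * 4 + 1 + 1) + 1 :=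
    (polyBdd_n.mul (((((polyBdd_samples.add (.const 1)).mul (.const 4)).add (.const 1)).add
      (.const 1)))).add (.const 1)
  have h₃ : PolyBdd bound fun z => z.I.params.size :=
    PolyBdd.self.mono fun z => by unfold bound; omega
  refine (((h₁.add h₂).add h₃).add (.const 10)).mono fun z => ?_
  have e₁ : (z.I.encObs z.h).size ≤ z.I.n * 4 + 1 := by
    refine (Data.size_ofList_le (w := 3) ?_).trans ?_
    · simp only [List.mem_map, forall_exists_index, and_imp]
      rintro u o - rfl
      simp [Data.size]
    · have := z.length_current_le
      simp
      omega
  have e₂ : (z.I.encDists (z.I.estimate dir z.T z.H)).size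
      ≤ z.I.n * ((z.T * z.I.n + 1) * 4 + 1 + 1) + 1 := by
    refine (Data.size_ofList_le (w := (z.T * z.I.n + 1) * 4 + 1) ?_).trans (by simp)
    intro u hu
    obtain ⟨i, rfl⟩ := List.mem_ofFn.1 hu
    refine (Data.size_ofList_le (w := 3) ?_).trans ?_
    · simp only [List.mem_map, forall_exists_index, and_imp]
      rintro u o - rfl
      simp [Data.size]
    rw [List.length_map]
    gcongr
    exact (length_shifted_le _ _ _ _).trans (Nat.add_le_add_right
      ((length_samples_le _ _ z.obs_length_le).trans (Nat.mul_le_mul_right _ z.length_le)) 1)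
  simp only [Instance.offlineInput, Data.ofList, Data.size]
  omega

/-- The online program first rewrites its input and then runs A. The running time of A is polynomial
in the size of the rewritten input, which is itself polynomially bounded. -/
theorem exists_program (dir : Bool) (A : Prog) (p : Polynomial ℕ) :
    ∃ (L : Prog) (q : Polynomial ℕ), ∀ (z : OnlineState) (out : Data),
      (∃ s ≤ p.eval (z.I.offlineInput (z.I.estimate dir z.T z.H) z.h).size,
        Runs A (z.I.offlineInput (z.I.estimate dir z.T z.H) z.h) out s) →
      ∃ s ≤ q.eval z.bound, Runs L (z.I.onlineInput z.T z.H z.h) out s := by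
  obtain ⟨L, q, hL⟩ := polyTime_offlineInput dir
  obtain ⟨q', hq'⟩ := (polyBdd_size_offlineInput dir).eval p
  refine ⟨.seq L A, q + q' + 1, fun z out ⟨s, hs, hrun⟩ => ?_⟩
  obtain ⟨t, ht, hrun'⟩ := hL z
  have := hs.trans (hq' z)
  exact ⟨t + s + 1, by simp; omega, .seq hrun' hrun⟩

end OnlineState

/-! ### Policies probe at most n items -/

namespace DecisionTree

variable {n : ℕ} {X : Type}

/-- On a tree that probes no item twice, only observation lists of length at most n occur. Answers
to longer lists are irrelevant, and this makes a uniform time bound possible. -/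
theorem Executes.mono {ans ans' : List (Fin n × X) → Data → Prop}
    (hans : ∀ h out, h.length ≤ n → ans h out → ans' h out) {σ : DecisionTree n X}
    {S : Finset (Fin n)} {h : List (Fin n × X)} (hσ : σ.ProbesOnce S) (hS : h.length = S.card)
    (hex : σ.Executes ans h) : σ.Executes ans' h := by
  have hle : h.length ≤ n := by simpa [hS] using S.card_le_univ
  induction σ generalizing S h with
  | leaf d => exact hans _ _ hle hex
  | node i next ih =>
    refine ⟨hans _ _ hle hex.1, fun y => ?_⟩
    have hS' : (h ++ [(i, y)]).length = (insert i S).card := by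
      simp [Finset.card_insert_of_notMem hσ.1, hS]
    exact ih y (hσ.2 y) hS' (hex.2 y) (by simpa [hS'] using (insert i S).card_le_univ)

/-- The probed items, in order. -/
def items (σ : DecisionTree n X) (x : Fin n → X) : List (Fin n) := (σ.trace x).map Prod.fst

theorem ProbesOnce.items_spec {σ : DecisionTree n X} {S : Finset (Fin n)} (hσ : σ.ProbesOnce S)
    (x : Fin n → X) : (σ.items x).Nodup ∧ ∀ i ∈ σ.items x, i ∉ S := by
  induction σ generalizing S with
  | leaf d => simp [items, trace]
  | node i next ih =>
    obtain ⟨h₁, h₂⟩ := ih (x i) (hσ.2 (x i))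
    simp only [items, trace, List.map_cons, List.nodup_cons, List.mem_cons, forall_eq_or_imp]
      at h₁ h₂ ⊢
    exact ⟨⟨fun h => h₂ i h (by simp), h₁⟩, hσ.1, fun j hj hjS => h₂ j hj (by simp [hjS])⟩

theorem trace_eq_map_items (σ : DecisionTree n X) (x : Fin n → X) :
    σ.trace x = (σ.items x).map fun i => (i, x i) := by
  induction σ with
  | leaf d => rfl
  | node i next ih => simpa [items, trace] using ih (x i)

theorem ProbesOnce.length_trace_le {σ : DecisionTree n X} {S : Finset (Fin n)}
    (hσ : σ.ProbesOnce S) (x : Fin n → X) : (σ.trace x).length ≤ n := by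
  have := (hσ.items_spec x).1.length_le_card
  simpa [items] using this

end DecisionTree

namespace Instance

variable (I : Instance)

theorem length_history (pol : List I.Obs → I.Policy) (x : ℕ → Fin I.n → I.X) (t : ℕ) :
    (I.history pol x t).length = t := by
  induction t with
  | zero => rfl
  | succ t ih => simp [history, ih]

theorem obs_length_le_of_mem_history {pol : List I.Obs → I.Policy}
    (hpol : ∀ H, pol H ∈ I.feasible) (x : ℕ → Fin I.n → I.X) (t : ℕ) :
    ∀ o ∈ I.history pol x t, o.length ≤ I.n := by
  induction t with
  | zero => simp [history]
  | succ t ih =>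
    simp only [history, List.mem_append, List.mem_singleton]
    rintro o (ho | rfl)
    · exact ih o ho
    · exact (I.probesOnce _ (hpol _)).length_trace_le _

end Instance

/-- The online algorithm runs the offline algorithm on shifted empirical distributions. -/
theorem StochasticProblem.HasApproxAlgorithm.exists_online {P : StochasticProblem}
    {k : Instance → ℕ} {α : Instance → ℝ} (hA : P.HasApproxAlgorithm k α) (dir : Bool) :
    ∃ (L : Prog) (q : Polynomial ℕ), ∀ I ∈ P.instances, ∀ T : ℕ,
      ∃ τ : List I.Obs → ThresholdTree I.n (k I) I.X,
        (∀ H, (τ H).toTree ∈ I.feasible ∧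
          P.IsApprox I (α I) (fun i => distOf (I.estimate dir T H i)) (τ H).toTree) ∧
        I.Implements L (q.eval (I.params.size + I.n + T)) T fun H => (τ H).toTree := by
  obtain ⟨A, p, hA⟩ := hA
  obtain ⟨L, q, hL⟩ := OnlineState.exists_program dir A p
  refine ⟨L, q, fun I hI T => ?_⟩
  -- The policies come from the axiom of choice, one for every list H, so nothing is known about how
  -- τ H depends on H. Measurability is recovered later from the program that carries them out.
  choose τ hfeas happrox hex using fun H : List I.Obs =>
    hA I hI (I.estimate dir T H) fun i => isDist_shifted _ _ _ _
  refine ⟨τ, fun H => ⟨hfeas H, happrox H⟩, fun x t ht => ⟨hfeas _, ?_⟩⟩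
  refine (hex _).mono (S := ∅) (fun h out hh hans => ?_) (I.probesOnce _ (hfeas _)) rfl
  exact hL ⟨I, T, _, h, by rw [I.length_history]; exact ht.le,
    I.obs_length_le_of_mem_history hfeas x t, hh⟩ out hans

/-! ## The outcome of a program depends measurably on its input -/

namespace Data

/-- The label of the node at a given position of a pointer structure. -/
def label : Data → List Bool → ℕ × ℝ
  | nil, [] => (1, 0)
  | num r, [] => (2, r)
  | pair _ _, [] => (3, 0)
  | pair a _, false :: p => a.label p
  | pair _ b, true :: p => b.label p
  | _, _ => (0, 0)

/-- There are countably many positions and labels determine the data. A map into `Data` is thus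
measurable exactly when each label is, and singletons are countable intersections of measurable
sets. -/
instance instMeasurableSpace : MeasurableSpace Data := MeasurableSpace.comap label inferInstance

theorem label_injective : Function.Injective label := by
  intro u
  induction u with
  | nil =>
    intro v h
    have := congrFun h []
    cases v <;> simp [label] at this ⊢
  | num r =>
    intro v h
    have := congrFun h []
    cases v <;> simp [label] at this ⊢
    exact this
  | pair a b iha ihb =>
    intro v h
    have h₀ := congrFun h []
    cases v with
    | nil => simp [label] at h₀
    | num s => simp [label] at h₀
    | pair c d =>
      rw [iha (funext fun p => by simpa [label] using congrFun h (false :: p)),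
        ihb (funext fun p => by simpa [label] using congrFun h (true :: p))]

theorem measurable_label : Measurable label := comap_measurable _

theorem measurable_label_apply (p : List Bool) : Measurable fun u : Data => u.label p :=
  (measurable_pi_apply p).comp measurable_label

instance instMeasurableSingletonClass : MeasurableSingletonClass Data where
  measurableSet_singleton c := by
    have : ({c} : Set Data) = ⋂ p, {u | u.label p = c.label p} := by
      ext u
      simp only [Set.mem_singleton_iff, Set.mem_iInter, Set.mem_ofPred_eq]
      exact ⟨fun h p => by rw [h], fun h => label_injective (funext h)⟩
    rw [this]
    exact .iInter fun p => measurable_label_apply p (measurableSet_singleton _)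

variable {Ω : Type*} [MeasurableSpace Ω]

theorem measurable_iff {f : Ω → Data} :
    Measurable f ↔ ∀ p, Measurable fun ω => (f ω).label p := by
  rw [measurable_comap_iff, measurable_pi_iff]
  rfl

theorem measurable_num {f : Ω → ℝ} (hf : Measurable f) : Measurable fun ω => num (f ω) := by
  refine measurable_iff.2 fun p => ?_
  cases p with
  | nil => exact measurable_const.prodMk hf
  | cons _ _ => exact measurable_const

theorem measurable_pair {f g : Ω → Data} (hf : Measurable f) (hg : Measurable g) :
    Measurable fun ω => pair (f ω) (g ω) := by
  refine measurable_iff.2 fun p => ?_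
  rcases p with _ | ⟨_ | _, p⟩
  · exact measurable_const
  · exact measurable_iff.1 hf p
  · exact measurable_iff.1 hg p

theorem measurable_ofList_map {α : Type*} (l : List α) {f : α → Ω → Data}
    (hf : ∀ a, Measurable (f a)) : Measurable fun ω => ofList (l.map fun a => f a ω) := by
  induction l with
  | nil => exact measurable_const
  | cons a l ih => exact measurable_pair (hf a) ih

def IsPair (u : Data) : Prop := (u.label []).1 = 3

def IsNum (u : Data) : Prop := (u.label []).1 = 2

theorem measurableSet_isPair : MeasurableSet {u : Data | u.IsPair} :=
  (measurable_fst.comp (measurable_label_apply [])) (measurableSet_singleton 3)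

theorem measurableSet_isNum : MeasurableSet {u : Data | u.IsNum} :=
  (measurable_fst.comp (measurable_label_apply [])) (measurableSet_singleton 2)

end Data

open Classical in
theorem Op.measurable_fst : Measurable Op.fst.apply := by
  refine Data.measurable_iff.2 fun p => ?_
  have : (fun u => (Op.fst.apply u).label p)
      = fun u : Data => if u.IsPair then u.label (false :: p) else Data.nil.label p := by
    ext1 u
    cases u <;> simp [Op.apply, Data.label, Data.IsPair]
  rw [this]
  exact Measurable.ite Data.measurableSet_isPair (Data.measurable_label_apply _) measurable_const

open Classical in
theorem Op.measurable_snd : Measurable Op.snd.apply := by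
  refine Data.measurable_iff.2 fun p => ?_
  have : (fun u => (Op.snd.apply u).label p)
      = fun u : Data => if u.IsPair then u.label (true :: p) else Data.nil.label p := by
    ext1 u
    cases u <;> simp [Op.apply, Data.label, Data.IsPair]
  rw [this]
  exact Measurable.ite Data.measurableSet_isPair (Data.measurable_label_apply _) measurable_const

/-- An operation on pairs of numbers is measurable. -/
theorem Data.measurable_of_pair_num {g : Data → Data} {φ : ℝ → ℝ → Data}
    (h₁ : ∀ r s, g (.pair (.num r) (.num s)) = φ r s)
    (h₂ : ∀ u, (∀ r s, u ≠ .pair (.num r) (.num s)) → g u = .nil)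
    (hφ : Measurable fun z : ℝ × ℝ => φ z.1 z.2) : Measurable g := by
  classical
  have hg : g = fun u => if u.IsPair ∧ (Op.fst.apply u).IsNum ∧ (Op.snd.apply u).IsNum
      then φ ((Op.fst.apply u).label []).2 ((Op.snd.apply u).label []).2 else .nil := by
    ext1 u
    rcases u with _ | r | ⟨_ | r | _, _ | s | _⟩ <;>
      simp [Op.apply, Data.label, Data.IsPair, Data.IsNum, h₁, h₂]
  rw [hg]
  refine Measurable.ite ?_ ?_ measurable_const
  · exact Data.measurableSet_isPair.inter ((Op.measurable_fst Data.measurableSet_isNum).inter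
      (Op.measurable_snd Data.measurableSet_isNum))
  · have h : Measurable fun u => (((Op.fst.apply u).label []).2, ((Op.snd.apply u).label []).2) :=
      (_root_.measurable_snd.comp ((Data.measurable_label_apply []).comp Op.measurable_fst)).prodMk
        (_root_.measurable_snd.comp ((Data.measurable_label_apply []).comp Op.measurable_snd))
    exact hφ.comp h

theorem Op.measurable_apply (o : Op) : Measurable o.apply := by
  classical
  cases o with
  | skip => exact measurable_id
  | nil => exact measurable_const
  | zero => exact measurable_const
  | one => exact measurable_const
  | fst => exact Op.measurable_fst
  | snd => exact Op.measurable_snd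
  | isPair =>
    have : Op.isPair.apply = fun u : Data => if u.IsPair then .num 1 else .nil := by
      ext1 u
      cases u <;> simp [Op.apply, Data.label, Data.IsPair]
    rw [this]
    exact Measurable.ite Data.measurableSet_isPair measurable_const measurable_const
  | add =>
    refine Data.measurable_of_pair_num (φ := fun r s => .num (r + s)) (fun r s => rfl)
      (fun u hu => ?_) (Data.measurable_num (by fun_prop))
    rcases u with _ | r | ⟨_ | r | _, _ | s | _⟩ <;> first | rfl | exact absurd rfl (hu _ _)
  | sub =>
    refine Data.measurable_of_pair_num (φ := fun r s => .num (r - s)) (fun r s => rfl)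
      (fun u hu => ?_) (Data.measurable_num (by fun_prop))
    rcases u with _ | r | ⟨_ | r | _, _ | s | _⟩ <;> first | rfl | exact absurd rfl (hu _ _)
  | mul =>
    refine Data.measurable_of_pair_num (φ := fun r s => .num (r * s)) (fun r s => rfl)
      (fun u hu => ?_) (Data.measurable_num (by fun_prop))
    rcases u with _ | r | ⟨_ | r | _, _ | s | _⟩ <;> first | rfl | exact absurd rfl (hu _ _)
  | div =>
    refine Data.measurable_of_pair_num (φ := fun r s => .num (r / s)) (fun r s => rfl)
      (fun u hu => ?_) (Data.measurable_num (by fun_prop))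
    rcases u with _ | r | ⟨_ | r | _, _ | s | _⟩ <;> first | rfl | exact absurd rfl (hu _ _)
  | le =>
    refine Data.measurable_of_pair_num (φ := fun r s => if r ≤ s then .num 1 else .nil)
      (fun r s => rfl) (fun u hu => ?_) (Measurable.ite
        (measurableSet_le _root_.measurable_fst _root_.measurable_snd)
        measurable_const measurable_const)
    rcases u with _ | r | ⟨_ | r | _, _ | s | _⟩ <;> first | rfl | exact absurd rfl (hu _ _)

/-- Sequencing of partial results: `nil` stands for "no result" and `pair v nil` for the
result `v`. -/
def Data.andThen (r : Data) (f : Data → Data) : Data :=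
  open Classical in if r.IsPair then f (Op.fst.apply r) else .nil

/-- The result of a program after at most `k` nested evaluations. -/
def Prog.evalFuel : ℕ → Prog → Data → Data
  | 0, _, _ => .nil
  | _ + 1, .op o, u => .pair (o.apply u) .nil
  | k + 1, .seq f g, u => (evalFuel k f u).andThen (evalFuel k g)
  | k + 1, .both f g, u =>
    (evalFuel k f u).andThen fun v => (evalFuel k g u).andThen fun w => .pair (.pair v w) .nil
  | k + 1, .cond c f g, u =>
    (evalFuel k c u).andThen fun b =>
      open Classical in if b = .nil then evalFuel k g u else evalFuel k f u
  | k + 1, .loop c f, u =>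
    (evalFuel k c u).andThen fun b =>
      open Classical in if b = .nil then .pair u .nil else
        (evalFuel k f u).andThen (evalFuel k (.loop c f))

theorem Data.measurable_andThen {Ω : Type*} [MeasurableSpace Ω] {r : Ω → Data}
    {f : Ω → Data → Data} (hr : Measurable r) (hf : Measurable fun z : Ω × Data => f z.1 z.2) :
    Measurable fun ω => (r ω).andThen (f ω) := by
  classical
  exact Measurable.ite (hr Data.measurableSet_isPair)
    (hf.comp (measurable_id.prodMk (Op.measurable_fst.comp hr))) measurable_const

/-- With bounded fuel a program is a finite combination of measurable operations and case
distinctions on measurable sets, so induction on the fuel suffices. Unbounded computation becomes a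
countable union over the fuel. -/
theorem Prog.measurable_evalFuel (k : ℕ) (p : Prog) : Measurable (p.evalFuel k) := by
  classical
  induction k generalizing p with
  | zero => exact measurable_const
  | succ k ih =>
    have hnil : MeasurableSet {z : Data × Data | z.2 = .nil} :=
      measurable_snd (measurableSet_singleton Data.nil)
    cases p with
    | op o => exact Data.measurable_pair o.measurable_apply measurable_const
    | seq f g => exact Data.measurable_andThen (ih f) ((ih g).comp measurable_snd)
    | both f g =>
      exact Data.measurable_andThen (ih f) (Data.measurable_andThen ((ih g).comp measurable_fst)
        (Data.measurable_pair (Data.measurable_pair (measurable_snd.comp measurable_fst)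
          measurable_snd) measurable_const))
    | cond c f g =>
      exact Data.measurable_andThen (ih c) (Measurable.ite hnil ((ih g).comp measurable_fst)
        ((ih f).comp measurable_fst))
    | loop c f =>
      exact Data.measurable_andThen (ih c) (Measurable.ite hnil
        (Data.measurable_pair measurable_fst measurable_const)
        (Data.measurable_andThen ((ih f).comp measurable_fst) ((ih _).comp measurable_snd)))

theorem Data.andThen_pair (v w : Data) (f : Data → Data) : (pair v w).andThen f = f v := by
  simp [andThen, IsPair, label, Op.apply]

theorem Data.andThen_eq_pair {r v w : Data} {f : Data → Data} (h : r.andThen f = pair v w) :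
    ∃ v' w', r = pair v' w' ∧ f v' = pair v w := by
  cases r with
  | nil => simp [andThen, IsPair, label] at h
  | num s => simp [andThen, IsPair, label] at h
  | pair v' w' => exact ⟨v', w', rfl, by rwa [andThen_pair] at h⟩

theorem Prog.runs_of_evalFuel {k : ℕ} {p : Prog} {u v w : Data}
    (h : p.evalFuel k u = .pair v w) : ∃ t, Runs p u v t := by
  induction k generalizing p u v w with
  | zero => simp [evalFuel] at h
  | succ k ih =>
    cases p with
    | op o =>
      simp only [evalFuel, Data.pair.injEq] at h
      exact h.1 ▸ ⟨1, .op o u⟩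
    | seq f g =>
      obtain ⟨v', w', h₁, h₂⟩ := Data.andThen_eq_pair h
      obtain ⟨s, hs⟩ := ih h₁
      obtain ⟨t, ht⟩ := ih h₂
      exact ⟨_, .seq hs ht⟩
    | both f g =>
      obtain ⟨v', w', h₁, h₂⟩ := Data.andThen_eq_pair h
      obtain ⟨v'', w'', h₃, h₄⟩ := Data.andThen_eq_pair h₂
      obtain ⟨s, hs⟩ := ih h₁
      obtain ⟨t, ht⟩ := ih h₃
      simp only [Data.pair.injEq] at h₄
      exact h₄.1 ▸ ⟨_, .both hs ht⟩
    | cond c f g =>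
      obtain ⟨b, w', h₁, h₂⟩ := Data.andThen_eq_pair h
      obtain ⟨s, hs⟩ := ih h₁
      by_cases hb : b = .nil
      · subst hb
        rw [if_pos rfl] at h₂
        obtain ⟨t, ht⟩ := ih h₂
        exact ⟨_, .condFalse hs ht⟩
      · rw [if_neg hb] at h₂
        obtain ⟨t, ht⟩ := ih h₂
        exact ⟨_, .condTrue hs hb ht⟩
    | loop c f =>
      obtain ⟨b, w', h₁, h₂⟩ := Data.andThen_eq_pair h
      obtain ⟨s, hs⟩ := ih h₁
      by_cases hb : b = .nil
      · subst hb
        rw [if_pos rfl, Data.pair.injEq] at h₂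
        exact h₂.1 ▸ ⟨_, .loopExit hs⟩
      · rw [if_neg hb] at h₂
        obtain ⟨v', w'', h₃, h₄⟩ := Data.andThen_eq_pair h₂
        obtain ⟨t, ht⟩ := ih h₃
        obtain ⟨r, hr⟩ := ih h₄
        exact ⟨_, .loopStep hs hb ht hr⟩

/-- The step count is enough fuel because each rule charges one step beyond its premises. -/
theorem Runs.evalFuel {p : Prog} {u v : Data} {t : ℕ} (h : Runs p u v t) :
    ∀ k, t ≤ k → p.evalFuel k u = .pair v .nil := by
  induction h with
  | op o u =>
    rintro (_ | k) hk
    · omega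
    · rfl
  | seq _ _ ih₁ ih₂ =>
    rintro (_ | k) hk
    · omega
    · rw [Prog.evalFuel, ih₁ k (by omega), Data.andThen_pair, ih₂ k (by omega)]
  | both _ _ ih₁ ih₂ =>
    rintro (_ | k) hk
    · omega
    · rw [Prog.evalFuel, ih₁ k (by omega), Data.andThen_pair, ih₂ k (by omega), Data.andThen_pair]
  | condTrue _ hb _ ih₁ ih₂ =>
    rintro (_ | k) hk
    · omega
    · rw [Prog.evalFuel, ih₁ k (by omega), Data.andThen_pair, if_neg hb, ih₂ k (by omega)]
  | condFalse _ _ ih₁ ih₂ =>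
    rintro (_ | k) hk
    · omega
    · rw [Prog.evalFuel, ih₁ k (by omega), Data.andThen_pair, if_pos rfl, ih₂ k (by omega)]
  | loopExit _ ih₁ =>
    rintro (_ | k) hk
    · omega
    · rw [Prog.evalFuel, ih₁ k (by omega), Data.andThen_pair, if_pos rfl]
  | loopStep _ hb _ _ ih₁ ih₂ ih₃ =>
    rintro (_ | k) hk
    · omega
    · rw [Prog.evalFuel, ih₁ k (by omega), Data.andThen_pair, if_neg hb, ih₂ k (by omega),
        Data.andThen_pair, ih₃ k (by omega)]

theorem measurableSet_runs (p : Prog) (v : Data) : MeasurableSet {u | ∃ t, Runs p u v t} := by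
  have : {u | ∃ t, Runs p u v t} = ⋃ k, p.evalFuel k ⁻¹' {.pair v .nil} := by
    ext u
    simp only [Set.mem_ofPred_eq, Set.mem_iUnion, Set.mem_preimage, Set.mem_singleton_iff]
    exact ⟨fun ⟨t, ht⟩ => ⟨t, ht.evalFuel t le_rfl⟩, fun ⟨k, hk⟩ => Prog.runs_of_evalFuel hk⟩
  rw [this]
  exact .iUnion fun k => p.measurable_evalFuel k (measurableSet_singleton _)

/-! ## The probed items are random variables -/

/-- Under the answers `ans`, after the observations `h`, the items in the list are probed, and then
the decision `d` is taken. -/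
def Follows {n : ℕ} {X : Type} (ans : List (Fin n × X) → Data → Prop) (y : Fin n → X) (d : ℕ) :
    List (Fin n) → List (Fin n × X) → Prop
  | [], h => ans h (.num d)
  | i :: s, h => ans h (.pair (.num (i : ℕ)) .nil) ∧ Follows ans y d s (h ++ [(i, y i)])

/-- Since answers are unique, the transcript of the answers determines the path through the tree.
Statements about an arbitrarily chosen policy become statements about the program alone. -/
theorem DecisionTree.Executes.follows_iff {n : ℕ} {X : Type}
    {ans : List (Fin n × X) → Data → Prop}
    (hans : ∀ h out out', ans h out → ans h out' → out = out') {σ : DecisionTree n X}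
    {h : List (Fin n × X)} (hσ : σ.Executes ans h) (y : Fin n → X) (d : ℕ) (s : List (Fin n)) :
    Follows ans y d s h ↔ σ.items y = s ∧ σ.decision y = d := by
  induction σ generalizing h s with
  | leaf d' =>
    cases s with
    | nil =>
      simp only [Follows, items, trace, decision, List.map_nil, true_and]
      refine ⟨fun h' => ?_, fun h' => h' ▸ hσ⟩
      simpa using hans _ _ _ hσ h'
    | cons i s =>
      simp only [Follows, items, trace, List.map_nil, List.nil_eq, reduceCtorEq, false_and,
        iff_false, not_and]
      intro h'
      simpa using hans _ _ _ hσ h'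
  | node i next ih =>
    cases s with
    | nil =>
      simp only [Follows, items, trace, List.map_cons, reduceCtorEq, false_and, iff_false]
      intro h'
      simpa using hans _ _ _ hσ.1 h'
    | cons j s =>
      have := ih (y i) (hσ.2 (y i)) s
      simp only [items] at this
      simp only [Follows, items, trace, decision, List.map_cons, List.cons.injEq]
      constructor
      · rintro ⟨h₁, h₂⟩
        obtain rfl : i = j := by simpa [Fin.val_inj] using hans _ _ _ hσ.1 h₁
        simpa using this.1 h₂
      · rintro ⟨⟨rfl, h₁⟩, h₂⟩
        exact ⟨hσ.1, this.2 ⟨h₁, h₂⟩⟩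

/-- Meant for lists of items: there are countably many of them, so measurability into them can be
checked on fibres. -/
instance listMeasurableSpace {α : Type*} : MeasurableSpace (List α) := ⊤

instance listDiscreteMeasurableSpace {α : Type*} : DiscreteMeasurableSpace (List α) := ⟨fun _ => trivial⟩

namespace Instance

variable (I : Instance)

/-- The items probed in period `t`. -/
def probes (pol : List I.Obs → I.Policy) (x : ℕ → Fin I.n → I.X) (t : ℕ) : List (Fin I.n) :=
  (pol (I.history pol x t)).items (x t)

/-- The feedback of the first `t` periods when the items in `s 0, s 1, …` are probed. -/
def feedback (s : ℕ → List (Fin I.n)) (x : ℕ → Fin I.n → I.X) (t : ℕ) : List I.Obs :=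
  (List.range t).map fun j => (s j).map fun i => (i, x j i)

/-- Separates the history into the discrete sequence of probed items and the outcomes. For a fixed
sequence of items the feedback is a measurable function of x, whatever the policies are. -/
theorem history_eq_feedback (pol : List I.Obs → I.Policy) (x : ℕ → Fin I.n → I.X) (t : ℕ) :
    I.history pol x t = I.feedback (I.probes pol x) x t := by
  induction t with
  | zero => rfl
  | succ t ih =>
    rw [history, feedback, List.range_succ, List.map_append, ← feedback, ← ih,
      DecisionTree.trace_eq_map_items]
    rfl

theorem measurable_encObs (s : List (Fin I.n)) (t : ℕ) :
    Measurable fun x : ℕ → Fin I.n → I.X => I.encObs (s.map fun i => (i, x t i)) := by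
  simp only [encObs, List.map_map]
  refine Data.measurable_ofList_map s (f := fun i (x : ℕ → Fin I.n → I.X) => .pair (.num ((i : ℕ) : ℝ))
    (.num (x t i : ℝ))) fun i => Data.measurable_pair measurable_const
    (Data.measurable_num ?_)
  exact measurable_subtype_coe.comp ((measurable_pi_apply i).comp (measurable_pi_apply t))

theorem measurable_onlineInput (T : ℕ) (s : ℕ → List (Fin I.n)) (t : ℕ) (s' : List (Fin I.n)) :
    Measurable fun x : ℕ → Fin I.n → I.X =>
      I.onlineInput T (I.feedback s x t) (s'.map fun i => (i, x t i)) := by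
  have h : Measurable fun x : ℕ → Fin I.n → I.X =>
      Data.ofList ((I.feedback s x t).map I.encObs) := by
    simp only [feedback, List.map_map]
    exact Data.measurable_ofList_map _ fun j => I.measurable_encObs (s j) j
  iterate 5 refine Data.measurable_pair measurable_const ?_
  exact Data.measurable_pair h (Data.measurable_pair (I.measurable_encObs s' t) measurable_const)

theorem measurableSet_follows (L : Prog) (T : ℕ) (ps : ℕ → List (Fin I.n)) (t d : ℕ)
    (s s' : List (Fin I.n)) : MeasurableSet {x : ℕ → Fin I.n → I.X |
      Follows (fun h out => ∃ r, Runs L (I.onlineInput T (I.feedback ps x t) h) out r) (x t) d s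
        (s'.map fun i => (i, x t i))} := by
  induction s generalizing s' with
  | nil => exact I.measurable_onlineInput T ps t s' (measurableSet_runs L _)
  | cons i s ih =>
    refine (I.measurable_onlineInput T ps t s' (measurableSet_runs L _)).inter ?_
    have := ih (s' ++ [i])
    simp only [List.map_append, List.map_cons, List.map_nil] at this
    exact this

variable {I} {L : Prog} {B T : ℕ} {pol : List I.Obs → I.Policy}

theorem Implements.follows_iff (hpol : I.Implements L B T pol) {t : ℕ} (ht : t < T)
    (x : ℕ → Fin I.n → I.X) (d : ℕ) (s : List (Fin I.n)) :
    Follows (fun h out => ∃ r, Runs L (I.onlineInput T (I.history pol x t) h) out r) (x t) d s []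
      ↔ I.probes pol x t = s ∧ (pol (I.history pol x t)).decision (x t) = d := by
  refine DecisionTree.Executes.follows_iff (fun h out out' ⟨_, h₁⟩ ⟨_, h₂⟩ => h₁.det h₂)
    ?_ (x t) d s
  exact (hpol x t ht).2.mono (S := ∅) (fun h out _ ⟨s, _, hs⟩ => ⟨s, hs⟩)
    (I.probesOnce _ (hpol x t ht).1) rfl

/-- Strong induction over the periods. The earlier probes take countably many values, each on a
measurable set; on such a set the input of the program is a measurable function of x, hence so are
the answers that determine the probes and the decision of period t. -/
theorem Implements.measurable_probes_decision (hpol : I.Implements L B T pol) {t : ℕ}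
    (ht : t < T) : Measurable fun x : ℕ → Fin I.n → I.X =>
      (I.probes pol x t, (pol (I.history pol x t)).decision (x t)) := by
  induction t using Nat.strong_induction_on with
  | _ t ih =>
    have hrec : Measurable fun x : ℕ → Fin I.n → I.X => (List.range t).map (I.probes pol x) := by
      refine measurable_to_countable' fun hs => ?_
      have : (fun x : ℕ → Fin I.n → I.X => (List.range t).map (I.probes pol x)) ⁻¹' {hs}
          = {_x | hs.length = t} ∩ ⋂ j : Fin t, {x | I.probes pol x j = hs.getD j []} := by
        ext x
        simp only [Set.mem_preimage, Set.mem_singleton_iff, Set.mem_inter_iff, Set.mem_iInter,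
          Set.mem_ofPred_eq]
        constructor
        · rintro rfl
          exact ⟨by simp, fun j => by simp⟩
        · rintro ⟨hl, hj⟩
          refine List.ext_getElem (by simp [hl]) fun j h₁ h₂ => ?_
          simpa [h₂] using hj ⟨j, by simpa using h₁⟩
      rw [this]
      exact (MeasurableSet.const _).inter (.iInter fun j => measurable_fst.comp
        (ih j j.2 (j.2.trans ht)) (measurableSet_singleton _))
    refine measurable_to_countable' fun ⟨s, d⟩ => ?_
    have : (fun x : ℕ → Fin I.n → I.X =>
        (I.probes pol x t, (pol (I.history pol x t)).decision (x t))) ⁻¹' {(s, d)}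
        = ⋃ hs : List (List (Fin I.n)), {x | (List.range t).map (I.probes pol x) = hs} ∩
          {x | Follows (fun h out => ∃ r, Runs L (I.onlineInput T
            (I.feedback (fun j => hs.getD j []) x t) h) out r) (x t) d s []} := by
      ext x
      simp only [Set.mem_preimage, Set.mem_singleton_iff, Prod.mk.injEq, Set.mem_iUnion,
        Set.mem_inter_iff, Set.mem_ofPred_eq, exists_eq_left']
      rw [← hpol.follows_iff ht, history_eq_feedback]
      have : I.feedback (fun j => ((List.range t).map (I.probes pol x)).getD j []) x t
          = I.feedback (I.probes pol x) x t := by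
        refine List.map_congr_left fun j hj => ?_
        simp [List.mem_range.1 hj]
      rw [this]
    rw [this]
    refine .iUnion fun hs => (hrec (measurableSet_singleton hs)).inter ?_
    simpa using I.measurableSet_follows L T (fun j => hs.getD j []) t d s []

theorem Implements.measurable_probes (hpol : I.Implements L B T pol) {t : ℕ} (ht : t < T) :
    Measurable fun x : ℕ → Fin I.n → I.X => I.probes pol x t :=
  measurable_fst.comp (hpol.measurable_probes_decision ht)

theorem Implements.measurable_value (hpol : I.Implements L B T pol) {t : ℕ} (ht : t < T) :
    Measurable fun x : ℕ → Fin I.n → I.X => I.value (pol (I.history pol x t)) (x t) := by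
  classical
  -- The guard is there because measurability of the cost is assumed only for lists without
  -- repetition; probed lists satisfy it.
  have h : Measurable fun z : (List (Fin I.n) × ℕ) × (Fin I.n → I.X) =>
      if z.1.1.Nodup then I.cost (z.1.1.map fun i => (i, z.2 i)) z.1.2 else 0 := by
    refine measurable_from_prod_countable_right fun ⟨s, d⟩ => ?_
    by_cases hs : s.Nodup
    · simpa [hs] using I.measurable_cost s d hs
    · simp [hs]
  convert h.comp ((hpol.measurable_probes_decision ht).prodMk (measurable_pi_apply t)) using 2
    with x
  have := ((I.probesOnce _ (hpol x t ht).1).items_spec (x t)).1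
  simp [probes, this, value, DecisionTree.trace_eq_map_items]

end Instance

/-! ## Resampling one coordinate -/

section Resample

variable {ι : Type*} {X : ι → Type*} [∀ i, MeasurableSpace (X i)]
  (μ : ∀ i, Measure (X i)) [∀ i, IsProbabilityMeasure (μ i)]

theorem measurable_resample [DecidableEq ι] (i : ι) :
    Measurable fun z : (∀ j, X j) × X i => Function.update z.1 i z.2 := by
  refine measurable_pi_iff.2 fun j => ?_
  by_cases h : j = i
  · subst h
    simpa using measurable_snd
  · simp only [ne_eq, h, not_false_eq_true, Function.update_of_ne]
    exact (measurable_pi_apply j).comp measurable_fst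

/-- A product measure is preserved when one coordinate is resampled. -/
theorem measurePreserving_resample [DecidableEq ι] (i : ι) :
    MeasurePreserving (fun z : (∀ j, X j) × X i => Function.update z.1 i z.2)
      ((Measure.infinitePi μ).prod (μ i)) (Measure.infinitePi μ) := by
  refine ⟨measurable_resample i, Measure.eq_infinitePi _ fun s t ht => ?_⟩
  rw [Measure.map_apply (measurable_resample i)
    (.pi s.countable_toSet fun j _ => ht j)]
  by_cases hi : i ∈ s
  · have : (fun z : (∀ j, X j) × X i => Function.update z.1 i z.2) ⁻¹' Set.pi (s : Set ι) t
        = Set.pi ((s.erase i : Finset ι) : Set ι) t ×ˢ t i := by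
      ext z
      simp only [Set.mem_preimage, Set.mem_pi, Set.mem_prod, Finset.mem_coe, Finset.mem_erase]
      constructor
      · exact fun h => ⟨fun j hj => by simpa [hj.1] using h j hj.2, by simpa using h i hi⟩
      · rintro ⟨h₁, h₂⟩ j hj
        by_cases hji : j = i
        · subst hji
          simpa using h₂
        · simpa [hji] using h₁ j ⟨hji, hj⟩
    rw [this, Measure.prod_prod, Measure.infinitePi_pi _ fun j _ => ht j,
      Finset.prod_erase_mul _ _ hi]
  · have : (fun z : (∀ j, X j) × X i => Function.update z.1 i z.2) ⁻¹' Set.pi (s : Set ι) t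
        = Set.pi (s : Set ι) t ×ˢ Set.univ := by
      ext z
      simp only [Set.mem_preimage, Set.mem_pi, Set.mem_prod, Finset.mem_coe, Set.mem_univ,
        and_true]
      refine forall₂_congr fun j hj => ?_
      rw [Function.update_of_ne (by rintro rfl; exact hi hj)]
    rw [this, Measure.prod_prod, Measure.infinitePi_pi _ fun j _ => ht j, measure_univ, mul_one]

end Resample

/-! ## Expectations of functions of bounded variation -/

section Variation

variable {X : Type*} [LinearOrder X] [TopologicalSpace X] [OrderTopology X]
  [MeasurableSpace X] [BorelSpace X]

/-- The Kolmogorov-Smirnov distance of `D` and `E` is at most `δ`. -/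
def UniformlyClose (D E : Measure X) (δ : ℝ) : Prop :=
  ∀ U : Set X, IsUpperSet U → |D.real U - E.real U| ≤ δ

theorem integrable_of_bounded {Ω : Type*} [MeasurableSpace Ω] {μ : Measure Ω}
    [IsFiniteMeasure μ] {f : Ω → ℝ} (hf : Measurable f) {r s : ℝ} (h : ∀ ω, r ≤ f ω ∧ f ω ≤ s) :
    Integrable f μ :=
  Integrable.of_mem_Icc r s hf.aemeasurable (.of_forall h)

variable {D E : Measure X} [IsProbabilityMeasure D] [IsProbabilityMeasure E] {δ : ℝ} {lo hi : X}

/-- Layer-cake formula: ∫ p − p(lo) is the integral over t ∈ [0, p(hi) − p(lo)] of the mass of {p −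
p(lo) ≥ t}. These sets are upper sets, so the integrands for D and E differ by at most δ. -/
theorem UniformlyClose.abs_integral_sub_le_of_monotone (hδ : UniformlyClose D E δ)
    (hX : ∀ y : X, lo ≤ y ∧ y ≤ hi) {p : X → ℝ} (hp : Monotone p) :
    |∫ y, p y ∂D - ∫ y, p y ∂E| ≤ δ * (p hi - p lo) := by
  set R := p hi - p lo with hR
  have hR0 : 0 ≤ R := sub_nonneg.2 (hp (hX lo).2)
  set q : X → ℝ := fun y => p y - p lo with hq
  have hq0 : ∀ y, 0 ≤ q y ∧ q y ≤ R := fun y =>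
    ⟨sub_nonneg.2 (hp (hX y).1), sub_le_sub_right (hp (hX y).2) _⟩
  have hqm : Monotone q := fun y z h => sub_le_sub_right (hp h) _
  have key : ∀ (M : Measure X) [IsProbabilityMeasure M],
      ∫ y, p y ∂M - p lo = ∫ t in (0 : ℝ)..R, M.real {y | t ≤ q y} := by
    intro M _
    have hint : Integrable q M := integrable_of_bounded hqm.measurable hq0
    rw [intervalIntegral.integral_of_le hR0, ← hint.integral_eq_integral_Ioc_meas_le
      (.of_forall fun y => (hq0 y).1) (.of_forall fun y => (hq0 y).2)]
    have hpi : Integrable p M :=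
      integrable_of_bounded hp.measurable fun y => ⟨hp (hX y).1, hp (hX y).2⟩
    simp [hq, integral_sub hpi (integrable_const _)]
  have anti : ∀ (M : Measure X) [IsProbabilityMeasure M],
      Antitone fun t : ℝ => M.real {y | t ≤ q y} := fun M _ s t hst =>
    measureReal_mono fun y (hy : t ≤ q y) => hst.trans hy
  have : ∫ y, p y ∂D - ∫ y, p y ∂E
      = ∫ t in (0 : ℝ)..R, (D.real {y | t ≤ q y} - E.real {y | t ≤ q y}) := by
    rw [intervalIntegral.integral_sub (anti D).intervalIntegrable (anti E).intervalIntegrable,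
      ← key D, ← key E]
    ring
  rw [this]
  have := intervalIntegral.norm_integral_le_of_norm_le_const (a := (0 : ℝ)) (b := R) (C := δ)
    (f := fun t => D.real {y | t ≤ q y} - E.real {y | t ≤ q y}) fun t _ =>
      hδ _ fun y z hyz hy => le_trans hy (hqm hyz)
  simpa [abs_of_nonneg hR0] using this

/-- A Jordan decomposition: h = (p + h)/2 − (p − h)/2 is a difference of monotone functions whose
total increases add up to that of p. -/
theorem UniformlyClose.abs_integral_sub_le (hδ : UniformlyClose D E δ)
    (hX : ∀ y : X, lo ≤ y ∧ y ≤ hi) {p h : X → ℝ}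
    (hp : ∀ y z, y ≤ z → |h z - h y| ≤ p z - p y) :
    |∫ y, h y ∂D - ∫ y, h y ∂E| ≤ δ * (p hi - p lo) := by
  have hpm : Monotone p := fun y z hyz => sub_nonneg.1 ((abs_nonneg _).trans (hp y z hyz))
  have h₁ : Monotone fun y => (p y + h y) / 2 := fun y z hyz => by
    have := neg_abs_le (h z - h y)
    have := hp y z hyz
    dsimp only
    linarith
  have h₂ : Monotone fun y => (p y - h y) / 2 := fun y z hyz => by
    have := le_abs_self (h z - h y)
    have := hp y z hyz
    dsimp only
    linarith
  have bd : ∀ {g : X → ℝ}, Monotone g → ∀ (M : Measure X) [IsProbabilityMeasure M],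
      Integrable g M := fun hg M _ =>
    integrable_of_bounded hg.measurable fun y => ⟨hg (hX y).1, hg (hX y).2⟩
  have split : ∀ (M : Measure X) [IsProbabilityMeasure M],
      ∫ y, h y ∂M = ∫ y, (p y + h y) / 2 ∂M - ∫ y, (p y - h y) / 2 ∂M := by
    intro M _
    rw [← integral_sub (bd h₁ M) (bd h₂ M)]
    congr 1
    ext y
    ring
  have e₁ := hδ.abs_integral_sub_le_of_monotone hX h₁
  have e₂ := hδ.abs_integral_sub_le_of_monotone hX h₂
  rw [split D, split E]
  rw [abs_le] at e₁ e₂ ⊢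
  constructor <;> linarith [e₁.1, e₁.2, e₂.1, e₂.2]

end Variation

section Control

variable {X : Type*} [LinearOrder X] {lo hi : X}

/-- A bounded function with bounded variation on each of `k` consecutive intervals. -/
theorem exists_monotone_control {k : ℕ} (J : X →o Fin k)
    {h : X → ℝ} {F : ℝ} {V : ℝ≥0} (hF : ∀ y, 0 ≤ h y ∧ h y ≤ F)
    (hV : ∀ s, eVariationOn h (J ⁻¹' {s}) ≤ V) :
    ∃ p : X → ℝ, (∀ y z, y ≤ z → |h z - h y| ≤ p z - p y) ∧ p hi - p lo ≤ k * (F + V) := by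
  have hF0 : 0 ≤ F := (hF lo).1.trans (hF lo).2
  set v : Fin k → X → ℝ≥0∞ := fun s y => eVariationOn h (J ⁻¹' {s} ∩ Set.Iic y) with hv
  have hvV : ∀ s y, v s y ≤ V := fun s y =>
    (eVariationOn.mono h Set.inter_subset_left).trans (hV s)
  have hvtop : ∀ s y, v s y ≠ ∞ := fun s y => ((hvV s y).trans_lt ENNReal.coe_lt_top).ne
  have hvm : ∀ s, ∀ y z, y ≤ z → (v s y).toReal ≤ (v s z).toReal := fun s y z hyz =>
    ENNReal.toReal_mono (hvtop s z) (eVariationOn.mono h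
      (Set.inter_subset_inter_right _ (Set.Iic_subset_Iic.2 hyz)))
  -- The first term pays F for each passage to a later interval, which covers any change of h across
  -- a threshold. The second accumulates the variation inside the intervals.
  refine ⟨fun y => F * (J y : ℕ) + ∑ s, (v s y).toReal, fun y z hyz => ?_, ?_⟩
  · have hJ : (J y : ℕ) ≤ (J z : ℕ) := J.monotone hyz
    have hsum : ∀ s, (v s z).toReal - (v s y).toReal
        ≤ ∑ s, (v s z).toReal - ∑ s, (v s y).toReal := by
      intro s
      rw [← Finset.sum_sub_distrib]
      exact Finset.single_le_sum (f := fun s => (v s z).toReal - (v s y).toReal)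
        (fun s _ => sub_nonneg.2 (hvm s y z hyz)) (Finset.mem_univ s)
    rcases hJ.eq_or_lt with heq | hlt
    · have heq' : J y = J z := Fin.ext heq
      -- Inside one interval, the jump from y to z is appended to the variation up to y.
      have h₁ : v (J y) y + edist (h z) (h y) ≤ v (J y) z := by
        refine (add_le_add le_rfl (eVariationOn.edist_le h (s := {y, z}) (by simp)
          (by simp))).trans ((eVariationOn.add_le_union h ?_).trans (eVariationOn.mono h ?_))
        · rintro w hw w' (rfl | rfl)
          · exact hw.2
          · exact le_trans hw.2 hyz
        · rintro w (hw | rfl | rfl)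
          · exact ⟨hw.1, le_trans hw.2 hyz⟩
          · exact ⟨rfl, hyz⟩
          · exact ⟨heq'.symm, le_refl w⟩
      have h₂ := ENNReal.toReal_mono (hvtop _ _) h₁
      rw [ENNReal.toReal_add (hvtop _ _) (edist_ne_top _ _), edist_dist,
        ENNReal.toReal_ofReal dist_nonneg, Real.dist_eq] at h₂
      have := hsum (J y)
      dsimp only
      rw [heq]
      linarith
    · have h₁ : F * (J y : ℕ) + F ≤ F * (J z : ℕ) := by
        have : ((J y : ℕ) : ℝ) + 1 ≤ (J z : ℕ) := by exact_mod_cast hlt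
        nlinarith
      have h₂ : |h z - h y| ≤ F := by
        rw [abs_le]
        constructor <;> linarith [hF y, hF z, (hF y).1, (hF y).2, (hF z).1, (hF z).2]
      have h₃ : ∑ s, (v s y).toReal ≤ ∑ s, (v s z).toReal :=
        Finset.sum_le_sum fun s _ => hvm s y z hyz
      linarith
  · have h₁ : F * (J hi : ℕ) ≤ F * k := by
      gcongr
      exact (J hi).2.le
    have h₂ : ∑ s, (v s hi).toReal ≤ ∑ _s : Fin k, (V : ℝ) :=
      Finset.sum_le_sum fun s _ => ENNReal.toReal_le_coe_of_le_coe (hvV s hi)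
    have h₃ : 0 ≤ F * (J lo : ℕ) := by positivity
    have h₄ : 0 ≤ ∑ s, (v s lo).toReal := Finset.sum_nonneg fun s _ => ENNReal.toReal_nonneg
    simp only [Finset.sum_const, Finset.card_univ, Fintype.card_fin, nsmul_eq_mul] at h₂
    dsimp only
    linarith

/-- The variation of a mean is at most the bound for the variations. -/
theorem eVariationOn_integral_le {Ω : Type*} [MeasurableSpace Ω] {μ : Measure Ω}
    [IsProbabilityMeasure μ] {f : Ω → X → ℝ} {A : Set X} {V : ℝ≥0∞}
    (hfm : ∀ y, Measurable fun ω => f ω y) {r s : ℝ} (hb : ∀ ω y, r ≤ f ω y ∧ f ω y ≤ s)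
    (hV : ∀ ω, eVariationOn (f ω) A ≤ V) : eVariationOn (fun y => ∫ ω, f ω y ∂μ) A ≤ V := by
  have hint : ∀ y, Integrable (fun ω => f ω y) μ := fun y =>
    integrable_of_bounded (hfm y) fun ω => hb ω y
  refine iSup_le fun ⟨N, u, hu, hA⟩ => ?_
  calc ∑ j ∈ Finset.range N, edist (∫ ω, f ω (u (j + 1)) ∂μ) (∫ ω, f ω (u j) ∂μ)
      ≤ ∑ j ∈ Finset.range N, ∫⁻ ω, edist (f ω (u (j + 1))) (f ω (u j)) ∂μ := by
        refine Finset.sum_le_sum fun j _ => ?_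
        simp only [edist_eq_enorm_sub]
        rw [← integral_sub (hint _) (hint _)]
        exact enorm_integral_le_lintegral_enorm _
    _ = ∫⁻ ω, ∑ j ∈ Finset.range N, edist (f ω (u (j + 1))) (f ω (u j)) ∂μ := by
        rw [lintegral_finsetSum _ fun j _ => (hfm _).edist (hfm _)]
    _ ≤ ∫⁻ _, V ∂μ := lintegral_mono fun ω => (eVariationOn.sum_le hu hA).trans (hV ω)
    _ = V := by simp

end Control

/-! ## Stability of threshold policies -/

theorem measurePreserving_resample_pi {n : ℕ} {X : Type*} [MeasurableSpace X]
    (D : Fin n → Measure X) [∀ i, IsProbabilityMeasure (D i)] (i : Fin n) :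
    MeasurePreserving (fun z : (Fin n → X) × X => Function.update z.1 i z.2)
      ((Measure.pi D).prod (D i)) (Measure.pi D) := by
  have := measurePreserving_resample (X := fun _ => X) D i
  rwa [Measure.infinitePi_eq_pi] at this

/-- An expectation under a product measure is computed by resampling one coordinate. -/
theorem integral_pi_eq_integral_resample {n : ℕ} {X : Type*} [MeasurableSpace X]
    (D : Fin n → Measure X) [∀ i, IsProbabilityMeasure (D i)] (i : Fin n) {f : (Fin n → X) → ℝ}
    (hf : Measurable f) {r s : ℝ} (hb : ∀ x, r ≤ f x ∧ f x ≤ s) :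
    ∫ x, f x ∂Measure.pi D = ∫ y, ∫ x, f (Function.update x i y) ∂Measure.pi D ∂D i := by
  have h := measurePreserving_resample_pi D i
  rw [← h.map_eq, integral_map h.measurable.aemeasurable hf.aestronglyMeasurable, h.map_eq]
  exact integral_prod_symm _
    (integrable_of_bounded (hf.comp h.measurable) fun z => hb _)

theorem measurable_integral_resample {n : ℕ} {X : Type*} [MeasurableSpace X]
    (D : Fin n → Measure X) [∀ i, IsProbabilityMeasure (D i)] (i : Fin n) {f : (Fin n → X) → ℝ}
    (hf : Measurable f) :
    Measurable fun y => ∫ x, f (Function.update x i y) ∂Measure.pi D :=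
  ((hf.comp (measurable_resample (X := fun _ : Fin n => X) i)).stronglyMeasurable.integral_prod_left'
    (μ := Measure.pi D)).measurable

namespace DecisionTree

theorem ProbesOnce.update {n : ℕ} {X : Type} {σ : DecisionTree n X} {S : Finset (Fin n)}
    (hσ : σ.ProbesOnce S) {i : Fin n} (hi : i ∈ S) (x : Fin n → X) (y : X) :
    σ.trace (Function.update x i y) = σ.trace x ∧
      σ.decision (Function.update x i y) = σ.decision x := by
  induction σ generalizing S with
  | leaf d => exact ⟨rfl, rfl⟩
  | node j next ih =>
    have hji : j ≠ i := fun h => hσ.1 (h ▸ hi)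
    have := ih (x j) (hσ.2 (x j)) (Finset.mem_insert_of_mem hi)
    simp [trace, decision, hji, this]

end DecisionTree

namespace ThresholdTree

variable {n k : ℕ} {X : Type} [LinearOrder X]

theorem leafOf_update {τ : ThresholdTree n k X} {S : Finset (Fin n)}
    (hτ : τ.toTree.ProbesOnce S) {i : Fin n} (hi : i ∈ S) (x : Fin n → X) (y : X) :
    τ.leafOf (Function.update x i y) = τ.leafOf x := by
  induction τ generalizing S with
  | leaf d => rfl
  | node j J next ih =>
    have hji : j ≠ i := fun h => hτ.1 (h ▸ hi)
    have := ih (J (x j)) (hτ.2 (x j)) (Finset.mem_insert_of_mem hi)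
    simp [leafOf, hji, this]

/-- The total weight of the items that are probed. -/
def probedWeight (ε : Fin n → ℝ) (τ : ThresholdTree n k X) (x : Fin n → X) : ℝ :=
  ((τ.toTree.items x).map ε).sum

theorem probedWeight_node (ε : Fin n → ℝ) (i : Fin n) (J : X →o Fin k)
    (next : Fin k → ThresholdTree n k X) (x : Fin n → X) :
    (node i J next).probedWeight ε x = ε i + (next (J (x i))).probedWeight ε x := by
  simp [probedWeight, toTree, DecisionTree.items, DecisionTree.trace]

theorem probedWeight_update (ε : Fin n → ℝ) {τ : ThresholdTree n k X} {S : Finset (Fin n)}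
    (hτ : τ.toTree.ProbesOnce S) {i : Fin n} (hi : i ∈ S) (x : Fin n → X) (y : X) :
    τ.probedWeight ε (Function.update x i y) = τ.probedWeight ε x := by
  simp [probedWeight, DecisionTree.items, (hτ.update hi x y).1]

theorem probedWeight_mem {ε : Fin n → ℝ} (hε : ∀ i, 0 ≤ ε i) {τ : ThresholdTree n k X}
    {S : Finset (Fin n)} (hτ : τ.toTree.ProbesOnce S) (x : Fin n → X) :
    0 ≤ τ.probedWeight ε x ∧ τ.probedWeight ε x ≤ ∑ i, ε i := by
  refine ⟨List.sum_nonneg (by simpa using fun i _ => hε i), ?_⟩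
  rw [probedWeight, ← List.sum_toFinset _ (hτ.items_spec x).1]
  exact Finset.sum_le_sum_of_subset_of_nonneg (Finset.subset_univ _) fun i _ _ => hε i

variable [TopologicalSpace X] [OrderTopology X] [MeasurableSpace X] [BorelSpace X]

theorem measurable_threshold (J : X →o Fin k) : Measurable J := by
  refine measurable_to_countable' fun s => Set.OrdConnected.measurableSet ⟨?_⟩
  rintro y hy z hz w ⟨h₁, h₂⟩
  simp only [Set.mem_preimage, Set.mem_singleton_iff] at hy hz ⊢
  exact le_antisymm (hz ▸ J.monotone h₂) (hy ▸ J.monotone h₁)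

theorem measurable_probedWeight (ε : Fin n → ℝ) (τ : ThresholdTree n k X) :
    Measurable (τ.probedWeight ε) := by
  induction τ with
  | leaf d => exact measurable_const
  | node i J next ih =>
    simp only [funext (probedWeight_node ε i J next)]
    have h : Measurable fun z : Fin k × (Fin n → X) => (next z.1).probedWeight ε z.2 :=
      measurable_from_prod_countable_right fun s => ih s
    exact measurable_const.add (h.comp
      (((measurable_threshold J).comp (measurable_pi_apply i)).prodMk measurable_id))

/-- If the distributions of the items are changed by `ε i` in Kolmogorov-Smirnov distance, the
expected objective of a threshold policy changes by at most a multiple of the expected weight of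
the probed items. -/
theorem abs_integral_sub_le {D E : Fin n → Measure X} [∀ i, IsProbabilityMeasure (D i)]
    [∀ i, IsProbabilityMeasure (E i)] {ε : Fin n → ℝ} (hε : ∀ i, 0 ≤ ε i)
    (hclose : ∀ i, UniformlyClose (D i) (E i) (ε i)) {lo hi : X}
    (hX : ∀ y : X, lo ≤ y ∧ y ≤ hi) {F : ℝ} {V : ℝ≥0} (τ : ThresholdTree n k X)
    {S : Finset (Fin n)} {c : List (Fin n × X) → ℕ → ℝ} {g : List (Fin k) → (Fin n → X) → ℝ}
    (hτ : τ.toTree.ProbesOnce S)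
    (hc : Measurable fun x => c (τ.toTree.trace x) (τ.toTree.decision x))
    (hF : ∀ x, 0 ≤ c (τ.toTree.trace x) (τ.toTree.decision x) ∧
      c (τ.toTree.trace x) (τ.toTree.decision x) ≤ F)
    (hV : ∀ ℓ x i, eVariationOn (fun y => g ℓ (Function.update x i y)) Set.univ ≤ V)
    (hg : ∀ x, c (τ.toTree.trace x) (τ.toTree.decision x) = g (τ.leafOf x) x) :
    |∫ x, c (τ.toTree.trace x) (τ.toTree.decision x) ∂Measure.pi D -
        ∫ x, c (τ.toTree.trace x) (τ.toTree.decision x) ∂Measure.pi E|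
      ≤ k * (F + V) * ∫ x, τ.probedWeight ε x ∂Measure.pi D := by
  induction τ generalizing S c g with
  | leaf d =>
    simp [toTree, DecisionTree.trace, DecisionTree.decision, probedWeight, DecisionTree.items]
  | node i J next ih =>
    set val : (Fin n → X) → ℝ := fun x =>
      c ((node i J next).toTree.trace x) ((node i J next).toTree.decision x) with hval
    set sub : X → (Fin n → X) → ℝ := fun y x =>
      c ((i, y) :: (next (J y)).toTree.trace x) ((next (J y)).toTree.decision x) with hsub
    have hpo : ∀ y, (next (J y)).toTree.ProbesOnce (insert i S) := hτ.2
    have hsv : ∀ y x, val (Function.update x i y) = sub y x := by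
      intro y x
      have := (hpo y).update (Finset.mem_insert_self i S) x y
      simp [hval, hsub, toTree, DecisionTree.trace, DecisionTree.decision, this]
    have hsm : ∀ y, Measurable (sub y) := fun y => by
      simp only [← funext (hsv y)]
      exact hc.comp measurable_update_left
    have hsF : ∀ y x, 0 ≤ sub y x ∧ sub y x ≤ F := fun y x => hsv y x ▸ hF _
    have hF0 : 0 ≤ F := (hF fun _ => lo).1.trans (hF fun _ => lo).2
    have hsg : ∀ y x, sub y x = g (J y :: (next (J y)).leafOf x) (Function.update x i y) := by
      intro y x
      rw [← hsv y x, hval]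
      dsimp only
      rw [hg]
      simp [leafOf, leafOf_update (hpo y) (Finset.mem_insert_self i S)]
    have hIH : ∀ y, |∫ x, sub y x ∂Measure.pi D - ∫ x, sub y x ∂Measure.pi E|
        ≤ k * (F + V) * ∫ x, (next (J y)).probedWeight ε x ∂Measure.pi D := by
      intro y
      -- The subtree inherits a cost with the first observation prefixed, and leaf functions with
      -- coordinate i frozen at y.
      refine ih (J y) (c := fun l d => c ((i, y) :: l) d)
        (g := fun ℓ x => g (J y :: ℓ) (Function.update x i y)) (hpo y) (hsm y) (hsF y)
        (fun ℓ x j => ?_) (hsg y)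
      -- In direction i the frozen leaf function is constant; in the other directions its slices are
      -- slices of g.
      by_cases hj : j = i
      · subst hj
        simp only [Function.update_idem]
        rw [eVariationOn.constant_on]
        · exact zero_le
        · rintro _ ⟨_, _, rfl⟩ _ ⟨_, _, rfl⟩
          rfl
      · simp only [Function.update_comm hj]
        exact hV _ _ _
    set hD : X → ℝ := fun y => ∫ x, sub y x ∂Measure.pi D with hhD
    set hE : X → ℝ := fun y => ∫ x, sub y x ∂Measure.pi E with hhE
    have hDm : Measurable hD := by
      simpa only [hhD, ← hsv] using measurable_integral_resample D i hc
    have hEm : Measurable hE := by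
      simpa only [hhE, ← hsv] using measurable_integral_resample E i hc
    have bdd : ∀ (M : Fin n → Measure X) [∀ i, IsProbabilityMeasure (M i)] (y : X),
        0 ≤ ∫ x, sub y x ∂Measure.pi M ∧ ∫ x, sub y x ∂Measure.pi M ≤ F := by
      intro M _ y
      refine ⟨integral_nonneg fun x => (hsF y x).1, ?_⟩
      refine (integral_mono (integrable_of_bounded (hsm y) (hsF y)) (integrable_const F)
        fun x => (hsF y x).2).trans (by simp)
    have hvD : ∫ x, val x ∂Measure.pi D = ∫ y, hD y ∂D i := by
      simpa only [hhD, ← hsv] using integral_pi_eq_integral_resample D i hc hF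
    have hvE : ∫ x, val x ∂Measure.pi E = ∫ y, hE y ∂E i := by
      simpa only [hhE, ← hsv] using integral_pi_eq_integral_resample E i hc hF
    obtain ⟨p, hp, hpR⟩ := exists_monotone_control (lo := lo) (hi := hi) J (h := hE) (F := F) (V := V)
      (bdd E) fun s => by
        refine eVariationOn_integral_le (μ := Measure.pi E) (f := fun x y => sub y x)
          (fun y => hsm y) (fun x y => hsF y x) fun x => ?_
        -- Within the branch s the subtree is fixed, and the leaf reached does not depend on y
        -- because i is not probed again. So y only moves along a one-dimensional slice of a single
        -- leaf function.
        have : Set.EqOn (fun y => sub y x)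
            (fun y => g (s :: (next s).leafOf x) (Function.update x i y)) (J ⁻¹' {s}) := by
          rintro y rfl
          exact hsg y x
        rw [eVariationOn.congr this]
        exact (eVariationOn.mono _ (Set.subset_univ _)).trans (hV _ _ _)
    have h₁ := (hclose i).abs_integral_sub_le hX hp
    have hWm := measurable_probedWeight ε (node i J next)
    have hWb := probedWeight_mem hε hτ
    set W : X → ℝ := fun y => ∫ x, (next (J y)).probedWeight ε x ∂Measure.pi D with hW
    have hWv : ∀ y, ∫ x, (node i J next).probedWeight ε (Function.update x i y) ∂Measure.pi D
        = ε i + W y := by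
      intro y
      have hb := probedWeight_mem hε (hpo y)
      simp only [probedWeight_node, Function.update_self,
        probedWeight_update ε (hpo y) (Finset.mem_insert_self i S)]
      rw [integral_add (integrable_const _)
        (integrable_of_bounded (measurable_probedWeight ε _) hb)]
      simp [hW]
    have hWb' : ∀ y, 0 ≤ W y ∧ W y ≤ ∑ i, ε i := by
      intro y
      have hb := probedWeight_mem hε (hpo y)
      refine ⟨integral_nonneg fun x => (hb x).1, ?_⟩
      refine (integral_mono (integrable_of_bounded (measurable_probedWeight ε _) hb)
        (integrable_const _) fun x => (hb x).2).trans (by simp)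
    have hWm' : Measurable W := by
      have := (measurable_integral_resample D i hWm).sub_const (ε i)
      simpa only [hWv, add_sub_cancel_left] using this
    have hWint : Integrable W (D i) := integrable_of_bounded hWm' hWb'
    have h₂ : ∫ x, (node i J next).probedWeight ε x ∂Measure.pi D = ε i + ∫ y, W y ∂D i := by
      rw [integral_pi_eq_integral_resample D i hWm hWb]
      simp only [hWv]
      rw [integral_add (integrable_const _) hWint]
      simp
    have hDi : Integrable hD (D i) := integrable_of_bounded hDm (bdd D)
    have hEi : Integrable hE (D i) := integrable_of_bounded hEm (bdd E)
    have h₃ : |∫ y, hD y ∂D i - ∫ y, hE y ∂D i| ≤ k * (F + V) * ∫ y, W y ∂D i := by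
      rw [← integral_sub hDi hEi, ← integral_const_mul]
      exact (abs_integral_le_integral_abs).trans
        (integral_mono (hDi.sub hEi).abs (hWint.const_mul _) hIH)
    have h₄ : ε i * (p hi - p lo) ≤ ε i * (k * (F + V)) := mul_le_mul_of_nonneg_left hpR (hε i)
    -- The continuation is changed first, while the root item still has distribution D i, and the
    -- root afterwards. This order makes the accumulated weight an expectation under D.
    calc |∫ x, val x ∂Measure.pi D - ∫ x, val x ∂Measure.pi E|
        ≤ |∫ y, hD y ∂D i - ∫ y, hE y ∂D i| + |∫ y, hE y ∂D i - ∫ y, hE y ∂E i| := by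
          rw [hvD, hvE]
          exact abs_sub_le _ _ _
      _ ≤ k * (F + V) * ∫ y, W y ∂D i + ε i * (k * (F + V)) := add_le_add h₃ (h₁.trans h₄)
      _ = k * (F + V) * ∫ x, (node i J next).probedWeight ε x ∂Measure.pi D := by
          rw [h₂]
          ring

end ThresholdTree

/-! ## Masses under finitely supported distributions -/

section Masses

variable {X : Type}

open Classical in
/-- The number of entries of a list that lie in a set. -/
def hits (S : Set X) (l : List X) : ℕ := l.countP (· ∈ S)

theorem hits_cons_of_mem {S : Set X} {y : X} (h : y ∈ S) (l : List X) :
    hits S (y :: l) = hits S l + 1 := by simp [hits, h]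

theorem hits_cons_of_notMem {S : Set X} {y : X} (h : y ∉ S) (l : List X) :
    hits S (y :: l) = hits S l := by simp [hits, h]

theorem hits_le_length (S : Set X) (l : List X) : hits S l ≤ l.length := List.countP_le_length

theorem hits_mono {S S' : Set X} (h : S ⊆ S') (l : List X) : hits S l ≤ hits S' l :=
  List.countP_mono_left fun y _ hy => by simpa using h (by simpa using hy)

theorem hits_compl (S : Set X) (l : List X) : hits Sᶜ l + hits S l = l.length := by
  induction l with
  | nil => rfl
  | cons y l ih =>
    by_cases h : y ∈ S
    · rw [hits_cons_of_mem h, hits_cons_of_notMem (by simpa using h), List.length_cons]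
      omega
    · rw [hits_cons_of_notMem h, hits_cons_of_mem (by simpa using h), List.length_cons]
      omega

theorem hits_eq_length {S : Set X} {l : List X} (h : ∀ y ∈ l, y ∈ S) : hits S l = l.length :=
  List.countP_eq_length.2 fun y hy => by simpa using h y hy

/-- A set that contains everything after each of its elements. -/
def ClosedUnder (rel : X → X → Prop) (S : Set X) : Prop := ∀ y z, rel y z → y ∈ S → z ∈ S

/-- Invariant of the search: nothing is lost, and the candidate precedes everything discarded so
far. -/
theorem foldl_sweepStep_spec {rel : X → X → Prop} (htot : ∀ y z, rel y z ∨ rel z y)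
    (htrans : ∀ w y z, rel w y → rel y z → rel w z) (l : List X) (s : X × List X)
    (hs : ∀ y ∈ s.2, rel s.1 y) :
    ((l.foldl (sweepStep rel) s).1 :: (l.foldl (sweepStep rel) s).2).Perm (s.1 :: s.2 ++ l) ∧
      ∀ y ∈ (l.foldl (sweepStep rel) s).2, rel (l.foldl (sweepStep rel) s).1 y := by
  induction l generalizing s with
  | nil => simpa using hs
  | cons y l ih =>
    rw [List.foldl_cons]
    by_cases hy : rel y s.1
    · have e : sweepStep rel s y = (y, s.1 :: s.2) := by simp [sweepStep, hy]
      rw [e]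
      obtain ⟨h₁, h₂⟩ := ih (y, s.1 :: s.2) (by
        simpa using ⟨hy, fun z hz => htrans _ _ _ hy (hs z hz)⟩)
      refine ⟨h₁.trans ?_, h₂⟩
      simpa using (List.perm_middle (a := y) (l₁ := s.1 :: s.2) (l₂ := l)).symm
    · have e : sweepStep rel s y = (s.1, y :: s.2) := by simp [sweepStep, hy]
      rw [e]
      obtain ⟨h₁, h₂⟩ := ih (s.1, y :: s.2) (by
        simpa using ⟨(htot y s.1).resolve_left hy, hs⟩)
      refine ⟨h₁.trans ?_, h₂⟩
      simpa using (List.perm_middle (a := y) (l₁ := s.2) (l₂ := l)).symm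

/-- If the removed first element lies in S, then by closedness all entries do; otherwise S loses
nothing. Either way the count is merely capped by the new length. -/
theorem hits_dropFirst {rel : X → X → Prop} (htot : ∀ y z, rel y z ∨ rel z y)
    (htrans : ∀ w y z, rel w y → rel y z → rel w z) {S : Set X} (hS : ClosedUnder rel S)
    (l : List X) : hits S (dropFirst rel l) = min (hits S l) (l.length - 1) := by
  cases l with
  | nil => simp [dropFirst, hits]
  | cons x l =>
    obtain ⟨h₁, h₂⟩ := foldl_sweepStep_spec htot htrans l (x, []) (by simp)
    simp only [List.cons_append, List.nil_append] at h₁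
    change hits S (l.foldl (sweepStep rel) (x, [])).2 = _
    have hlen := h₁.length_eq
    have hc : hits S _ = hits S _ := h₁.countP_eq _
    have hle := hits_le_length S (l.foldl (sweepStep rel) (x, [])).2
    simp only [List.length_cons] at hlen ⊢
    by_cases hm : (l.foldl (sweepStep rel) (x, [])).1 ∈ S
    · have := hits_eq_length fun y hy => hS _ _ (h₂ y hy) hm
      rw [hits_cons_of_mem hm] at hc
      omega
    · rw [hits_cons_of_notMem hm] at hc
      omega

theorem hits_iterate_dropFirst {rel : X → X → Prop} (htot : ∀ y z, rel y z ∨ rel z y)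
    (htrans : ∀ w y z, rel w y → rel y z → rel w z) {S : Set X} (hS : ClosedUnder rel S)
    (l : List X) (r : ℕ) :
    hits S ((dropFirst rel)^[r] l) = min (hits S l) (l.length - r) := by
  induction r with
  | zero => simpa using hits_le_length S l
  | succ r ih =>
    rw [Function.iterate_succ_apply', hits_dropFirst htot htrans hS, ih,
      length_iterate_dropFirst]
    omega

variable [MeasurableSpace X]

open Classical in
theorem distOf_real {l : List (X × ℝ)} (hl : ∀ p ∈ l, 0 ≤ p.2) {S : Set X}
    (hS : MeasurableSet S) :
    (distOf l).real S = (l.map fun p => if p.1 ∈ S then p.2 else 0).sum ∧ distOf l S ≠ ∞ := by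
  induction l with
  | nil => simp [distOf, measureReal_def]
  | cons p l ih =>
    obtain ⟨h₁, h₂⟩ := ih fun q hq => hl q (by simp [hq])
    have e : distOf (p :: l) S
        = ENNReal.ofReal p.2 * S.indicator 1 p.1 + distOf l S := by
      simp [distOf, Measure.dirac_apply' _ hS]
    have hp := hl p (by simp)
    have hne : ENNReal.ofReal p.2 * S.indicator 1 p.1 ≠ ∞ := by
      by_cases hpS : p.1 ∈ S <;> simp [hpS]
    refine ⟨?_, by rw [e]; exact ENNReal.add_ne_top.2 ⟨hne, h₂⟩⟩
    rw [measureReal_def, e, ENNReal.toReal_add hne h₂, ← measureReal_def, h₁, List.map_cons,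
      List.sum_cons]
    by_cases hpS : p.1 ∈ S <;> simp [hpS, hp]

theorem IsDist.isProbabilityMeasure {l : List (X × ℝ)} (hl : IsDist l) :
    IsProbabilityMeasure (distOf l) := by
  obtain ⟨h₁, h₂⟩ := distOf_real hl.1 MeasurableSet.univ
  refine ⟨?_⟩
  rw [← ENNReal.toReal_eq_one_iff, ← measureReal_def, h₁, ← hl.2]
  simp

open Classical in
theorem shifted_real (rel : X → X → Prop) (j : ℕ) (e : X) (l : List X) {S : Set X}
    (hS : MeasurableSet S) :
    (distOf (shifted rel j e l)).real S
      = hits S ((dropFirst rel)^[trimCount j l.length] l) * (1 / (l.length : ℝ)) +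
        if e ∈ S then 1 - ((l.length : ℝ) - (trimCount j l.length : ℕ)) * (1 / (l.length : ℝ))
        else 0 := by
  rw [(distOf_real (isDist_shifted rel j e l).1 hS).1, shifted_eq]
  simp only [List.map_append, List.map_reverse, List.map_map, List.sum_append, List.sum_reverse,
    List.map_cons, List.map_nil, List.sum_singleton, Function.comp_def]
  congr 1
  generalize (dropFirst rel)^[_] l = l'
  induction l' with
  | nil => simp [hits]
  | cons y l' ih =>
    by_cases hy : y ∈ S
    · rw [List.map_cons, List.sum_cons, ih, hits_cons_of_mem hy]
      simp only [hy, if_true]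
      push_cast
      ring
    · rw [List.map_cons, List.sum_cons, ih, hits_cons_of_notMem hy]
      simp [hy]

/-- The shifted empirical distribution gives more mass to closed sets than the true distribution,
but not much more. -/
theorem shifted_spec {rel : X → X → Prop} (htot : ∀ y z, rel y z ∨ rel z y)
    (htrans : ∀ w y z, rel w y → rel y z → rel w z) {e : X} (he : ∀ y, rel y e) {j : ℕ}
    (hj : 1 ≤ j) {l : List X} (hl : l ≠ []) {D : Measure X} [IsProbabilityMeasure D] {S : Set X}
    (hS : ClosedUnder rel S) (hSm : MeasurableSet S)
    (hD : |(hits S l : ℝ) / l.length - D.real S| ≤ 3 * √(j / l.length)) :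
    D.real S ≤ (distOf (shifted rel j e l)).real S ∧
      |D.real S - (distOf (shifted rel j e l)).real S| ≤ 7 * √(j / l.length) := by
  set m := l.length with hm
  have hm0 : 0 < m := List.length_pos_iff.2 hl
  have hm0' : (0 : ℝ) < m := by exact_mod_cast hm0
  set r := trimCount j m with hr
  set w := √((j : ℝ) / m) with hw
  have hw0 : 0 ≤ w := Real.sqrt_nonneg _
  have hmw : m * w = √(j * m) := by
    rw [hw, show (j : ℝ) * m = m ^ 2 * (j / m) by field_simp, Real.sqrt_mul (by positivity),
      Real.sqrt_sq hm0'.le]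
  have hsq : (m * w) * (m * w) = j * m := by rw [hmw, Real.mul_self_sqrt (by positivity)]
  have hw1 : 1 ≤ m * w := by
    rw [hmw, Real.one_le_sqrt]
    exact_mod_cast Nat.mul_pos hj hm0
  have hrm : r ≤ m := trimCount_le _ _
  -- If r > 0, then r − 1 still failed the stopping test, so r ≤ 3mw + 1; the extra 1 is absorbed
  -- because mw = √(jm) ≥ 1.
  have hr_upper : (r : ℝ) ≤ 4 * (m * w) := by
    rcases Nat.eq_zero_or_pos r with h0 | hpos
    · rw [h0]
      push_cast
      linarith
    · have h := (lt_trimCount_iff.1 (show r - 1 < trimCount j m by omega)).2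
      have h' : ((r - 1 : ℕ) : ℝ) * (r - 1 : ℕ) < 9 * (j * m) := by
        rw [← mul_assoc]
        exact_mod_cast h
      rw [Nat.cast_sub hpos, Nat.cast_one, ← hsq] at h'
      have : (r : ℝ) - 1 ≤ 3 * (m * w) := by
        by_contra! hcon
        nlinarith
      linarith
  -- Either every sample was moved, and then a nonempty closed set has full mass, or the moved mass
  -- compensates the sampling error 3w.
  have hr_lower : r = m ∨ 3 * (m * w) ≤ r := by
    rcases hrm.eq_or_lt with h | h
    · exact .inl h
    · right
      have hn : ¬ r < trimCount j m := lt_irrefl _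
      rw [lt_trimCount_iff] at hn
      have h' : 9 * j * m ≤ r * r := by
        by_contra hcon
        exact hn ⟨h, by omega⟩
      have h'' : 9 * (j * m : ℝ) ≤ r * r := by
        rw [← mul_assoc]
        exact_mod_cast h'
      rw [← hsq] at h''
      by_contra! hcon
      nlinarith [(Nat.cast_nonneg r : (0 : ℝ) ≤ r)]
  have hnn : 0 ≤ D.real S := measureReal_nonneg
  have hle1 : D.real S ≤ 1 := measureReal_le_one
  rcases S.eq_empty_or_nonempty with rfl | ⟨y, hy⟩
  · simp only [measureReal_empty]
    exact ⟨le_rfl, by simpa using hw0⟩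
  have heS : e ∈ S := hS y e (he y) hy
  -- The samples in S that remain and the mass r/m moved to e add up to the frequency of S raised by
  -- r/m, capped at 1.
  have hE : (distOf (shifted rel j e l)).real S = min (hits S l / m + r / m : ℝ) 1 := by
    rw [shifted_real _ _ _ _ hSm, if_pos heS, hits_iterate_dropFirst htot htrans hS, ← hm, ← hr,
      Nat.cast_min, Nat.cast_sub hrm]
    rcases le_total (hits S l : ℝ) (m - r) with h | h
    · rw [min_eq_left h, min_eq_left]
      · field_simp
        ring
      · rw [← add_div, div_le_one hm0']
        linarith
    · rw [min_eq_right h, min_eq_right]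
      · ring
      · rw [← add_div, one_le_div hm0']
        linarith
  have hr_upper' : (r : ℝ) / m ≤ 4 * w := by
    rw [div_le_iff₀ hm0']
    linarith
  have hr0 : 0 ≤ (r : ℝ) / m := by positivity
  rw [hE]
  rw [abs_le] at hD ⊢
  refine ⟨le_min ?_ hle1, ?_, ?_⟩
  · rcases hr_lower with h | h
    · have : (r : ℝ) / m = 1 := by
        rw [h]
        field_simp
      have : (0 : ℝ) ≤ hits S l / m := by positivity
      linarith
    · have : 3 * w ≤ (r : ℝ) / m := by
        rw [le_div_iff₀ hm0']
        linarith
      linarith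
  · have := min_le_left (hits S l / m + r / m : ℝ) 1
    linarith
  · rcases min_choice (hits S l / m + r / m : ℝ) 1 with h | h <;> rw [h] <;> linarith

end Masses

/-! ## A finite family of test sets -/

section TestSets

variable {X : Type} [LinearOrder X] [TopologicalSpace X] [OrderTopology X]
  [mX : MeasurableSpace X] (D : Measure X) [hD : IsProbabilityMeasure D]

/-- The set is an upper set. If it has a least element g, it lies in `Ici g`. Otherwise it is the
union of the rays `Ioi y` over its elements; countably many of these suffice by second countability,
they form a chain, and continuity from below applies. Atoms of D need no special treatment. -/
theorem measureReal_setOf_Ici_le [SecondCountableTopology X] {c : ℝ} (hc : 0 ≤ c) : D.real {y | D.real (Set.Ici y) ≤ c} ≤ c := by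
  set A : Set X := {y | D.real (Set.Ici y) ≤ c} with hA
  have hup : IsUpperSet A := fun y z hyz (hy : _ ≤ c) =>
    (measureReal_mono (Set.Ici_subset_Ici.2 hyz)).trans hy
  by_cases hmin : ∃ g ∈ A, ∀ y ∈ A, g ≤ y
  · obtain ⟨g, hg, hmin⟩ := hmin
    exact (measureReal_mono fun y hy => hmin y hy).trans hg
  · push Not at hmin
    obtain ⟨B, hBA, hBc, hBU⟩ :=
      TopologicalSpace.isOpen_biUnion_countable A (fun y => Set.Ioi y) fun y _ => isOpen_Ioi
    have hAU : A = ⋃ y ∈ B, Set.Ioi y := by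
      rw [hBU]
      ext z
      simp only [Set.mem_iUnion, Set.mem_Ioi, exists_prop]
      exact ⟨fun hz => hmin z hz, fun ⟨y, hy, hyz⟩ => hup hyz.le hy⟩
    rw [hAU, measureReal_def]
    refine ENNReal.toReal_le_of_le_ofReal hc ?_
    rw [measure_biUnion_eq_iSup hBc]
    · refine iSup₂_le fun y hy => ?_
      rw [ENNReal.le_ofReal_iff_toReal_le (measure_ne_top _ _) hc]
      exact (measureReal_mono Set.Ioi_subset_Ici_self).trans (hBA hy)
    · intro y hy z hz
      rcases le_total y z with h | h
      · exact ⟨y, hy, subset_rfl, Set.Ioi_subset_Ioi h⟩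
      · exact ⟨z, hz, Set.Ioi_subset_Ioi h, subset_rfl⟩

theorem measureReal_setOf_Iic_le [SecondCountableTopology X] {c : ℝ} (hc : 0 ≤ c) : D.real {y | D.real (Set.Iic y) ≤ c} ≤ c :=
  @measureReal_setOf_Ici_le Xᵒᵈ _ _ _ mX D hD _ c hc

variable [BorelSpace X]

/-- Sets that detect deviations from `D`. -/
def testSet (T : ℕ) (z : ℕ × Bool) : Set X :=
  if z.2 then {y | D.real (Set.Ici y) ≤ z.1 / T} else {y | D.real (Set.Iic y) ≤ z.1 / T}

theorem measurableSet_testSet (T : ℕ) (z : ℕ × Bool) : MeasurableSet (testSet D T z) := by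
  unfold testSet
  split
  · have : IsUpperSet {y | D.real (Set.Ici y) ≤ z.1 / T} := fun y z hyz (hy : _ ≤ _) =>
      (measureReal_mono (Set.Ici_subset_Ici.2 hyz)).trans hy
    exact this.ordConnected.measurableSet
  · have : IsLowerSet {y | D.real (Set.Iic y) ≤ z.1 / T} := fun y z hyz (hy : _ ≤ _) =>
      (measureReal_mono (Set.Iic_subset_Iic.2 hyz)).trans hy
    exact this.ordConnected.measurableSet

/-- If the frequencies of the test sets are not too large, then the empirical distribution is close
to `D`. -/
theorem abs_frequency_sub_le [SecondCountableTopology X] {T : ℕ} (hT : 0 < T) {l : List X} (hl : l ≠ []) {ε : ℝ}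
    (h : ∀ j ≤ T, ∀ b, (hits (testSet D T (j, b)) l : ℝ) / l.length
      ≤ D.real (testSet D T (j, b)) + ε) {U : Set X} (hU : IsUpperSet U) :
    |(hits U l : ℝ) / l.length - D.real U| ≤ ε + 1 / T := by
  have hl0 : (0 : ℝ) < l.length := by exact_mod_cast List.length_pos_iff.2 hl
  have hT0 : (0 : ℝ) < T := by exact_mod_cast hT
  have key : ∀ (S : Set X) (b : Bool), (∀ y ∈ S, D.real (if b then Set.Ici y else Set.Iic y)
      ≤ D.real S) → (hits S l : ℝ) / l.length ≤ D.real S + (ε + 1 / T) := by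
    intro S b hS
    -- The mass of S is rounded up to a multiple of 1/T. The corresponding test set contains S and
    -- has mass at most j/T, which exceeds the mass of S by at most 1/T.
    set j := ⌈T * D.real S⌉₊ with hj
    have hjT : j ≤ T := by
      refine Nat.ceil_le.2 ?_
      nlinarith [measureReal_le_one (μ := D) (s := S)]
    have hj₁ : D.real S ≤ j / T := by
      rw [le_div_iff₀ hT0, mul_comm]
      exact Nat.le_ceil _
    have hj₂ : (j : ℝ) / T ≤ D.real S + 1 / T := by
      rw [div_le_iff₀ hT0, add_mul, one_div_mul_cancel hT0.ne', mul_comm]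
      exact (Nat.ceil_lt_add_one (by positivity)).le
    have hsub : S ⊆ testSet D T (j, b) := by
      intro y hy
      have := (hS y hy).trans hj₁
      cases b <;> simpa [testSet] using this
    have hD : D.real (testSet D T (j, b)) ≤ j / T := by
      have h0 : (0 : ℝ) ≤ j / T := by positivity
      cases b
      · simpa [testSet] using measureReal_setOf_Iic_le D h0
      · simpa [testSet] using measureReal_setOf_Ici_le D h0
    calc (hits S l : ℝ) / l.length ≤ (hits (testSet D T (j, b)) l : ℝ) / l.length := by
          gcongr
          exact hits_mono hsub l
      _ ≤ D.real (testSet D T (j, b)) + ε := h j hjT b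
      _ ≤ _ := by linarith
  -- One-sided bounds are enough: the upper bound for the complement of U, a lower set, is the lower
  -- bound for U.
  have h₁ := key U true fun y hy => measureReal_mono fun z hz => hU hz hy
  have h₂ := key Uᶜ false fun y hy => measureReal_mono fun z hz hzU => hy (hU hz hzU)
  have h₃ : (hits Uᶜ l : ℝ) + hits U l = l.length := by exact_mod_cast hits_compl U l
  have h₄ : (hits Uᶜ l : ℝ) / l.length = 1 - hits U l / l.length := by
    rw [eq_sub_iff_add_eq, ← add_div, h₃, div_self hl0.ne']
  rw [h₄, probReal_compl_eq_one_sub hU.ordConnected.measurableSet] at h₂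
  rw [abs_le]
  constructor <;> linarith

end TestSets

/-! ## Concentration of the empirical distributions -/

theorem samples_append_singleton {n : ℕ} {X : Type} (i : Fin n) (H : List (List (Fin n × X)))
    {s : List (Fin n)} (hs : s.Nodup) (y : Fin n → X) :
    samples i (H ++ [s.map fun j => (j, y j)])
      = if i ∈ s then y i :: samples i H else samples i H := by
  have key : ∀ acc : List X, (s.map fun j => (j, y j)).foldl
      (fun acc p => if p.1 = i then p.2 :: acc else acc) acc
        = if i ∈ s then y i :: acc else acc := by
    induction s with
    | nil => simp
    | cons j s ih =>
      intro acc
      rw [List.nodup_cons] at hs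
      rw [List.map_cons, List.foldl_cons, ih hs.2]
      by_cases hji : j = i
      · subst hji
        simp [hs.1]
      · simp [hji, Ne.symm hji]
  rw [samples, List.foldl_append, List.foldl_cons, List.foldl_nil, key]
  rfl

/-- Whether i is probed is settled before its outcome is seen. This makes the recorded outcomes of i
fresh samples although the policies are adaptive. -/
theorem DecisionTree.ProbesOnce.mem_items_update {n : ℕ} {X : Type} {σ : DecisionTree n X}
    {S : Finset (Fin n)} (hσ : σ.ProbesOnce S) (i : Fin n) (x : Fin n → X) (y : X) :
    i ∈ σ.items (Function.update x i y) ↔ i ∈ σ.items x := by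
  induction σ generalizing S with
  | leaf d => rfl
  | node j next ih =>
    by_cases hji : j = i
    · subst hji
      simp [items, trace]
    · have := ih (x j) (hσ.2 (x j))
      simp only [items] at this
      simp [items, trace, hji, this]

/-! ### An exponential supermartingale for adaptively collected samples -/

section Hoeffding

variable {X : Type} [MeasurableSpace X] (M : Measure X) [IsProbabilityMeasure M]

/-- The exponential weight of a list of samples, for the event that samples lie in `S`. -/
def expWeight (c : ℝ) (S : Set X) (l : List X) : ℝ :=
  Real.exp (c * (hits S l - M.real S * l.length) - c ^ 2 / 8 * l.length)

/-- A new sample multiplies the weight by exp(c(1_S − M(S)) − c²/8), whose mean is at most 1 by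
Hoeffding's lemma for a variable in [0, 1]. -/
theorem lintegral_expWeight_cons_le (c : ℝ) {S : Set X} (hS : MeasurableSet S) (l : List X) :
    ∫⁻ z, ENNReal.ofReal (expWeight M c S (z :: l)) ∂M ≤ ENNReal.ofReal (expWeight M c S l) := by
  classical
  set f : X → ℝ := S.indicator 1 with hf
  have hfm : Measurable f := measurable_one.indicator hS
  have hf01 : ∀ z, f z ∈ Set.Icc (0 : ℝ) 1 := fun z => by
    by_cases h : z ∈ S <;> simp [hf, h]
  have hsub := ProbabilityTheory.hasSubgaussianMGF_of_mem_Icc (μ := M) hfm.aemeasurable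
    (.of_forall hf01)
  have hint : ∫ z, f z ∂M = M.real S := by simp [hf, integral_indicator_one hS]
  rw [hint] at hsub
  have hmgf := hsub.mgf_le c
  have hexp := hsub.integrable_exp_mul c
  have e : ∀ z, expWeight M c S (z :: l)
      = expWeight M c S l * Real.exp (-(c ^ 2 / 8)) * Real.exp (c * (f z - M.real S)) := by
    intro z
    rw [expWeight, expWeight, ← Real.exp_add, ← Real.exp_add]
    congr 1
    by_cases h : z ∈ S
    · rw [hits_cons_of_mem h]
      simp [hf, h]
      ring
    · rw [hits_cons_of_notMem h]
      simp [hf, h]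
      ring
  have hpos : 0 ≤ expWeight M c S l := (Real.exp_pos _).le
  simp only [e]
  rw [← ofReal_integral_eq_lintegral_ofReal (hexp.const_mul _)
    (.of_forall fun z => by positivity), integral_const_mul]
  refine ENNReal.ofReal_le_ofReal ?_
  have h₁ : ∫ z, Real.exp (c * (f z - M.real S)) ∂M ≤ Real.exp (c ^ 2 / 8) := by
    refine hmgf.trans (Real.exp_le_exp.2 (le_of_eq ?_))
    simp
    ring
  calc expWeight M c S l * Real.exp (-(c ^ 2 / 8)) * ∫ z, Real.exp (c * (f z - M.real S)) ∂M
      ≤ expWeight M c S l * Real.exp (-(c ^ 2 / 8)) * Real.exp (c ^ 2 / 8) := by gcongr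
    _ = expWeight M c S l := by
      rw [mul_assoc, ← Real.exp_add]
      simp

end Hoeffding

namespace Instance

variable {I : Instance} {L : Prog} {B T : ℕ} {pol : List I.Obs → I.Policy}

theorem history_update (pol : List I.Obs → I.Policy) (x : ℕ → Fin I.n → I.X) (t : ℕ)
    (y : Fin I.n → I.X) {s : ℕ} (hs : s ≤ t) :
    I.history pol (Function.update x t y) s = I.history pol x s := by
  induction s with
  | zero => rfl
  | succ s ih => simp [history, ih (by omega), show s ≠ t by omega]

theorem Implements.samples_history_succ (hpol : I.Implements L B T pol) {t : ℕ} (ht : t < T)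
    (i : Fin I.n) (x : ℕ → Fin I.n → I.X) :
    samples i (I.history pol x (t + 1)) =
      if i ∈ I.probes pol x t then x t i :: samples i (I.history pol x t)
      else samples i (I.history pol x t) := by
  rw [history, DecisionTree.trace_eq_map_items]
  exact samples_append_singleton i _ ((I.probesOnce _ (hpol x t ht).1).items_spec (x t)).1 (x t)

theorem Implements.measurable_length_samples (hpol : I.Implements L B T pol) (i : Fin I.n) {t : ℕ}
    (ht : t ≤ T) : Measurable fun x => (samples i (I.history pol x t)).length := by
  classical
  induction t with
  | zero => exact measurable_const
  | succ t ih =>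
    have e : (fun x => (samples i (I.history pol x (t + 1))).length)
        = fun x => (samples i (I.history pol x t)).length +
          if i ∈ I.probes pol x t then 1 else 0 := by
      ext x
      rw [hpol.samples_history_succ ht]
      split <;> simp
    rw [e]
    exact (ih (by omega)).add (Measurable.ite
      (hpol.measurable_probes ht (MeasurableSet.of_discrete (s := {s : List (Fin I.n) | i ∈ s})))
      measurable_const measurable_const)

theorem Implements.measurable_hits_samples (hpol : I.Implements L B T pol) (i : Fin I.n)
    {S : Set I.X} (hS : MeasurableSet S) {t : ℕ} (ht : t ≤ T) :
    Measurable fun x => hits S (samples i (I.history pol x t)) := by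
  classical
  induction t with
  | zero => exact measurable_const
  | succ t ih =>
    have e : (fun x => hits S (samples i (I.history pol x (t + 1))))
        = fun x => hits S (samples i (I.history pol x t)) +
          if i ∈ I.probes pol x t ∧ x t i ∈ S then 1 else 0 := by
      ext x
      rw [hpol.samples_history_succ ht]
      by_cases h₁ : i ∈ I.probes pol x t
      · by_cases h₂ : x t i ∈ S
        · simp [h₁, h₂, hits_cons_of_mem]
        · simp [h₁, h₂, hits_cons_of_notMem]
      · simp [h₁]
    rw [e]
    refine (ih (by omega)).add (Measurable.ite (.inter
      (hpol.measurable_probes ht (MeasurableSet.of_discrete (s := {s : List (Fin I.n) | i ∈ s})))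
      ?_) measurable_const measurable_const)
    exact ((measurable_pi_apply i).comp (measurable_pi_apply t)) hS

variable (D : Fin I.n → Measure I.X) [∀ i, IsProbabilityMeasure (D i)]

theorem measurePreserving_resample_law (I : Instance) (D : Fin I.n → Measure I.X)
    [∀ i, IsProbabilityMeasure (D i)] (t : ℕ) :
    MeasurePreserving (fun z : (ℕ → Fin I.n → I.X) × (Fin I.n → I.X) => Function.update z.1 t z.2)
      ((StochasticProblem.law I D).prod (Measure.pi D)) (StochasticProblem.law I D) :=
  measurePreserving_resample (X := fun _ : ℕ => Fin I.n → I.X) (fun _ => Measure.pi D) t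

instance isProbabilityMeasure_law : IsProbabilityMeasure (StochasticProblem.law I D) := by
  unfold StochasticProblem.law
  infer_instance

theorem lintegral_law_eq (t : ℕ) {G : (ℕ → Fin I.n → I.X) → ℝ≥0∞} (hG : Measurable G) :
    ∫⁻ x, G x ∂StochasticProblem.law I D
      = ∫⁻ x, ∫⁻ y, G (Function.update x t y) ∂Measure.pi D ∂StochasticProblem.law I D := by
  have hr := measurePreserving_resample_law I D t
  rw [← hr.lintegral_comp hG]
  exact lintegral_prod (fun z => G (Function.update z.1 t z.2)) (hG.comp hr.measurable).aemeasurable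

theorem lintegral_pi_eq (i : Fin I.n) {G : (Fin I.n → I.X) → ℝ≥0∞} (hG : Measurable G) :
    ∫⁻ y, G y ∂Measure.pi D = ∫⁻ y, ∫⁻ z, G (Function.update y i z) ∂D i ∂Measure.pi D := by
  have hr := measurePreserving_resample_pi D i
  rw [← hr.lintegral_comp hG]
  exact lintegral_prod (fun z => G (Function.update z.1 i z.2)) (hG.comp hr.measurable).aemeasurable

/-- Supermartingale property by resampling period t and then, within it, the outcome of item i.
Neither the earlier history nor the event that i is probed changes, so either nothing is added or a
fresh sample is, and the mean weight does not grow. -/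
theorem Implements.lintegral_expWeight_le (hpol : I.Implements L B T pol) (i : Fin I.n) (c : ℝ)
    {S : Set I.X} (hS : MeasurableSet S) {t : ℕ} (ht : t ≤ T) :
    ∫⁻ x, ENNReal.ofReal (expWeight (D i) c S (samples i (I.history pol x t)))
      ∂StochasticProblem.law I D ≤ 1 := by
  induction t with
  | zero => simp [history, samples, expWeight, hits]
  | succ t ih =>
    have hm : ∀ s ≤ T, Measurable fun x =>
        ENNReal.ofReal (expWeight (D i) c S (samples i (I.history pol x s))) := by
      intro s hs
      have h₁ : Measurable fun x => ((samples i (I.history pol x s)).length : ℝ) :=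
        measurable_from_top.comp (hpol.measurable_length_samples i hs)
      have h₂ : Measurable fun x => (hits S (samples i (I.history pol x s)) : ℝ) :=
        measurable_from_top.comp (hpol.measurable_hits_samples i hS hs)
      unfold expWeight
      fun_prop
    have hG := hm (t + 1) ht
    rw [lintegral_law_eq D t hG]
    refine le_trans (lintegral_mono fun x => ?_) (ih (by omega))
    have hGx : Measurable fun y => ENNReal.ofReal (expWeight (D i) c S
        (samples i (I.history pol (Function.update x t y) (t + 1)))) :=
      hG.comp (measurable_update x)
    rw [lintegral_pi_eq D i hGx]
    refine le_trans (lintegral_mono (g := fun _ => ENNReal.ofReal (expWeight (D i) c S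
      (samples i (I.history pol x t)))) fun y => ?_) (by simp)
    have e : ∀ z, samples i (I.history pol
        (Function.update x t (Function.update y i z)) (t + 1)) =
          if i ∈ (pol (I.history pol x t)).items y then z :: samples i (I.history pol x t)
          else samples i (I.history pol x t) := by
      intro z
      rw [hpol.samples_history_succ ht, probes, history_update pol x t _ le_rfl]
      simp only [Function.update_self]
      have := (I.probesOnce _ (hpol x t ht).1).mem_items_update i y z
      simp only [this]
    simp only [e]
    by_cases h : i ∈ (pol (I.history pol x t)).items y
    · simpa only [h, if_true] using lintegral_expWeight_cons_le (D i) c hS _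
    · simp [h]

/-- The tail bound for the frequency of a set among `m` samples of an item. -/
theorem Implements.measure_deviation_le (hpol : I.Implements L B T pol) (i : Fin I.n)
    {S : Set I.X} (hS : MeasurableSet S) {t : ℕ} (ht : t ≤ T) (m : ℕ) {ε : ℝ} (hε : 0 ≤ ε) :
    StochasticProblem.law I D {x | (samples i (I.history pol x t)).length = m ∧
      ((D i).real S + ε) * m ≤ hits S (samples i (I.history pol x t))}
        ≤ ENNReal.ofReal (Real.exp (-(2 * ε ^ 2 * m))) := by
  -- The parameter c = 4ε maximizes cεm − c²m/8, with value 2ε²m.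
  have h := hpol.lintegral_expWeight_le D i (4 * ε) hS ht
  have hsub : {x | (samples i (I.history pol x t)).length = m ∧
      ((D i).real S + ε) * m ≤ hits S (samples i (I.history pol x t))}
      ⊆ {x | ENNReal.ofReal (Real.exp (2 * ε ^ 2 * m)) ≤
        ENNReal.ofReal (expWeight (D i) (4 * ε) S (samples i (I.history pol x t)))} := by
    rintro x ⟨h₁, h₂⟩
    refine ENNReal.ofReal_le_ofReal (Real.exp_le_exp.2 ?_)
    rw [h₁]
    have : 4 * ε * (ε * m) ≤
        4 * ε * (hits S (samples i (I.history pol x t)) - (D i).real S * m) := by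
      gcongr
      linarith
    nlinarith
  have hm : Measurable fun x =>
      ENNReal.ofReal (expWeight (D i) (4 * ε) S (samples i (I.history pol x t))) := by
    have h₁ : Measurable fun x => ((samples i (I.history pol x t)).length : ℝ) :=
      measurable_from_top.comp (hpol.measurable_length_samples i ht)
    have h₂ : Measurable fun x => (hits S (samples i (I.history pol x t)) : ℝ) :=
      measurable_from_top.comp (hpol.measurable_hits_samples i hS ht)
    unfold expWeight
    fun_prop
  refine (measure_mono hsub).trans ?_
  have hpos : 0 < Real.exp (2 * ε ^ 2 * m) := Real.exp_pos _
  have hmk := (mul_meas_ge_le_lintegral hm (ENNReal.ofReal (Real.exp (2 * ε ^ 2 * m)))).trans h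
  rw [Real.exp_neg, ENNReal.ofReal_inv_of_pos hpos, ← one_div,
    ENNReal.le_div_iff_mul_le (by simp [hpos]) (by simp), mul_comm]
  exact hmk

/-- The event that a frequency deviates before period `t`. -/
def badEvent (I : Instance) (pol : List I.Obs → I.Policy) (D : Fin I.n → Measure I.X) (T t : ℕ) :
    Set (ℕ → Fin I.n → I.X) :=
  ⋃ z ∈ (Finset.univ ×ˢ Finset.Icc 1 T ×ˢ (Finset.range (T + 1) ×ˢ Finset.univ) :
      Finset (Fin I.n × ℕ × (ℕ × Bool))),
    {x | (samples z.1 (I.history pol x t)).length = z.2.1 ∧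
      ((D z.1).real (testSet (D z.1) T z.2.2) + 2 * √((Nat.clog 2 (I.n * T) : ℕ) / z.2.1)) * z.2.1
        ≤ hits (testSet (D z.1) T z.2.2) (samples z.1 (I.history pol x t))}

theorem Implements.measurableSet_badEvent (hpol : I.Implements L B T pol) {t : ℕ} (ht : t ≤ T) :
    MeasurableSet (I.badEvent pol D T t) := by
  refine Finset.measurableSet_biUnion _ fun z _ => .inter ?_ ?_
  · exact hpol.measurable_length_samples z.1 ht (measurableSet_singleton _)
  · have h : Measurable fun x =>
        (hits (testSet (D z.1) T z.2.2) (samples z.1 (I.history pol x t)) : ℝ) :=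
      measurable_from_top.comp
        (hpol.measurable_hits_samples z.1 (measurableSet_testSet (D z.1) T z.2.2) ht)
    exact measurableSet_le measurable_const h

theorem cube_mul_exp_le {n T : ℕ} (h : 2 ≤ n * T) :
    ((n * T : ℕ) : ℝ) ^ 3 * Real.exp (-(8 * (Nat.clog 2 (n * T) : ℕ))) ≤ 1 := by
  set j := Nat.clog 2 (n * T)
  have h₁ : ((n * T : ℕ) : ℝ) ≤ 2 ^ j := by exact_mod_cast Nat.le_pow_clog (by norm_num) _
  have h₂ : (2 : ℝ) ^ j ≤ Real.exp j := by
    rw [← Real.exp_one_rpow, Real.rpow_natCast]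
    gcongr
    linarith [Real.add_one_le_exp (1 : ℝ)]
  calc ((n * T : ℕ) : ℝ) ^ 3 * Real.exp (-(8 * j))
      ≤ Real.exp j ^ 3 * Real.exp (-(8 * j)) := by
        gcongr
        exact h₁.trans h₂
    _ = Real.exp (-(5 * j)) := by
        rw [← Real.exp_nat_mul, ← Real.exp_add]
        congr 1
        push_cast
        ring
    _ ≤ 1 := by
        rw [Real.exp_le_one_iff]
        simp

/-- Union bound over items, possible sample counts (the count is random), test sets and periods.
Each single event has probability at most exp(−8j), and nT ≤ 2^j ≤ e^j beats their number, which is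
at most 4(nT)³. -/
theorem Implements.sum_badEvent_le (hpol : I.Implements L B T pol) (hT : 2 ≤ I.n * T) :
    ∑ t ∈ Finset.range T, (StochasticProblem.law I D).real (I.badEvent pol D T t) ≤ 4 := by
  set j := Nat.clog 2 (I.n * T) with hj
  have hT1 : 1 ≤ T := by
    rcases Nat.eq_zero_or_pos T with h | h
    · simp [h] at hT
    · exact h
  have hn1 : 1 ≤ I.n := by
    rcases Nat.eq_zero_or_pos I.n with h | h
    · simp [h] at hT
    · exact h
  have hone : ∀ t ∈ Finset.range T, (StochasticProblem.law I D).real (I.badEvent pol D T t)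
      ≤ (I.n * (T * ((T + 1) * 2)) : ℕ) * Real.exp (-(8 * (j : ℝ))) := by
    intro t ht
    refine (measureReal_biUnion_finset_le _ _).trans ?_
    refine (Finset.sum_le_card_nsmul _ _ (Real.exp (-(8 * (j : ℝ)))) fun z hz => ?_).trans ?_
    · have hz1 : 1 ≤ z.2.1 := by
        simp only [Finset.mem_product, Finset.mem_Icc] at hz
        exact hz.2.1.1
      have hz0 : (0 : ℝ) < z.2.1 := by exact_mod_cast hz1
      rw [measureReal_def]
      refine ENNReal.toReal_le_of_le_ofReal (Real.exp_pos _).le ?_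
      refine (hpol.measure_deviation_le D z.1 (measurableSet_testSet (D z.1) T z.2.2)
        (Finset.mem_range.1 ht).le z.2.1 (by positivity)).trans ?_
      -- For ε = 2√(j/m), the exponent 2ε²m equals 8j.
      refine ENNReal.ofReal_le_ofReal (Real.exp_le_exp.2 (le_of_eq ?_))
      rw [mul_pow, Real.sq_sqrt (by positivity)]
      field_simp
      ring
    · simp [Finset.card_product, nsmul_eq_mul]
  refine (Finset.sum_le_sum hone).trans ?_
  rw [Finset.sum_const, Finset.card_range, nsmul_eq_mul, ← mul_assoc, ← Nat.cast_mul]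
  have hcard : T * (I.n * (T * ((T + 1) * 2))) ≤ 4 * (I.n * T) ^ 3 := by
    have h₁ : T + 1 ≤ 2 * T := by omega
    calc T * (I.n * (T * ((T + 1) * 2))) ≤ T * (I.n * (T * ((2 * T) * 2))) := by gcongr
      _ = 4 * (I.n * T ^ 3) := by ring
      _ ≤ 4 * (I.n ^ 3 * T ^ 3) := by
        gcongr
        exact Nat.le_self_pow (by norm_num) _
      _ = 4 * (I.n * T) ^ 3 := by ring
  have hcard' : ((T * (I.n * (T * ((T + 1) * 2))) : ℕ) : ℝ) ≤ 4 * ((I.n * T : ℕ) : ℝ) ^ 3 := by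
    exact_mod_cast hcard
  calc _ ≤ 4 * ((I.n * T : ℕ) : ℝ) ^ 3 * Real.exp (-(8 * (j : ℝ))) := by gcongr
    _ = 4 * (((I.n * T : ℕ) : ℝ) ^ 3 * Real.exp (-(8 * (j : ℝ)))) := by ring
    _ ≤ 4 * 1 := by
      gcongr
      exact cube_mul_exp_le hT
    _ = 4 := by norm_num

end Instance

/-! ## The estimates outside of the bad event -/

theorem before_total {X : Type} [LinearOrder X] (dir : Bool) (y z : X) :
    before dir y z ∨ before dir z y := by
  cases dir
  · simpa [before] using le_total z y
  · simpa [before] using le_total y z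

theorem before_trans {X : Type} [LinearOrder X] (dir : Bool) (w y z : X) (h₁ : before dir w y)
    (h₂ : before dir y z) : before dir w z := by
  cases dir
  · simp only [before, Bool.false_eq_true, if_false] at *
    exact h₂.trans h₁
  · simp only [before, if_true] at *
    exact h₁.trans h₂

theorem closedUnder_before_true {X : Type} [LinearOrder X] {S : Set X} :
    ClosedUnder (before true) S ↔ IsUpperSet S := by simp [ClosedUnder, before, IsUpperSet]

theorem closedUnder_before_false {X : Type} [LinearOrder X] {S : Set X} :
    ClosedUnder (before false) S ↔ IsLowerSet S := by
  simp only [ClosedUnder, before, Bool.false_eq_true, if_false, IsLowerSet]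

theorem Instance.before_endpoint (I : Instance) (dir : Bool) (y : I.X) :
    before dir y (I.endpoint dir) := by
  cases dir
  · exact y.2.1
  · exact y.2.2

/-- `E` is at least as favorable as `D`, if larger outcomes are favorable (`dir = true`), or if
smaller outcomes are favorable (`dir = false`). -/
def Favors {X : Type} [Preorder X] [MeasurableSpace X] (dir : Bool) (E D : Measure X) : Prop :=
  if dir then Dominates E D else Dominates D E

section Close

variable {X : Type} [LinearOrder X] [TopologicalSpace X] [OrderTopology X] [MeasurableSpace X]
  [BorelSpace X] {D E : Measure X} [IsProbabilityMeasure D] [IsProbabilityMeasure E]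

theorem ClosedUnder.measurableSet {dir : Bool} {S : Set X} (hS : ClosedUnder (before dir) S) :
    MeasurableSet S := by
  cases dir
  · exact (closedUnder_before_false.1 hS).ordConnected.measurableSet
  · exact (closedUnder_before_true.1 hS).ordConnected.measurableSet

theorem favors_of_closedUnder {dir : Bool}
    (h : ∀ S : Set X, ClosedUnder (before dir) S → D.real S ≤ E.real S) : Favors dir E D := by
  have conv : ∀ {M M' : Measure X} [IsProbabilityMeasure M] [IsProbabilityMeasure M'] {S : Set X},
      M.real S ≤ M'.real S → M S ≤ M' S := fun h =>
    (ENNReal.toReal_le_toReal (measure_ne_top _ _) (measure_ne_top _ _)).1 h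
  cases dir
  · intro t
    refine conv ?_
    have := h (Set.Iio t) (closedUnder_before_false.2 (isLowerSet_Iio t))
    rw [← Set.compl_Iio, probReal_compl_eq_one_sub measurableSet_Iio,
      probReal_compl_eq_one_sub measurableSet_Iio]
    linarith
  · exact fun t => conv (h _ (closedUnder_before_true.2 (isUpperSet_Ici t)))

theorem uniformlyClose_of_closedUnder {dir : Bool} {δ : ℝ}
    (h : ∀ S : Set X, ClosedUnder (before dir) S → |D.real S - E.real S| ≤ δ) :
    UniformlyClose D E δ := by
  intro U hU
  cases dir
  · have := h Uᶜ (closedUnder_before_false.2 hU.compl)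
    rw [probReal_compl_eq_one_sub hU.ordConnected.measurableSet,
      probReal_compl_eq_one_sub hU.ordConnected.measurableSet] at this
    rwa [sub_sub_sub_cancel_left, abs_sub_comm] at this
  · exact h U (closedUnder_before_true.2 hU)

end Close

namespace Instance

variable {I : Instance} {L : Prog} {B T : ℕ} {pol : List I.Obs → I.Policy}

theorem Implements.length_samples_le (hpol : I.Implements L B T pol) (i : Fin I.n)
    (x : ℕ → Fin I.n → I.X) {t : ℕ} (ht : t ≤ T) :
    (samples i (I.history pol x t)).length ≤ t := by
  induction t with
  | zero => simp [history, samples]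
  | succ t ih =>
    have := ih (by omega)
    rw [hpol.samples_history_succ ht]
    split
    · simpa using this
    · omega

/-- The radius of the confidence band of an item. -/
def radius (I : Instance) (T : ℕ) (H : List I.Obs) (i : Fin I.n) : ℝ :=
  7 * √((Nat.clog 2 (I.n * T) : ℕ) / (max 1 (samples i H).length : ℕ))

theorem radius_nonneg (T : ℕ) (H : List I.Obs) (i : Fin I.n) : 0 ≤ I.radius T H i := by
  unfold radius
  positivity

instance isProbabilityMeasure_estimate (dir : Bool) (T : ℕ) (H : List I.Obs) (i : Fin I.n) :
    IsProbabilityMeasure (distOf (I.estimate dir T H i)) :=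
  (isDist_shifted _ _ _ _).isProbabilityMeasure

theorem Implements.estimate_spec (hpol : I.Implements L B T pol) (hT : 2 ≤ I.n * T)
    (D : Fin I.n → Measure I.X) [∀ i, IsProbabilityMeasure (D i)] (dir : Bool)
    {x : ℕ → Fin I.n → I.X} {t : ℕ} (ht : t < T) (hx : x ∉ I.badEvent pol D T t) (i : Fin I.n)
    {S : Set I.X} (hS : ClosedUnder (before dir) S) :
    (D i).real S ≤ (distOf (I.estimate dir T (I.history pol x t) i)).real S ∧
      |(D i).real S - (distOf (I.estimate dir T (I.history pol x t) i)).real S|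
        ≤ I.radius T (I.history pol x t) i := by
  classical
  have hSm : MeasurableSet S := hS.measurableSet
  set l := samples i (I.history pol x t) with hl
  have hj : 1 ≤ Nat.clog 2 (I.n * T) := Nat.clog_pos (by norm_num) hT
  set j := Nat.clog 2 (I.n * T) with hjdef
  unfold radius estimate
  rw [← hl, ← hjdef]
  have hle1 : (D i).real S ≤ 1 := measureReal_le_one
  have hnn : 0 ≤ (D i).real S := measureReal_nonneg
  -- Without samples the estimate is the point mass at the favorable endpoint. It favors every
  -- distribution, and the radius is at least 7 thanks to the `max 1`, so closeness is trivial.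
  rcases eq_or_ne l [] with h0 | hne
  · have hr := shifted_real (before dir) j (I.endpoint dir) l hSm
    have hE : (distOf (shifted (before dir) j (I.endpoint dir) l)).real S
        = if I.endpoint dir ∈ S then 1 else 0 := by
      rw [hr, h0]
      simp
    have hD : (D i).real S ≤ if I.endpoint dir ∈ S then (1 : ℝ) else 0 := by
      split
      · exact hle1
      · rename_i hn
        have : S = ∅ := by
          by_contra hS'
          obtain ⟨y, hy⟩ := Set.nonempty_iff_ne_empty.2 hS'
          exact hn (hS _ _ (I.before_endpoint dir y) hy)
        simp [this]
    rw [hE]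
    refine ⟨hD, ?_⟩
    have h1 : 1 ≤ √((j : ℝ) / (max 1 l.length : ℕ)) := by
      rw [h0, Real.one_le_sqrt]
      simpa using hj
    have h2 : |(D i).real S - if I.endpoint dir ∈ S then (1 : ℝ) else 0| ≤ 1 := by
      rw [abs_le]
      split <;> constructor <;> linarith
    linarith
  · have hm1 : 1 ≤ l.length := List.length_pos_iff.2 hne
    -- Keeps the sample count among the indices of the bad event, and lets the rounding error 1/T be
    -- absorbed into √(j/m): the bounds 2√(j/m) and 1/T together give 3√(j/m).
    have hmT : l.length ≤ T := (hpol.length_samples_le i x ht.le).trans ht.le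
    have hm0 : (0 : ℝ) < l.length := by exact_mod_cast hm1
    rw [max_eq_right hm1]
    refine shifted_spec (before_total dir) (before_trans dir) (I.before_endpoint dir) hj hne hS hSm
      ?_
    have hfreq : ∀ k ≤ T, ∀ b, (hits (testSet (D i) T (k, b)) l : ℝ) / l.length
        ≤ (D i).real (testSet (D i) T (k, b)) + 2 * √((j : ℝ) / l.length) := by
      intro k hk b
      by_contra! hcon
      refine hx ?_
      simp only [badEvent, Set.mem_iUnion]
      refine ⟨(i, l.length, (k, b)), ?_, rfl, ?_⟩
      · simp only [Finset.mem_product, Finset.mem_univ, Finset.mem_Icc, Finset.mem_range, true_and,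
          and_true]
        omega
      · exact ((lt_div_iff₀ hm0).1 hcon).le
    have hw : 1 / (T : ℝ) ≤ √((j : ℝ) / l.length) := by
      refine Real.le_sqrt_of_sq_le ?_
      have hT0 : (0 : ℝ) < T := by
        have : (l.length : ℝ) ≤ T := by exact_mod_cast hmT
        linarith
      calc (1 / (T : ℝ)) ^ 2 = 1 / T * (1 / T) := by ring
        _ ≤ 1 / l.length * 1 := by
          gcongr
          rw [div_le_one hT0]
          exact_mod_cast (by omega : 1 ≤ T)
        _ ≤ j / l.length := by
          rw [mul_one]
          gcongr
          exact_mod_cast hj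
    have hup : ∀ {U : Set I.X}, IsUpperSet U →
        |(hits U l : ℝ) / l.length - (D i).real U| ≤ 3 * √((j : ℝ) / l.length) := fun hU => by
      have := abs_frequency_sub_le (D i) (by omega) hne hfreq hU
      linarith
    cases dir
    · have hlow := closedUnder_before_false.1 hS
      have := hup hlow.compl
      have h₃ : (hits Sᶜ l : ℝ) + hits S l = l.length := by exact_mod_cast hits_compl S l
      have h₄ : (hits Sᶜ l : ℝ) / l.length = 1 - hits S l / l.length := by
        rw [eq_sub_iff_add_eq, ← add_div, h₃, div_self hm0.ne']
      rwa [h₄, probReal_compl_eq_one_sub hSm, sub_sub_sub_cancel_left, abs_sub_comm] at this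
    · exact hup (closedUnder_before_true.1 hS)

end Instance

/-! ## The regret in one period -/

namespace StochasticProblem

variable {P : StochasticProblem}

/-- `1` for minimization and `-1` for maximization. -/
def sgn (P : StochasticProblem) : ℝ := if P.maximize then -1 else 1

theorem sgn_mul_le_abs (r : ℝ) : P.sgn * r ≤ |r| := by
  unfold sgn
  split
  · simpa using neg_le_abs r
  · simpa using le_abs_self r

theorem IsApprox.sgn_mul_le {I : Instance} {α : ℝ} {E : Fin I.n → Measure I.X} {σ : I.Policy}
    (h : P.IsApprox I α E σ) : P.sgn * I.expValue E σ ≤ P.sgn * (α * P.opt I E) := by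
  unfold IsApprox at h
  unfold sgn
  split <;> simp_all

theorem regret_eq (I : Instance) (α : ℝ) (D : Fin I.n → Measure I.X)
    [∀ i, IsProbabilityMeasure (D i)] (T : ℕ) (pol : List I.Obs → I.Policy) :
    P.regret I α D T pol = P.sgn * (∫ x, I.total pol T x ∂law I D - T * (α * P.opt I D)) := by
  unfold regret sgn
  split <;> ring

/-- For a monotone problem one of the two directions makes distributions favorable. -/
theorem exists_direction (hP : P.UpMonotone ∨ P.DownMonotone) :
    ∃ dir : Bool, ∀ I ∈ P.instances, ∀ D E : Fin I.n → Measure I.X,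
      (∀ i, IsProbabilityMeasure (D i)) → (∀ i, IsProbabilityMeasure (E i)) →
      (∀ i, Favors dir (E i) (D i)) → P.sgn * P.opt I E ≤ P.sgn * P.opt I D := by
  rcases hP with hP | hP <;> cases hm : P.maximize
  · refine ⟨true, fun I hI D E hD hE h => ?_⟩
    simpa [sgn, hm] using hP I hI D E hD hE h
  · refine ⟨false, fun I hI D E hD hE h => ?_⟩
    simpa [sgn, hm] using hP I hI E D hE hD h
  · refine ⟨false, fun I hI D E hD hE h => ?_⟩
    simpa [sgn, hm] using hP I hI E D hE hD h
  · refine ⟨true, fun I hI D E hD hE h => ?_⟩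
    simpa [sgn, hm] using hP I hI D E hD hE h

theorem IsRatio.nonneg {α : ℝ} (h : P.IsRatio α) : 0 ≤ α := by
  unfold IsRatio at h
  split at h <;> linarith [h]

theorem _root_.StochOpt.Instance.Bounded.expValue_mem {I : Instance} {F : ℝ} (hF : I.Bounded F)
    (D : Fin I.n → Measure I.X) [∀ i, IsProbabilityMeasure (D i)] {σ : I.Policy}
    (hσ : σ ∈ I.feasible) : 0 ≤ I.expValue D σ ∧ I.expValue D σ ≤ F := by
  refine ⟨integral_nonneg fun x => (hF σ hσ x).1, ?_⟩
  refine (integral_mono (integrable_of_bounded (I.measurable_value σ hσ) (hF σ hσ))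
    (integrable_const F) fun x => (hF σ hσ x).2).trans (by simp)

/-- A trivial bound for the loss of a feasible policy. -/
theorem loss_le {I : Instance} {F α : ℝ} (hF : I.Bounded F) (hα : P.IsRatio α)
    (D : Fin I.n → Measure I.X) [∀ i, IsProbabilityMeasure (D i)] {σ : I.Policy}
    (hσ : σ ∈ I.feasible) : P.sgn * (I.expValue D σ - α * P.opt I D) ≤ F := by
  have hv := hF.expValue_mem D hσ
  have hF0 : 0 ≤ F := hv.1.trans hv.2
  unfold IsRatio at hα
  unfold sgn opt
  split
  · rename_i hm
    rw [if_pos hm] at hα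
    have h₀ : 0 ≤ ⨆ σ : I.feasible, I.expValue D σ :=
      Real.iSup_nonneg fun σ => (hF.expValue_mem D σ.2).1
    have h₁ : ⨆ σ : I.feasible, I.expValue D σ ≤ F :=
      Real.iSup_le (fun σ => (hF.expValue_mem D σ.2).2) hF0
    nlinarith [hα.1, hα.2]
  · rename_i hm
    rw [if_neg hm] at hα
    have h₀ : 0 ≤ ⨅ σ : I.feasible, I.expValue D σ :=
      Real.iInf_nonneg fun σ => (hF.expValue_mem D σ.2).1
    nlinarith

end StochasticProblem

theorem Instance.LeafRegular.abs_expValue_sub_le {I : Instance} {k : ℕ} {V : ℝ≥0}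
    (hV : I.LeafRegular k V) {F : ℝ} (hF : I.Bounded F) {D E : Fin I.n → Measure I.X}
    [∀ i, IsProbabilityMeasure (D i)] [∀ i, IsProbabilityMeasure (E i)] {ε : Fin I.n → ℝ}
    (hε : ∀ i, 0 ≤ ε i) (hclose : ∀ i, UniformlyClose (D i) (E i) (ε i))
    {τ : ThresholdTree I.n k I.X} (hτ : τ.toTree ∈ I.feasible) :
    |I.expValue D τ.toTree - I.expValue E τ.toTree|
      ≤ k * (F + V) * ∫ x, τ.probedWeight ε x ∂Measure.pi D := by
  obtain ⟨g, hg₁, hg₂⟩ := hV τ hτ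
  exact ThresholdTree.abs_integral_sub_le hε hclose (lo := I.endpoint false)
    (hi := I.endpoint true) (fun y => ⟨y.2.1, y.2.2⟩) τ (I.probesOnce _ hτ)
    (I.measurable_value _ hτ) (hF _ hτ) (fun ℓ x i => (hg₁ ℓ x i).2) hg₂

/-! ## The total regret -/

namespace Instance

variable {I : Instance} {L : Prog} {B T : ℕ} {pol : List I.Obs → I.Policy}

/-- Resampling the realization of a period does not change expectations. -/
theorem integral_law_eq (D : Fin I.n → Measure I.X) [∀ i, IsProbabilityMeasure (D i)] (t : ℕ)
    {G : (ℕ → Fin I.n → I.X) → ℝ} (hG : Measurable G) {r s : ℝ} (hb : ∀ x, r ≤ G x ∧ G x ≤ s) :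
    Integrable (fun x => ∫ y, G (Function.update x t y) ∂Measure.pi D)
        (StochasticProblem.law I D) ∧
      ∫ x, G x ∂StochasticProblem.law I D
        = ∫ x, ∫ y, G (Function.update x t y) ∂Measure.pi D ∂StochasticProblem.law I D := by
  have hr := measurePreserving_resample_law I D t
  have hint : Integrable (fun z : (ℕ → Fin I.n → I.X) × (Fin I.n → I.X) =>
      G (Function.update z.1 t z.2)) ((StochasticProblem.law I D).prod (Measure.pi D)) :=
    integrable_of_bounded (hG.comp hr.measurable) fun z => hb _
  refine ⟨hint.integral_prod_left, ?_⟩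
  rw [← integral_prod _ hint]
  conv_lhs => rw [← hr.map_eq]
  exact integral_map hr.measurable.aemeasurable hG.aestronglyMeasurable

/-- The total radius of the items probed in period `t`. -/
def probedRadius (I : Instance) (T : ℕ) (pol : List I.Obs → I.Policy) (x : ℕ → Fin I.n → I.X)
    (t : ℕ) : ℝ :=
  ∑ i, if i ∈ I.probes pol x t then I.radius T (I.history pol x t) i else 0

theorem sum_map_eq_sum_ite {n : ℕ} {s : List (Fin n)} (hs : s.Nodup) (ε : Fin n → ℝ) :
    (s.map ε).sum = ∑ i, if i ∈ s then ε i else 0 := by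
  rw [← List.sum_toFinset _ hs, ← Finset.sum_filter]
  congr 1
  ext i
  simp

theorem Implements.measurable_probedRadius (hpol : I.Implements L B T pol) {t : ℕ} (ht : t < T) :
    Measurable fun x => I.probedRadius T pol x t := by
  refine Finset.measurable_sum _ fun i _ => Measurable.ite
    (hpol.measurable_probes ht (MeasurableSet.of_discrete (s := {s : List (Fin I.n) | i ∈ s})))
    ?_ measurable_const
  exact (measurable_from_top (f := fun m : ℕ =>
    7 * √((Nat.clog 2 (I.n * T) : ℕ) / (max 1 m : ℕ) : ℝ))).comp
      (hpol.measurable_length_samples i ht.le)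

theorem radius_le (H : List I.Obs) (i : Fin I.n) :
    I.radius T H i ≤ 7 * √(Nat.clog 2 (I.n * T) : ℕ) := by
  unfold radius
  gcongr
  refine div_le_self (by positivity) ?_
  exact_mod_cast le_max_left _ _

theorem probedRadius_mem (x : ℕ → Fin I.n → I.X) (t : ℕ) :
    0 ≤ I.probedRadius T pol x t ∧
      I.probedRadius T pol x t ≤ I.n * (7 * √(Nat.clog 2 (I.n * T) : ℕ)) := by
  constructor
  · refine Finset.sum_nonneg fun i _ => ?_
    split
    · exact radius_nonneg _ _ _
    · exact le_rfl
  · refine (Finset.sum_le_card_nsmul _ _ (7 * √(Nat.clog 2 (I.n * T) : ℕ)) fun i _ => ?_).trans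
      (by simp)
    split
    · exact radius_le _ _
    · positivity

/-- For N ≥ 1 it rests on √(N+1) + √N ≤ 3√N, which turns the difference of the roots into at least
1/(3√N). The `max 1` covers the first probe, N = 0. -/
theorem one_div_sqrt_add_le (N : ℕ) :
    1 / √((max 1 N : ℕ) : ℝ) + 3 * √N ≤ 3 * √((N + 1 : ℕ) : ℝ) := by
  rcases Nat.eq_zero_or_pos N with rfl | hN
  · norm_num
  · rw [max_eq_right hN]
    have hN' : (1 : ℝ) ≤ N := by exact_mod_cast hN
    have ha : 1 ≤ √(N : ℝ) := Real.one_le_sqrt.2 hN'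
    have ha2 : √(N : ℝ) * √N = N := Real.mul_self_sqrt (by linarith)
    have hb2 : √((N + 1 : ℕ) : ℝ) * √((N + 1 : ℕ) : ℝ) = N + 1 := by
      rw [Real.mul_self_sqrt (by positivity)]
      push_cast
      rfl
    set a := √(N : ℝ)
    set b := √((N + 1 : ℕ) : ℝ)
    have hb0 : 0 ≤ b := Real.sqrt_nonneg _
    have hb : b ≤ 2 * a := by
      by_contra! hcon
      nlinarith
    have hab : a ≤ b := by
      by_contra! hcon
      nlinarith
    have : 1 / a ≤ 3 * (b - a) := by
      rw [div_le_iff₀ (by linarith)]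
      nlinarith
    linarith

/-- A radius is paid only when i is probed, and then the sample count grows by one, so the sum
telescopes in the square root of the count. -/
theorem Implements.sum_radius_le (hpol : I.Implements L B T pol) (x : ℕ → Fin I.n → I.X)
    (i : Fin I.n) {t : ℕ} (ht : t ≤ T) :
    ∑ s ∈ Finset.range t,
        (if i ∈ I.probes pol x s then I.radius T (I.history pol x s) i else 0)
      ≤ 21 * √(Nat.clog 2 (I.n * T) : ℕ) * √((samples i (I.history pol x t)).length : ℕ) := by
  induction t with
  | zero =>
    simp only [Finset.range_zero, Finset.sum_empty]
    positivity
  | succ t ih =>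
    rw [Finset.sum_range_succ, hpol.samples_history_succ ht]
    have := ih (by omega)
    split
    · have h := one_div_sqrt_add_le (samples i (I.history pol x t)).length
      have hj : 0 ≤ √(Nat.clog 2 (I.n * T) : ℝ) := Real.sqrt_nonneg _
      have e : I.radius T (I.history pol x t) i = 7 * √(Nat.clog 2 (I.n * T) : ℕ) *
          (1 / √((max 1 (samples i (I.history pol x t)).length : ℕ) : ℝ)) := by
        rw [radius, Real.sqrt_div (by positivity)]
        ring
      rw [e, List.length_cons]
      have := mul_le_mul_of_nonneg_left h (mul_nonneg (by norm_num : (0 : ℝ) ≤ 7) hj)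
      linarith
    · simpa using this

theorem Implements.sum_probedRadius_le (hpol : I.Implements L B T pol)
    (x : ℕ → Fin I.n → I.X) :
    ∑ t ∈ Finset.range T, I.probedRadius T pol x t
      ≤ I.n * (21 * √(Nat.clog 2 (I.n * T) : ℕ) * √T) := by
  unfold probedRadius
  rw [Finset.sum_comm]
  refine (Finset.sum_le_card_nsmul _ _ (21 * √(Nat.clog 2 (I.n * T) : ℕ) * √T) fun i _ => ?_).trans
    (by simp)
  refine (hpol.sum_radius_le x i le_rfl).trans ?_
  gcongr
  exact_mod_cast hpol.length_samples_le i x le_rfl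

end Instance

namespace StochasticProblem

variable {P : StochasticProblem} {I : Instance} {L : Prog} {B T k : ℕ} {α F : ℝ} {V : ℝ≥0}
  {dir : Bool} {τ : List I.Obs → ThresholdTree I.n k I.X}

/-- The expected loss of the online algorithm in one period. -/
theorem sgn_mul_integral_value_le (D : Fin I.n → Measure I.X) [∀ i, IsProbabilityMeasure (D i)]
    (hpol : I.Implements L B T fun H => (τ H).toTree) (hT : 2 ≤ I.n * T)
    (hdir : ∀ E : Fin I.n → Measure I.X, (∀ i, IsProbabilityMeasure (E i)) →
      (∀ i, Favors dir (E i) (D i)) → P.sgn * P.opt I E ≤ P.sgn * P.opt I D)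
    (hα : P.IsRatio α) (hF : I.Bounded F) (hV : I.LeafRegular k V)
    (hτ : ∀ H, (τ H).toTree ∈ I.feasible ∧
      P.IsApprox I α (fun i => distOf (I.estimate dir T H i)) (τ H).toTree) {t : ℕ} (ht : t < T) :
    P.sgn * (∫ x, I.value (τ (I.history (fun H => (τ H).toTree) x t)).toTree (x t) ∂law I D -
        α * P.opt I D)
      ≤ k * (F + V) * ∫ x, I.probedRadius T (fun H => (τ H).toTree) x t ∂law I D +
        F * (law I D).real (I.badEvent (fun H => (τ H).toTree) D T t) := by
  set pol : List I.Obs → I.Policy := fun H => (τ H).toTree with hpdef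
  have hF0 : 0 ≤ F :=
    (hF.expValue_mem D (hτ []).1).1.trans (hF.expValue_mem D (hτ []).1).2
  have hK : 0 ≤ (k : ℝ) * (F + V) := by positivity
  have hvm : Measurable fun x : ℕ → Fin I.n → I.X => I.value (pol (I.history pol x t)) (x t) :=
    hpol.measurable_value ht
  have hvb : ∀ x : ℕ → Fin I.n → I.X, 0 ≤ I.value (pol (I.history pol x t)) (x t) ∧
      I.value (pol (I.history pol x t)) (x t) ≤ F := fun x => hF _ (hτ _).1 _
  obtain ⟨hvi, hve⟩ := Instance.integral_law_eq D t hvm hvb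
  obtain ⟨hwi, hwe⟩ := Instance.integral_law_eq D t (hpol.measurable_probedRadius ht)
    (fun x => Instance.probedRadius_mem x t)
  -- The policy of period t depends only on earlier realizations. Integrating over a fresh
  -- realization of period t gives the expected objective of a fixed policy.
  have hvx : ∀ x : ℕ → Fin I.n → I.X,
      ∫ y, I.value (pol (I.history pol (Function.update x t y) t)) (Function.update x t y t)
        ∂Measure.pi D = I.expValue D (pol (I.history pol x t)) := by
    intro x
    simp only [Function.update_self, Instance.history_update pol x t _ le_rfl]
    rfl
  have hwx : ∀ x : ℕ → Fin I.n → I.X,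
      ∫ y, I.probedRadius T pol (Function.update x t y) t ∂Measure.pi D
        = ∫ y, (τ (I.history pol x t)).probedWeight (I.radius T (I.history pol x t)) y
          ∂Measure.pi D := by
    intro x
    congr 1
    ext y
    rw [Instance.probedRadius, Instance.probes]
    simp only [Function.update_self, Instance.history_update pol x t _ le_rfl]
    exact (Instance.sum_map_eq_sum_ite ((I.probesOnce _ (hτ _).1).items_spec y).1 _).symm
  simp only [hvx] at hvi hve
  simp only [hwx] at hwi hwe
  have hbm := hpol.measurableSet_badEvent D ht.le
  have hpoint : ∀ x : ℕ → Fin I.n → I.X,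
      P.sgn * (I.expValue D (pol (I.history pol x t)) - α * P.opt I D)
        ≤ k * (F + V) * ∫ y, (τ (I.history pol x t)).probedWeight
            (I.radius T (I.history pol x t)) y ∂Measure.pi D +
          F * (I.badEvent pol D T t).indicator 1 x := by
    intro x
    have hw0 : 0 ≤ ∫ y, (τ (I.history pol x t)).probedWeight
        (I.radius T (I.history pol x t)) y ∂Measure.pi D :=
      integral_nonneg fun y => (ThresholdTree.probedWeight_mem
        (fun i => Instance.radius_nonneg _ _ i) (I.probesOnce _ (hτ _).1) y).1
    -- On the bad event the loss is bounded trivially by F; elsewhere the estimates are favorable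
    -- and close.
    by_cases hx : x ∈ I.badEvent pol D T t
    · have := loss_le hF hα D (hτ (I.history pol x t)).1
      simp only [hx, Set.indicator_of_mem, Pi.one_apply, mul_one]
      have := mul_nonneg hK hw0
      linarith
    · set E : Fin I.n → Measure I.X := fun i =>
        distOf (I.estimate dir T (I.history pol x t) i) with hE
      have hEp : ∀ i, IsProbabilityMeasure (E i) := fun i =>
        Instance.isProbabilityMeasure_estimate dir T _ i
      have hspec := fun i S hS => hpol.estimate_spec hT D dir ht hx i (S := S) hS
      have hopt := hdir E hEp fun i => favors_of_closedUnder fun S hS => (hspec i S hS).1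
      have happ := (hτ (I.history pol x t)).2.sgn_mul_le
      have hst := hV.abs_expValue_sub_le hF (D := D) (E := E)
        (fun i => Instance.radius_nonneg T (I.history pol x t) i)
        (fun i => uniformlyClose_of_closedUnder fun S hS => (hspec i S hS).2)
        (hτ (I.history pol x t)).1
      have hs := sgn_mul_le_abs (P := P) (I.expValue D (τ (I.history pol x t)).toTree -
        I.expValue E (τ (I.history pol x t)).toTree)
      have hαo := mul_le_mul_of_nonneg_left hopt hα.nonneg
      simp only [hx, not_false_eq_true, Set.indicator_of_notMem, mul_zero, add_zero]
      -- The approximation guarantee under E and the comparison of the optima bound the value under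
      -- E by α times the optimum under D, up to sign. Only the difference of the values under D and
      -- E is left for stability.
      refine le_trans ?_ (hs.trans hst)
      simp only [hpdef] at hαo happ ⊢
      linarith
  have hbi : Integrable (fun x => F *
      (I.badEvent pol D T t).indicator (1 : (ℕ → Fin I.n → I.X) → ℝ) x) (law I D) :=
    ((integrable_const (1 : ℝ)).indicator hbm).const_mul F
  rw [hve]
  calc P.sgn * (∫ x, I.expValue D (pol (I.history pol x t)) ∂law I D - α * P.opt I D)
      = ∫ x, P.sgn * (I.expValue D (pol (I.history pol x t)) - α * P.opt I D) ∂law I D := by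
        rw [integral_const_mul, integral_sub hvi (integrable_const _)]
        simp
    _ ≤ ∫ x, (k * (F + V) * ∫ y, (τ (I.history pol x t)).probedWeight
            (I.radius T (I.history pol x t)) y ∂Measure.pi D +
          F * (I.badEvent pol D T t).indicator 1 x) ∂law I D := by
        refine integral_mono ((hvi.sub (integrable_const _)).const_mul _)
          ((hwi.const_mul _).add hbi) hpoint
    _ = _ := by
        rw [integral_add (hwi.const_mul _) hbi, integral_const_mul,
          integral_const_mul, ← hwe, integral_indicator_one hbm]

theorem integrable_total (D : Fin I.n → Measure I.X) [∀ i, IsProbabilityMeasure (D i)]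
    {pol : List I.Obs → I.Policy} (hpol : I.Implements L B T pol) (hF : I.Bounded F) {t : ℕ}
    (ht : t < T) : Integrable (fun x => I.value (pol (I.history pol x t)) (x t)) (law I D) :=
  integrable_of_bounded (hpol.measurable_value ht) fun x => hF _ (hpol x t ht).1 _

/-- Rounding up adds at most 1 ≤ log N / log 2, and 2 / log 2 < 3. -/
theorem clog_le_three_mul_log {N : ℕ} (hN : 2 ≤ N) : ((Nat.clog 2 N : ℕ) : ℝ) ≤ 3 * Real.log N := by
  have h := Nat.pow_pred_clog_lt_self (b := 2) (by norm_num) (x := N) (by omega)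
  have hpos := Nat.clog_pos (b := 2) (by norm_num) (n := N) (by omega)
  set j := Nat.clog 2 N
  have h₁ : ((j.pred : ℕ) : ℝ) * Real.log 2 ≤ Real.log N := by
    rw [← Real.log_pow]
    refine Real.log_le_log (by positivity) ?_
    exact_mod_cast h.le
  have h₂ : Real.log 2 ≤ Real.log N := Real.log_le_log (by norm_num) (by exact_mod_cast hN)
  have h₃ : ((j.pred : ℕ) : ℝ) = j - 1 := by
    rw [Nat.pred_eq_sub_one, Nat.cast_sub hpos, Nat.cast_one]
  rw [h₃] at h₁
  nlinarith [Real.log_two_gt_d9, (Nat.cast_nonneg j : (0 : ℝ) ≤ j)]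

/-- The regret of the online algorithm. -/
theorem regret_le (D : Fin I.n → Measure I.X) [∀ i, IsProbabilityMeasure (D i)]
    (hpol : I.Implements L B T fun H => (τ H).toTree) (hT : 2 ≤ I.n * T) (hk : 1 ≤ k)
    (hdir : ∀ E : Fin I.n → Measure I.X, (∀ i, IsProbabilityMeasure (E i)) →
      (∀ i, Favors dir (E i) (D i)) → P.sgn * P.opt I E ≤ P.sgn * P.opt I D)
    (hα : P.IsRatio α) (hF : I.Bounded F) (hV : I.LeafRegular k V)
    (hτ : ∀ H, (τ H).toTree ∈ I.feasible ∧
      P.IsApprox I α (fun i => distOf (I.estimate dir T H i)) (τ H).toTree) :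
    P.regret I α D T (fun H => (τ H).toTree) ≤
      50 * k * I.n * (F + V) * √(T * Real.log (I.n * T)) := by
  have hone := fun t (ht : t ∈ Finset.range T) =>
    sgn_mul_integral_value_le D hpol hT hdir hα hF hV hτ (Finset.mem_range.1 ht)
  set pol : List I.Obs → I.Policy := fun H => (τ H).toTree with hpdef
  have hF0 : 0 ≤ F :=
    (hF.expValue_mem D (hτ []).1).1.trans (hF.expValue_mem D (hτ []).1).2
  have hn : 1 ≤ I.n := Nat.one_le_iff_ne_zero.2 fun h => by simp [h] at hT
  have hT1 : 1 ≤ T := Nat.one_le_iff_ne_zero.2 fun h => by simp [h] at hT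
  have hsum : ∑ t ∈ Finset.range T, ∫ x, I.probedRadius T pol x t ∂law I D
      ≤ I.n * (21 * √(Nat.clog 2 (I.n * T) : ℕ) * √T) := by
    rw [← integral_finsetSum _ fun t ht => integrable_of_bounded
      (hpol.measurable_probedRadius (Finset.mem_range.1 ht))
      fun x => Instance.probedRadius_mem x t]
    refine (integral_mono (integrable_finsetSum _ fun t ht => integrable_of_bounded
      (hpol.measurable_probedRadius (Finset.mem_range.1 ht))
      fun x => Instance.probedRadius_mem x t) (integrable_const _)
      hpol.sum_probedRadius_le).trans (by simp)
  have hbad := hpol.sum_badEvent_le D hT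
  have hreg : P.regret I α D T pol ≤
      k * (F + V) * (I.n * (21 * √(Nat.clog 2 (I.n * T) : ℕ) * √T)) + F * 4 := by
    have e : P.regret I α D T pol = ∑ t ∈ Finset.range T, P.sgn *
        (∫ x, I.value (pol (I.history pol x t)) (x t) ∂law I D - α * P.opt I D) := by
      rw [regret_eq, ← Finset.mul_sum, Finset.sum_sub_distrib]
      unfold Instance.total
      rw [integral_finsetSum _ fun t ht => integrable_total D hpol hF (Finset.mem_range.1 ht)]
      simp
    rw [e]
    refine (Finset.sum_le_sum hone).trans ?_
    rw [Finset.sum_add_distrib, ← Finset.mul_sum, ← Finset.mul_sum]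
    gcongr
  refine hreg.trans ?_
  set w := √(T * Real.log (I.n * T)) with hw
  have hN : ((I.n * T : ℕ) : ℝ) = (I.n : ℝ) * T := by push_cast; rfl
  have hlog : 1 / 4 ≤ Real.log (I.n * T) := by
    have : Real.log 2 ≤ Real.log (I.n * T) := by
      rw [← hN]
      exact Real.log_le_log (by norm_num) (by exact_mod_cast hT)
    linarith [Real.log_two_gt_d9]
  have hTR : (1 : ℝ) ≤ T := by exact_mod_cast hT1
  have hw1 : 1 / 2 ≤ w := by
    refine Real.le_sqrt_of_sq_le ?_
    nlinarith
  -- The factor 3 in j ≤ 3 log(nT) is relaxed to 4, so that its root is 2.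
  have hjw : √(Nat.clog 2 (I.n * T) : ℕ) * √T ≤ 2 * w := by
    rw [← Real.sqrt_mul (by positivity), show (2 : ℝ) * w = √(4 * (T * Real.log (I.n * T))) by
      rw [Real.sqrt_mul (by norm_num), show (4 : ℝ) = 2 ^ 2 by norm_num,
        Real.sqrt_sq (by norm_num)]]
    refine Real.sqrt_le_sqrt ?_
    have := clog_le_three_mul_log hT
    rw [hN] at this
    nlinarith
  have hkn : (1 : ℝ) ≤ k * I.n := by
    have : 1 ≤ k * I.n := Nat.mul_pos hk hn
    exact_mod_cast this
  have hFV : F ≤ F + V := by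
    have : (0 : ℝ) ≤ V := V.2
    linarith
  have hFV0 : 0 ≤ F + V := hF0.trans hFV
  have h₁ : k * (F + V) * (I.n * (21 * √(Nat.clog 2 (I.n * T) : ℕ) * √T))
      ≤ k * (F + V) * (I.n * (21 * (2 * w))) := by
    rw [mul_assoc 21]
    gcongr
  -- The constant cost of the bad events is absorbed by w ≥ 1/2 and kn ≥ 1.
  have h₂ : F * 4 ≤ (k * I.n) * (F + V) * (8 * w) := by
    calc F * 4 ≤ (1 * (F + V)) * 4 := by linarith
      _ ≤ (k * I.n) * (F + V) * (8 * w) := by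
        gcongr
        linarith
  -- The constant is 50 = 21 · 2 + 8.
  calc _ ≤ k * (F + V) * (I.n * (21 * (2 * w))) + (k * I.n) * (F + V) * (8 * w) := add_le_add h₁ h₂
    _ = 50 * k * I.n * (F + V) * w := by ring

end StochasticProblem

end StochOpt

end

open StochOpt in
theorem theorem3p6 :
    ∃ C : ℝ, 0 < C ∧
      ∀ (P : StochasticProblem) (k : Instance → ℕ) (α fmax : Instance → ℝ) (V : Instance → ℝ≥0),
        (P.UpMonotone ∨ P.DownMonotone) →
        (∀ I ∈ P.instances, 1 ≤ k I ∧ P.IsRatio (α I)) →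
        (∀ I ∈ P.instances, I.Bounded (fmax I) ∧ I.LeafRegular (k I) (V I)) →
        P.HasApproxAlgorithm k α →
        ∃ (L : Prog) (q : Polynomial ℕ), ∀ I ∈ P.instances, ∀ T : ℕ, 2 ≤ I.n * T →
          ∃ pol : List I.Obs → I.Policy,
            I.Implements L (q.eval (I.params.size + I.n + T)) T pol ∧
            ∀ (D : Fin I.n → Measure I.X) [∀ i, IsProbabilityMeasure (D i)],
              Integrable (I.total pol T) (StochasticProblem.law I D) ∧
              P.regret I (α I) D T pol ≤
                C * k I * I.n * (fmax I + V I) * Real.sqrt (T * Real.log (I.n * T)) := by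
  refine ⟨50, by norm_num, fun P k α fmax V hmono hratio hreg happrox => ?_⟩
  obtain ⟨dir, hdir⟩ := StochasticProblem.exists_direction hmono
  obtain ⟨L, q, hL⟩ := happrox.exists_online dir
  refine ⟨L, q, fun I hI T hT => ?_⟩
  obtain ⟨τ, hτ, hpol⟩ := hL I hI T
  refine ⟨fun H => (τ H).toTree, hpol, fun D _ => ⟨?_, ?_⟩⟩
  · exact integrable_finsetSum _ fun t ht =>
      StochasticProblem.integrable_total D hpol (hreg I hI).1 (Finset.mem_range.1 ht)
  · exact StochasticProblem.regret_le D hpol hT (hratio I hI).1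
      (fun E hE h => hdir I hI D E inferInstance hE h) (hratio I hI).2 (hreg I hI).1
      (hreg I hI).2 hτ
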